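/- Let $b\ge 2$. For $r\ge 0$ let $T_r$ be the $b$-ary tree with $r$ levels, i.e. the ball of radius $r$ around the root of the infinite $b$-ary tree (in which the root is at distance $0$ and every vertex has $b$ children), and let $n_r$ be its number of vertices. For $\beta\ge 0$ and an external field $H:T_r\to\mathbb R$, the Ising model on $T_r$ gives a configuration $\sigma\in\{-1,1\}^{T_r}$ probability proportional to $$\exp\Big(\beta\sum_{\{v,w\}\in E(T_r)}\sigma(v)\sigma(w)+\sum_{v\in T_r}H(v)\sigma(v)\Big).$$ The (continuous-time, heat-bath) Glauber dynamics updates each vertex $v$ at rate $1$, replacing $\sigma(v)$ by a spin drawn from the Gibbs distribution conditional on the remaining spins; let $\mathcal L$ be its generator and let $0=\lambda_1\le\lambda_2\le\cdots$ be the eigenvalues of $-\mathcal L$, with multiplicity. The relaxation time is $\tau_2(T_r,\beta,H)=1/\lambda_2$; write $\tau_2(T_r,\beta)=\tau_2(T_r,\beta,0)$. Put $\epsilon=\epsilon(\beta)=(1+e^{2\beta})^{-1}$. Then: 1. (All temperatures.) There is a constant $C$ depending only on $b$ such that $\tau_2(T_r,\beta)\le n_r^{C\log(1/\epsilon)}$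 for all $\beta\ge0$ and all $r\ge 0$. Moreover, for every $\beta\ge 0$ the limit $\lim_{r\to\infty}\frac{\log\tau_2(T_r,\beta)}{\log n_r}$ exists and is finite. 2. (Low temperature.) (a) If $1-2\epsilon\ge 1/\sqrt b$, then $\sup_r\tau_2(T_r,\beta)=\infty$. In fact there is $c>0$, depending only on $b$ and $\beta$, such that for all $r$: $\tau_2(T_r,\beta)\ge c\,n_r^{\log_b(b(1-2\epsilon)^2)}$ if $1-2\epsilon>1/\sqrt b$, and $\tau_2(T_r,\beta)\ge c\log n_r$ if $1-2\epsilon=1/\sqrt b$. (b) The degree of $\tau_2$ tends to infinity as $\epsilon\to0$: there are $c>0$ and $\epsilon_0>0$, depending only on $b$, such that $\tau_2(T_r,\beta)\ge n_r^{c\log(1/\epsilon)}$ for all $r$ whenever $\epsilon<\epsilon_0$; in particular $\lim_{r\to\infty}\frac{\log\tau_2(T_r,\beta)}{\log n_r}\to\infty$ as $\beta\to\infty$. 3. (Intermediate and high temperature.) If $1-2\epsilon<1/\sqrt b$, then there is a constant $C$, depending only on $b$ and $\beta$, such that $\tau_2(T_r,\beta,H)\le C$ for all $r\ge 0$ and every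 external field $H:T_r\to\mathbb R$. -/

import Mathlib

open Filter Topology

noncomputable section

/-! ### The Ising model on a finite graph and its heat-bath Glauber dynamics -/

section Ising

variable {V : Type} [Fintype V] [DecidableEq V]

/-- The spin `σ v ∈ {-1, 1}` as a real number. A configuration is a function `σ : V → ℤˣ`. -/
def spin (σ : V → ℤˣ) (v : V) : ℝ := ((σ v : ℤ) : ℝ)

/-- The unnormalised weight
`exp (β ∑_{ {v,w} ∈ E } σ(v) σ(w) + ∑_v H(v) σ(v))` of a configuration, at inverse temperature `β`
and with external field `H`. -/
def isingWeight (G : SimpleGraph V) [DecidableRel G.Adj] (β : ℝ) (H : V → ℝ)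
    (σ : V → ℤˣ) : ℝ :=
  Real.exp (β * ∑ e ∈ G.edgeFinset,
      Sym2.lift ⟨fun v w => spin σ v * spin σ w, fun _ _ => mul_comm _ _⟩ e
    + ∑ v, H v * spin σ v)

/-- The Gibbs distribution of the Ising model. -/
def isingGibbs (G : SimpleGraph V) [DecidableRel G.Adj] (β : ℝ) (H : V → ℝ)
    (σ : V → ℤˣ) : ℝ :=
  isingWeight G β H σ / ∑ η, isingWeight G β H η

/-- The heat-bath rate `K[σ → σ_v^a]`: the conditional Gibbs probability that the spin at `v`
is `a`, given that the configuration agrees with `σ` off `v`. Here `σ_v^a` is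
`Function.update σ v a`. -/
def heatBathRate (G : SimpleGraph V) [DecidableRel G.Adj] (β : ℝ) (H : V → ℝ)
    (σ : V → ℤˣ) (v : V) (a : ℤˣ) : ℝ :=
  isingGibbs G β H (Function.update σ v a) /
    ∑ a' : ℤˣ, isingGibbs G β H (Function.update σ v a')

/-- The generator of continuous-time heat-bath Glauber dynamics,
`(L f)(σ) = ∑_v ∑_a K[σ → σ_v^a] (f (σ_v^a) - f σ)`. -/
def glauberGenerator (G : SimpleGraph V) [DecidableRel G.Adj] (β : ℝ) (H : V → ℝ) :
    ((V → ℤˣ) → ℝ) →ₗ[ℝ] ((V → ℤˣ) → ℝ) where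
  toFun f σ := ∑ v, ∑ a : ℤˣ,
    heatBathRate G β H σ v a * (f (Function.update σ v a) - f σ)
  map_add' f g := by
    funext σ
    simp only [Pi.add_apply, ← Finset.sum_add_distrib]
    refine Finset.sum_congr rfl fun v _ => Finset.sum_congr rfl fun a _ => ?_
    ring
  map_smul' c f := by
    funext σ
    simp only [Pi.smul_apply, smul_eq_mul, RingHom.id_apply, Finset.mul_sum]
    refine Finset.sum_congr rfl fun v _ => Finset.sum_congr rfl fun a _ => ?_
    ring

/-- The spectral gap of a reversible generator `L`: if `λ₁ ≤ λ₂ ≤ … ≤ λ_k` are the eigenvalues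
of `-L`, listed with multiplicity, it is `λ₂` (the entry of index `1` in the sorted list). -/
def spectralGap {S : Type} [Fintype S] (L : (S → ℝ) →ₗ[ℝ] (S → ℝ)) : ℝ :=
  ((-L).charpoly.roots.sort (· ≤ ·)).getD 1 0

/-- The relaxation time `τ₂` of Glauber dynamics: the inverse of the spectral gap. -/
def relaxationTime (G : SimpleGraph V) [DecidableRel G.Adj] (β : ℝ) (H : V → ℝ) : ℝ :=
  (spectralGap (glauberGenerator G β H))⁻¹

end Ising

/-! ### The `b`-ary tree with `r` levels -/

/-- The infinite `b`-ary tree: the vertices are the words over `b` letters, the root is the empty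
word, and the children of a word `w` are the words `a :: w`. -/
def infiniteTree (b : ℕ) : SimpleGraph (List (Fin b)) where
  Adj v w := (∃ a, w = a :: v) ∨ (∃ a, v = a :: w)
  symm := ⟨fun _ _ h => h.symm⟩
  loopless := ⟨fun v h => by
    rcases h with ⟨a, h⟩ | ⟨a, h⟩ <;> simpa using congrArg List.length h⟩

instance (b : ℕ) : DecidableRel (infiniteTree b).Adj := fun v w =>
  inferInstanceAs (Decidable ((∃ a, w = a :: v) ∨ (∃ a, v = a :: w)))

/-- The vertices at distance at most `r` from the root (the length of a word is its distance
from the root). -/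
abbrev TreeVertex (b r : ℕ) : Type := {w : List (Fin b) // w.length ≤ r}

instance (b r : ℕ) : Fintype (TreeVertex b r) :=
  @Fintype.ofFinite _ (List.finite_length_le (Fin b) r).to_subtype

/-- The `b`-ary tree `T_r` with `r` levels below the root, an induced subgraph of the infinite
tree. -/
def tree (b r : ℕ) : SimpleGraph (TreeVertex b r) :=
  (infiniteTree b).comap Subtype.val

instance (b r : ℕ) : DecidableRel (tree b r).Adj := fun v w =>
  inferInstanceAs (Decidable ((infiniteTree b).Adj v.1 w.1))

/-- The number `n_r` of vertices of `T_r`. -/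
def treeSize (b r : ℕ) : ℕ := Fintype.card (TreeVertex b r)

/-- `τ₂(T_r, β)`: the relaxation time on `T_r` at inverse temperature `β`, without external
field. -/
def treeRelaxationTime (b r : ℕ) (β : ℝ) : ℝ :=
  relaxationTime (tree b r) β (fun _ => 0)

/-- `ε = (1 + e^{2β})⁻¹`. -/
def eps (β : ℝ) : ℝ := (1 + Real.exp (2 * β))⁻¹

end

/-! In L²(w), with w the Gibbs weight, resampling the spin at v is the orthogonal projection E_v
(`condAvg w {v}`). Hence -L = ∑_v (1 - E_v), its Dirichlet form is the sum of the mean conditional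
variances `energy w {v} f`, and τ₂ is the best constant in the Poincaré inequality for w
(`relaxationTime_le`, `relaxationTime_spec`). Upper bounds are Poincaré inequalities; lower bounds
come from test functions. Write θ = 1 - 2ε = tanh β.

Below the threshold. θ bounds the influence between neighbours under every field and boundary
condition (`abs_prob_sub_le`). Let T be the average over s mod N of the conditional expectations
given the levels congruent to s. Measure the oscillation of f at depth k in units of b^(-k/2):
passing an influence down to b children or up to the parent then costs the same factor q = θ√b < 1.
So integrating out spins inflates the weighted oscillations by at most S², where S = 1/(1-q). A spin
is retained in only one of the N terms of T, so T halves the oscillations once N ≥ 2S².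
Self-adjointness turns this decay into an L² bound (`sum_mul_le_of_iterate_bound`), that is, a
Poincaré inequality for blocks (`energy_univ_le_slab`). The components of the blocks have bounded
size, so a crude comparison with a product measure finishes (`blockPoincare_slab`).

All temperatures. Split the variance on T_(r+s) at level r. In zero field the top r levels are
distributed as the model on T_r, and each subtree hanging from level r is a copy of T_s up to the
one edge above it. This gives τ_(r+s) ≤ 2 e^(2β) τ_r τ_s (`treeRelaxationTime_add_le`). Adding one
level at a time yields the polynomial bound, and Fekete's lemma the limiting exponent.

Lower bounds. The sum of the leaf spins has second moment at least (bθ)^(2r), with an extra factor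
linear in r at criticality, while each of the b^r leaves contributes at most 1 to the Dirichlet form
(`levelMoment_succ`). As ε → 0 a better test function is recursive majority over three of the
grandchildren, available for every b ≥ 2: it recovers the root spin up to error 10ε, so two of its
sub-estimates disagree with probability at most 24ε, and the expected number of pivotal leaves
shrinks by 72ε every two levels (`pivotalSum_le`). Independence in different subtrees comes from
exchanging subtrees between two independent configurations (`mean_mul_of_regraft`). -/

set_option linter.unusedSectionVars false

noncomputable section

/-! ### Uniform averages over blocks of spins. -/

section Averages

variable {V : Type} [DecidableEq V]

/-- `f` does not depend on the spins in `A`. -/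
def IndepOf (A : Finset V) (f : (V → ℤˣ) → ℝ) : Prop :=
  ∀ σ τ : V → ℤˣ, (∀ v, v ∉ A → σ v = τ v) → f σ = f τ

lemma IndepOf.mono {A B : Finset V} {f : (V → ℤˣ) → ℝ} (hf : IndepOf B f) (h : A ⊆ B) :
    IndepOf A f :=
  fun σ τ hστ => hf σ τ fun v hv => hστ v fun hA => hv (h hA)

lemma IndepOf.const (A : Finset V) (c : ℝ) : IndepOf A (fun _ : V → ℤˣ => c) :=
  fun _ _ _ => rfl

lemma IndepOf.mul {A : Finset V} {f g : (V → ℤˣ) → ℝ} (hf : IndepOf A f) (hg : IndepOf A g) :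
    IndepOf A (fun σ => f σ * g σ) :=
  fun σ τ h => by simp only [hf σ τ h, hg σ τ h]

lemma IndepOf.div {A : Finset V} {f g : (V → ℤˣ) → ℝ} (hf : IndepOf A f) (hg : IndepOf A g) :
    IndepOf A (fun σ => f σ / g σ) :=
  fun σ τ h => by simp only [hf σ τ h, hg σ τ h]

lemma IndepOf.sub {A : Finset V} {f g : (V → ℤˣ) → ℝ} (hf : IndepOf A f) (hg : IndepOf A g) :
    IndepOf A (fun σ => f σ - g σ) :=
  fun σ τ h => by simp only [hf σ τ h, hg σ τ h]

lemma IndepOf.piecewise {A : Finset V} {f : (V → ℤˣ) → ℝ} (hf : IndepOf A f) (η σ : V → ℤˣ) :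
    f (A.piecewise η σ) = f σ :=
  hf _ _ fun v hv => by simp [hv]

lemma IndepOf.update {A : Finset V} {f : (V → ℤˣ) → ℝ} (hf : IndepOf A f) {v : V} (hv : v ∈ A)
    (σ : V → ℤˣ) (a : ℤˣ) : f (Function.update σ v a) = f σ :=
  hf _ _ fun w hw => by
    rw [Function.update_of_ne]
    rintro rfl
    exact hw hv

variable [Fintype V]

/-- The average of `f` over all spins in `A`, the other spins being fixed. -/
def av (A : Finset V) (f : (V → ℤˣ) → ℝ) (σ : V → ℤˣ) : ℝ :=
  (Fintype.card (V → ℤˣ) : ℝ)⁻¹ * ∑ η : V → ℤˣ, f (A.piecewise η σ)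

lemma card_cfg_pos : (0 : ℝ) < Fintype.card (V → ℤˣ) := by
  exact_mod_cast Fintype.card_pos

/-- Resampling the spins in `B` leaves the counting measure invariant. -/
lemma sum_sum_piecewise (B : Finset V) (F : (V → ℤˣ) → ℝ) :
    ∑ η : V → ℤˣ, ∑ ζ : V → ℤˣ, F (B.piecewise ζ η)
      = (Fintype.card (V → ℤˣ) : ℝ) * ∑ η, F η := by
  have h1 : ∑ η : V → ℤˣ, ∑ ζ : V → ℤˣ, F (B.piecewise ζ η)
      = ∑ q : (V → ℤˣ) × (V → ℤˣ), F (B.piecewise q.2 q.1) := by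
    rw [Fintype.sum_prod_type]
  -- Exchanging the coordinates in `B` between two configurations is an involution on pairs.
  have hinv : Function.Involutive
      (fun q : (V → ℤˣ) × (V → ℤˣ) => (B.piecewise q.2 q.1, B.piecewise q.1 q.2)) := by
    rintro ⟨x, y⟩
    ext v <;> by_cases hv : v ∈ B <;> simp [hv]
  have h2 : ∑ q : (V → ℤˣ) × (V → ℤˣ), F (B.piecewise q.2 q.1)
      = ∑ q : (V → ℤˣ) × (V → ℤˣ), F q.1 :=
    Fintype.sum_equiv hinv.toPerm _ _ fun q => rfl
  rw [h1, h2, Fintype.sum_prod_type]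
  simp [Finset.mul_sum]

lemma av_indepOf_of {A C : Finset V} {f : (V → ℤˣ) → ℝ} (hf : IndepOf C f) :
    IndepOf C (av A f) := by
  intro σ τ h
  unfold av
  congr 1
  refine Finset.sum_congr rfl fun η _ => hf _ _ fun v hv => ?_
  by_cases hA : v ∈ A <;> simp [hA, h v hv]

lemma av_indepOf (A : Finset V) (f : (V → ℤˣ) → ℝ) : IndepOf A (av A f) := by
  intro σ τ h
  unfold av
  congr 1
  refine Finset.sum_congr rfl fun η _ => ?_
  congr 1
  ext v
  by_cases hA : v ∈ A <;> simp [hA, h]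

lemma av_mul_left {A : Finset V} {g : (V → ℤˣ) → ℝ} (hg : IndepOf A g) (f : (V → ℤˣ) → ℝ)
    (σ : V → ℤˣ) : av A (fun τ => g τ * f τ) σ = g σ * av A f σ := by
  unfold av
  simp only [hg.piecewise, ← Finset.mul_sum]
  ring

lemma av_mul_right {A : Finset V} {g : (V → ℤˣ) → ℝ} (hg : IndepOf A g) (f : (V → ℤˣ) → ℝ)
    (σ : V → ℤˣ) : av A (fun τ => f τ * g τ) σ = av A f σ * g σ := by
  simp only [mul_comm _ (g _)]
  exact av_mul_left hg f σ

/-- Resampling the overlap a second time changes nothing, by `sum_sum_piecewise`. -/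
lemma av_av (A B : Finset V) (f : (V → ℤˣ) → ℝ) (σ : V → ℤˣ) :
    av A (av B f) σ = av (A ∪ B) f σ := by
  have key : ∀ η ζ : V → ℤˣ, B.piecewise ζ (A.piecewise η σ)
      = (A ∪ B).piecewise (B.piecewise ζ η) σ := by
    intro η ζ
    ext v
    by_cases hA : v ∈ A <;> by_cases hB : v ∈ B <;> simp [hA, hB]
  have hc := card_cfg_pos (V := V)
  unfold av
  simp only [key]
  rw [← Finset.mul_sum,
    sum_sum_piecewise B (fun η => f ((A ∪ B).piecewise η σ)), inv_mul_cancel_left₀ hc.ne']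

lemma av_univ (f : (V → ℤˣ) → ℝ) (σ : V → ℤˣ) :
    av Finset.univ f σ = (Fintype.card (V → ℤˣ) : ℝ)⁻¹ * ∑ η, f η := by
  simp [av]

lemma sum_av (A : Finset V) (f : (V → ℤˣ) → ℝ) : ∑ σ, av A f σ = ∑ σ, f σ := by
  have hc := card_cfg_pos (V := V)
  have h := av_av Finset.univ A f 1
  rw [Finset.union_eq_left.2 (Finset.subset_univ A), av_univ, av_univ] at h
  exact mul_left_cancel₀ (inv_ne_zero hc.ne') h

lemma av_pos {w : (V → ℤˣ) → ℝ} (hw : ∀ σ, 0 < w σ) (A : Finset V) (σ : V → ℤˣ) :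
    0 < av A w σ :=
  mul_pos (inv_pos.2 card_cfg_pos) (Finset.sum_pos (fun _ _ => hw _) Finset.univ_nonempty)

lemma sum_cfg_apply (v : V) (φ : ℤˣ → ℝ) :
    ∑ η : V → ℤˣ, φ (η v) = (Fintype.card (V → ℤˣ) : ℝ) / 2 * ∑ a : ℤˣ, φ a := by
  have h1 : ∀ a : ℤˣ, ∑ η : V → ℤˣ, φ (a * η v) = ∑ η : V → ℤˣ, φ (η v) := by
    intro a
    refine Fintype.sum_equiv (Equiv.mulLeft (fun _ : V => a)) _ _ fun η => by simp
  have h2 : ∑ a : ℤˣ, ∑ η : V → ℤˣ, φ (a * η v) = 2 * ∑ η : V → ℤˣ, φ (η v) := by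
    simp [h1]
  rw [Finset.sum_comm] at h2
  have h3 : ∀ c : ℤˣ, ∑ a : ℤˣ, φ (a * c) = ∑ a : ℤˣ, φ a := fun c =>
    Fintype.sum_equiv (Equiv.mulRight c) _ _ fun a => rfl
  simp only [h3, Finset.sum_const, Finset.card_univ, nsmul_eq_mul] at h2
  linarith

lemma av_singleton (v : V) (f : (V → ℤˣ) → ℝ) (σ : V → ℤˣ) :
    av {v} f σ = (∑ a : ℤˣ, f (Function.update σ v a)) / 2 := by
  have hc := card_cfg_pos (V := V)
  unfold av
  have : ∀ η : V → ℤˣ, ({v} : Finset V).piecewise η σ = Function.update σ v (η v) := by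
    intro η
    rw [Finset.piecewise_singleton]
  simp only [this]
  rw [sum_cfg_apply v (fun a => f (Function.update σ v a))]
  field_simp

end Averages

/-! ### Conditional expectations, conditional variances and block Poincaré inequalities. -/

section ConditionalAverages

variable {V : Type} [DecidableEq V] [Fintype V]

/-- The conditional expectation of `f` given the spins outside `A`, under the measure with
density proportional to `w`. -/
def condAvg (w : (V → ℤˣ) → ℝ) (A : Finset V) (f : (V → ℤˣ) → ℝ) (σ : V → ℤˣ) : ℝ :=
  av A (fun τ => w τ * f τ) σ / av A w σ

/-- The (unnormalised) mean conditional variance of `f` given the spins outside `A`. -/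
def energy (w : (V → ℤˣ) → ℝ) (A : Finset V) (f : (V → ℤˣ) → ℝ) : ℝ :=
  ∑ σ, w σ * (f σ - condAvg w A f σ) ^ 2

variable {w : (V → ℤˣ) → ℝ}

lemma condAvg_indepOf (w : (V → ℤˣ) → ℝ) (A : Finset V) (f : (V → ℤˣ) → ℝ) :
    IndepOf A (condAvg w A f) :=
  (av_indepOf A _).div (av_indepOf A _)

lemma condAvg_sub (A : Finset V) (f g : (V → ℤˣ) → ℝ) (σ : V → ℤˣ) :
    condAvg w A (fun τ => f τ - g τ) σ = condAvg w A f σ - condAvg w A g σ := by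
  unfold condAvg av
  rw [← sub_div, ← mul_sub, ← Finset.sum_sub_distrib]
  simp only [mul_sub]

lemma condAvg_of_indepOf (hw : ∀ σ, 0 < w σ) {A : Finset V} {g : (V → ℤˣ) → ℝ}
    (hg : IndepOf A g) (σ : V → ℤˣ) : condAvg w A g σ = g σ := by
  unfold condAvg
  rw [av_mul_right hg, mul_div_cancel_left₀ _ (av_pos hw A σ).ne']

/-- Averaging over the spins in `A` first removes the normalisation of `condAvg`. This makes
`condAvg w A` the orthogonal projection of L²(w) onto the functions independent of `A`, from which
all the variance identities follow. -/
lemma sum_mul_condAvg (hw : ∀ σ, 0 < w σ) {A : Finset V} {g : (V → ℤˣ) → ℝ}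
    (hg : IndepOf A g) (f : (V → ℤˣ) → ℝ) :
    ∑ σ, w σ * (g σ * condAvg w A f σ) = ∑ σ, w σ * (g σ * f σ) := by
  rw [← sum_av A, ← sum_av A (fun σ => w σ * (g σ * f σ))]
  refine Finset.sum_congr rfl fun σ _ => ?_
  rw [av_mul_right (hg.mul (condAvg_indepOf w A f))]
  have : av A (fun σ => w σ * (g σ * f σ)) σ = g σ * av A (fun σ => w σ * f σ) σ := by
    rw [← av_mul_left hg]
    congr 1
    ext τ
    ring
  rw [this, condAvg]
  field_simp [(av_pos hw A σ).ne']

lemma sum_mul_sub_condAvg (hw : ∀ σ, 0 < w σ) {A : Finset V} {g : (V → ℤˣ) → ℝ}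
    (hg : IndepOf A g) (f : (V → ℤˣ) → ℝ) :
    ∑ σ, w σ * (g σ * (f σ - condAvg w A f σ)) = 0 := by
  have h := sum_mul_condAvg hw hg f
  simp only [mul_sub, Finset.sum_sub_distrib]
  linarith

/-- Pythagoras for that projection. It yields the variational principle `energy_le`: any guess `g`
independent of `A` bounds the energy from above, so conditional expectations seldom have to be
computed. -/
lemma sum_sq_sub_eq (hw : ∀ σ, 0 < w σ) {A : Finset V} {g : (V → ℤˣ) → ℝ}
    (hg : IndepOf A g) (f : (V → ℤˣ) → ℝ) :
    ∑ σ, w σ * (f σ - g σ) ^ 2 = energy w A f + ∑ σ, w σ * (condAvg w A f σ - g σ) ^ 2 := by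
  have h := sum_mul_sub_condAvg hw ((condAvg_indepOf w A f).sub hg) f
  unfold energy
  have : ∑ σ, w σ * (f σ - g σ) ^ 2
      = ∑ σ, w σ * (f σ - condAvg w A f σ) ^ 2 + ∑ σ, w σ * (condAvg w A f σ - g σ) ^ 2
        + 2 * ∑ σ, w σ * ((condAvg w A f σ - g σ) * (f σ - condAvg w A f σ)) := by
    rw [Finset.mul_sum, ← Finset.sum_add_distrib, ← Finset.sum_add_distrib]
    refine Finset.sum_congr rfl fun σ _ => ?_
    ring
  rw [this, h]
  ring

lemma energy_le (hw : ∀ σ, 0 < w σ) {A : Finset V} {g : (V → ℤˣ) → ℝ}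
    (hg : IndepOf A g) (f : (V → ℤˣ) → ℝ) :
    energy w A f ≤ ∑ σ, w σ * (f σ - g σ) ^ 2 := by
  rw [sum_sq_sub_eq hw hg]
  exact le_add_of_nonneg_right (Finset.sum_nonneg fun σ _ => mul_nonneg (hw σ).le (sq_nonneg _))

lemma energy_nonneg (hw : ∀ σ, 0 < w σ) (A : Finset V) (f : (V → ℤˣ) → ℝ) : 0 ≤ energy w A f :=
  Finset.sum_nonneg fun σ _ => mul_nonneg (hw σ).le (sq_nonneg _)

lemma energy_mono (hw : ∀ σ, 0 < w σ) {A B : Finset V} (h : A ⊆ B) (f : (V → ℤˣ) → ℝ) :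
    energy w A f ≤ energy w B f :=
  energy_le hw ((condAvg_indepOf w B f).mono h) f

lemma sum_sq_condAvg_le (hw : ∀ σ, 0 < w σ) (A : Finset V) (f : (V → ℤˣ) → ℝ) :
    ∑ σ, w σ * condAvg w A f σ ^ 2 ≤ ∑ σ, w σ * f σ ^ 2 := by
  have h := sum_sq_sub_eq hw (IndepOf.const A 0) f
  simp only [sub_zero] at h
  rw [h]
  exact le_add_of_nonneg_left (energy_nonneg hw A f)

lemma energy_eq_zero_of_indepOf (hw : ∀ σ, 0 < w σ) {A : Finset V} {f : (V → ℤˣ) → ℝ}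
    (hf : IndepOf A f) : energy w A f = 0 := by
  unfold energy
  simp [condAvg_of_indepOf hw hf]

/-- `⟨f - E_A f, f⟩ = ‖f - E_A f‖²`. -/
lemma sum_sub_condAvg_mul (hw : ∀ σ, 0 < w σ) (A : Finset V) (f : (V → ℤˣ) → ℝ) :
    ∑ σ, w σ * ((f σ - condAvg w A f σ) * f σ) = energy w A f := by
  have h := sum_mul_sub_condAvg hw (condAvg_indepOf w A f) f
  unfold energy
  rw [← add_zero (∑ σ, w σ * (f σ - condAvg w A f σ) ^ 2), ← h, ← Finset.sum_add_distrib]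
  refine Finset.sum_congr rfl fun σ _ => ?_
  ring

lemma condAvg_symm (hw : ∀ σ, 0 < w σ) (A : Finset V) (f g : (V → ℤˣ) → ℝ) :
    ∑ σ, w σ * (f σ * condAvg w A g σ) = ∑ σ, w σ * (condAvg w A f σ * g σ) := by
  rw [← sum_mul_condAvg hw (condAvg_indepOf w A f) g]
  have := sum_mul_condAvg hw (condAvg_indepOf w A g) f
  simp only [mul_comm (condAvg w A g _)] at this
  exact this.symm

/-- The weight `w` has no interaction between the spins in `A` and those in `B`. -/
def Separates (w : (V → ℤˣ) → ℝ) (A B : Finset V) : Prop :=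
  Disjoint A B ∧ ∃ g h : (V → ℤˣ) → ℝ, (∀ σ, w σ = g σ * h σ) ∧ IndepOf A g ∧ IndepOf B h

lemma Separates.symm {A B : Finset V} (h : Separates w A B) : Separates w B A := by
  obtain ⟨hd, g, h, hw, hg, hh⟩ := h
  exact ⟨hd.symm, h, g, fun σ => by rw [hw, mul_comm], hh, hg⟩

/-- The factor of `w` that is free of `B` cancels from `condAvg w B f`. What remains in front of the
average over `B` is `g / av B g`, which is free of `A` and so cancels from the outer conditional
expectation. -/
lemma Separates.condAvg_condAvg (hw : ∀ σ, 0 < w σ) {A B : Finset V} (hs : Separates w A B)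
    (f : (V → ℤˣ) → ℝ) : condAvg w A (condAvg w B f) = condAvg w (A ∪ B) f := by
  obtain ⟨hd, g, h, hgh, hg, hh⟩ := hs
  have hgne : ∀ σ, g σ ≠ 0 := fun σ h0 => by have := hw σ; simp [hgh, h0] at this
  have hhne : ∀ σ, h σ ≠ 0 := fun σ h0 => by have := hw σ; simp [hgh, h0] at this
  have hB : ∀ φ : (V → ℤˣ) → ℝ, ∀ σ, av B (fun τ => w τ * φ τ) σ
      = h σ * av B (fun τ => g τ * φ τ) σ := by
    intro φ σ
    rw [← av_mul_left hh]
    congr 1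
    ext τ
    rw [hgh]; ring
  have hB1 : ∀ σ, av B w σ = h σ * av B g σ := by
    intro σ
    simpa using hB (fun _ => 1) σ
  have hBne : ∀ σ, av B g σ ≠ 0 := fun σ h0 => by
    have := av_pos hw B σ
    simp [hB1, h0] at this
  have hEB : ∀ σ, condAvg w B f σ = av B (fun τ => g τ * f τ) σ / av B g σ := by
    intro σ
    rw [condAvg, hB, hB1, mul_div_mul_left _ _ (hhne σ)]
  have hgB : IndepOf A (av B g) := av_indepOf_of hg
  funext σ
  have hnum : av A (fun τ => w τ * condAvg w B f τ) σ
      = g σ / av B g σ * av (A ∪ B) (fun τ => w τ * f τ) σ := by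
    rw [← av_av, ← av_mul_left (hg.div hgB)]
    congr 1
    ext τ
    rw [hB, hEB, hgh]
    field_simp [hBne τ]
  have hden : av A w σ = g σ / av B g σ * av (A ∪ B) w σ := by
    rw [← av_av, ← av_mul_left (hg.div hgB)]
    congr 1
    ext τ
    rw [hB1, hgh]
    field_simp [hBne τ]
  rw [condAvg, hnum, hden, mul_div_mul_left _ _ (div_ne_zero (hgne σ) (hBne σ)), condAvg]

lemma condAvg_condAvg_of_subset (hw : ∀ σ, 0 < w σ) {A B : Finset V} (h : A ⊆ B)
    (f : (V → ℤˣ) → ℝ) : condAvg w B (condAvg w A f) = condAvg w B f := by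
  funext σ
  unfold condAvg
  congr 1
  rw [← Finset.union_eq_left.2 h, ← av_av, ← av_av]
  congr 1
  ext τ
  change av A (fun τ => w τ * condAvg w A f τ) τ = _
  rw [av_mul_right (condAvg_indepOf w A f), condAvg]
  field_simp [(av_pos hw A τ).ne']

lemma condAvg_condAvg_of_superset (hw : ∀ σ, 0 < w σ) {A B : Finset V} (h : A ⊆ B)
    (f : (V → ℤˣ) → ℝ) : condAvg w A (condAvg w B f) = condAvg w B f := by
  funext σ
  exact condAvg_of_indepOf hw ((condAvg_indepOf w B f).mono h) σ

/-- Tensorisation of the variance: by Pythagoras the excess over `energy w A f` is the squared norm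
of E_A f - E_(A∪B) f = E_A (f - E_B f), and E_A is a contraction. -/
lemma Separates.energy_union_le (hw : ∀ σ, 0 < w σ) {A B : Finset V} (hs : Separates w A B)
    (f : (V → ℤˣ) → ℝ) : energy w (A ∪ B) f ≤ energy w A f + energy w B f := by
  have h1 := sum_sq_sub_eq hw ((condAvg_indepOf w (A ∪ B) f).mono Finset.subset_union_left) f
  change energy w (A ∪ B) f = _ at h1
  rw [h1]
  gcongr
  have h2 := sum_sq_condAvg_le hw A (fun τ => f τ - condAvg w B f τ)
  simp only [condAvg_sub, hs.condAvg_condAvg hw] at h2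
  exact h2

/-- Poincaré inequality for the conditional measures on the block `A`. -/
def BlockPoincare (w : (V → ℤˣ) → ℝ) (A : Finset V) (K : ℝ) : Prop :=
  ∀ f : (V → ℤˣ) → ℝ, energy w A f ≤ K * ∑ v ∈ A, energy w {v} f

/-- Holley–Stroock perturbation. Since an energy is a minimum over guesses, the conditional
expectation of one measure serves as a guess for the other; the change of weight costs `exp Δ` once
on each side. -/
lemma BlockPoincare.of_comparable {w' : (V → ℤˣ) → ℝ} (hw : ∀ σ, 0 < w σ)
    (hw' : ∀ σ, 0 < w' σ) {A : Finset V} {K Δ : ℝ} (hK : 0 ≤ K)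
    (h1 : ∀ σ, w' σ ≤ Real.exp Δ * w σ) (h2 : ∀ σ, w σ ≤ Real.exp Δ * w' σ)
    (h : BlockPoincare w A K) : BlockPoincare w' A (K * Real.exp (2 * Δ)) := by
  have key : ∀ (w w' : (V → ℤˣ) → ℝ), (∀ σ, 0 < w σ) → (∀ σ, 0 < w' σ) →
      (∀ σ, w' σ ≤ Real.exp Δ * w σ) → ∀ B f, energy w' B f ≤ Real.exp Δ * energy w B f := by
    intro w w' hw hw' h1 B f
    refine (energy_le hw' (condAvg_indepOf w B f) f).trans ?_
    unfold energy
    rw [Finset.mul_sum]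
    refine Finset.sum_le_sum fun σ _ => ?_
    rw [← mul_assoc]
    exact mul_le_mul_of_nonneg_right (h1 σ) (sq_nonneg _)
  intro f
  calc energy w' A f ≤ Real.exp Δ * energy w A f := key w w' hw hw' h1 A f
    _ ≤ Real.exp Δ * (K * ∑ v ∈ A, energy w {v} f) := by gcongr; exact h f
    _ ≤ Real.exp Δ * (K * ∑ v ∈ A, Real.exp Δ * energy w' {v} f) := by
        gcongr with v hv
        exact key w' w hw' hw h2 {v} f
    _ = K * Real.exp (2 * Δ) * ∑ v ∈ A, energy w' {v} f := by
        rw [← Finset.mul_sum, two_mul, Real.exp_add]; ring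

end ConditionalAverages

/-! ### Spectral gap and Poincaré constant of a reversible generator. -/

section Spectral

variable {S : Type} [Fintype S] {w : S → ℝ}

/-- The isometry from `L²(w)` onto Euclidean space. -/
def weightedEquiv (w : S → ℝ) (hw : ∀ s, 0 < w s) : (S → ℝ) ≃ₗ[ℝ] EuclideanSpace ℝ S :=
  (LinearEquiv.piCongrRight fun s =>
    LinearEquiv.smulOfNeZero ℝ ℝ (Real.sqrt (w s)) (Real.sqrt_pos.2 (hw s)).ne').trans
    (WithLp.linearEquiv 2 ℝ (S → ℝ)).symm

lemma inner_weightedEquiv (hw : ∀ s, 0 < w s) (f g : S → ℝ) :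
    inner ℝ (weightedEquiv w hw f) (weightedEquiv w hw g) = ∑ s, w s * (f s * g s) := by
  rw [PiLp.inner_apply]
  refine Finset.sum_congr rfl fun s _ => ?_
  have : (weightedEquiv w hw f) s = Real.sqrt (w s) * f s := rfl
  have h2 : (weightedEquiv w hw g) s = Real.sqrt (w s) * g s := rfl
  rw [this, h2]
  simp only [RCLike.inner_apply, conj_trivial]
  linear_combination (f s * g s) * Real.mul_self_sqrt (hw s).le

/-- Spectral decomposition of an operator that is self-adjoint on `L²(w)`. -/
lemma exists_eigenbasis (hw : ∀ s, 0 < w s) (T : (S → ℝ) →ₗ[ℝ] (S → ℝ))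
    (hT : ∀ f g, ∑ s, w s * (T f s * g s) = ∑ s, w s * (f s * T g s)) :
    ∃ (φ : Fin (Fintype.card S) → S → ℝ) (e : Fin (Fintype.card S) → ℝ),
      T.charpoly.roots = Multiset.map e Finset.univ.val ∧
      (∀ i, T (φ i) = e i • φ i) ∧
      (∀ i j, ∑ s, w s * (φ i s * φ j s) = if i = j then 1 else 0) ∧
      (∀ f g : S → ℝ, ∑ i, (∑ s, w s * (f s * φ i s)) * (∑ s, w s * (g s * φ i s))
        = ∑ s, w s * (f s * g s)) := by
  set E := weightedEquiv w hw with hE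
  have hsym : LinearMap.IsSymmetric (E.conj T) := by
    intro x y
    obtain ⟨f, rfl⟩ := E.surjective x
    obtain ⟨g, rfl⟩ := E.surjective y
    rw [LinearEquiv.conj_apply_apply, LinearEquiv.conj_apply_apply, E.symm_apply_apply,
      E.symm_apply_apply, inner_weightedEquiv, inner_weightedEquiv, hT]
  have hn : Module.finrank ℝ (EuclideanSpace ℝ S) = Fintype.card S := finrank_euclideanSpace
  set B := hsym.eigenvectorBasis hn with hB
  have hEB : ∀ i, E (E.symm (B i)) = B i := fun i => E.apply_symm_apply _
  refine ⟨fun i => E.symm (B i), hsym.eigenvalues hn, ?_, ?_, ?_, ?_⟩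
  · rw [← E.charpoly_conj T, hsym.roots_charpoly_eq_eigenvalues hn]
    rfl
  · intro i
    have h := hsym.apply_eigenvectorBasis hn i
    apply E.injective
    rw [map_smul, hEB, ← hB] at *
    rw [LinearEquiv.conj_apply_apply] at h
    exact h
  · intro i j
    rw [← inner_weightedEquiv hw, ← hE, hEB, hEB]
    exact orthonormal_iff_ite.1 B.orthonormal i j
  · intro f g
    rw [← inner_weightedEquiv hw f g, ← hE, ← B.sum_inner_mul_inner]
    refine Finset.sum_congr rfl fun i _ => ?_
    rw [← inner_weightedEquiv hw, ← inner_weightedEquiv hw, ← hE, hEB,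
      real_inner_comm (E g)]

/-- The entry of index `1` in the increasing rearrangement of a finite family. -/
lemma getD_one_sort_map {n : ℕ} (hn : 2 ≤ n) (e : Fin n → ℝ) :
    ∃ i₀ j, i₀ ≠ j ∧ ((Multiset.map e Finset.univ.val).sort (· ≤ ·)).getD 1 0 = e j ∧
      e i₀ ≤ e j ∧ ∀ i, i ≠ i₀ → e j ≤ e i := by
  have : Nonempty (Fin n) := ⟨⟨0, by omega⟩⟩
  obtain ⟨i₀, -, hi₀⟩ := Finset.exists_min_image Finset.univ e Finset.univ_nonempty
  have hne : (Finset.univ.erase i₀).Nonempty := by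
    rw [← Finset.card_pos, Finset.card_erase_of_mem (Finset.mem_univ _), Finset.card_univ,
      Fintype.card_fin]
    omega
  obtain ⟨j, hj, hjmin⟩ := Finset.exists_min_image (Finset.univ.erase i₀) e hne
  refine ⟨i₀, j, (Finset.ne_of_mem_erase hj).symm, ?_, hi₀ j (Finset.mem_univ _),
    fun i hi => hjmin i (Finset.mem_erase.2 ⟨hi, Finset.mem_univ _⟩)⟩
  have h1 : (Multiset.map e Finset.univ.val)
      = e i₀ ::ₘ e j ::ₘ Multiset.map e ((Finset.univ.erase i₀).erase j).val := by
    rw [← Multiset.map_cons, ← Multiset.map_cons, Finset.erase_val (Finset.univ.erase i₀),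
      Multiset.cons_erase hj, Finset.erase_val, Multiset.cons_erase (Finset.mem_univ i₀)]
  rw [h1, Multiset.sort_cons, Multiset.sort_cons]
  · rfl
  · intro b hb
    obtain ⟨k, hk, rfl⟩ := Multiset.mem_map.1 hb
    exact hjmin k (Finset.mem_of_mem_erase hk)
  · intro b hb
    rw [← Multiset.map_cons] at hb
    obtain ⟨k, hk, rfl⟩ := Multiset.mem_map.1 hb
    exact hi₀ k (Finset.mem_univ _)

/-- Poincaré inequality implies a lower bound on the spectral gap. -/
lemma inv_le_spectralGap (hw : ∀ s, 0 < w s) (hS : 2 ≤ Fintype.card S)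
    (L : (S → ℝ) →ₗ[ℝ] (S → ℝ))
    (hL : ∀ f g, ∑ s, w s * (L f s * g s) = ∑ s, w s * (f s * L g s)) {K : ℝ} (hK : 0 < K)
    (h : ∀ f : S → ℝ, ∑ s, w s * f s = 0 →
      ∑ s, w s * f s ^ 2 ≤ K * ∑ s, w s * (f s * (-L) f s)) :
    K⁻¹ ≤ spectralGap L := by
  obtain ⟨φ, e, hroots, heig, hon, -⟩ := exists_eigenbasis hw (-L) (fun f g => by
    simp only [LinearMap.neg_apply, Pi.neg_apply, neg_mul, mul_neg, Finset.sum_neg_distrib, hL])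
  obtain ⟨i₀, j, hij, hgap, hle, -⟩ := getD_one_sort_map hS e
  rw [spectralGap, hroots, hgap]
  have key : ∀ α β : ℝ, ∑ s, w s * (α * φ i₀ s + β * φ j s) = 0 →
      α ^ 2 + β ^ 2 ≤ K * (e i₀ * α ^ 2 + e j * β ^ 2) := by
    intro α β hz
    have h0 := h _ hz
    have e1 : (fun s => α * φ i₀ s + β * φ j s) = α • φ i₀ + β • φ j := rfl
    have e2 : ∀ s, (-L) (fun s => α * φ i₀ s + β * φ j s) s
        = α * (e i₀ * φ i₀ s) + β * (e j * φ j s) := by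
      intro s
      rw [e1, map_add, map_smul, map_smul, heig, heig]
      rfl
    have o1 := hon i₀ i₀
    have o2 := hon j j
    have o3 := hon i₀ j
    rw [if_pos rfl] at o1 o2
    rw [if_neg hij] at o3
    have l1 : ∑ s, w s * (α * φ i₀ s + β * φ j s) ^ 2 = α ^ 2 + β ^ 2 := by
      calc _ = α ^ 2 * ∑ s, w s * (φ i₀ s * φ i₀ s) + β ^ 2 * ∑ s, w s * (φ j s * φ j s)
            + 2 * α * β * ∑ s, w s * (φ i₀ s * φ j s) := by
            simp only [Finset.mul_sum, ← Finset.sum_add_distrib]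
            exact Finset.sum_congr rfl fun s _ => by ring
        _ = _ := by rw [o1, o2, o3]; ring
    have l2 : ∑ s, w s * ((α * φ i₀ s + β * φ j s)
          * (-L) (fun s => α * φ i₀ s + β * φ j s) s) = e i₀ * α ^ 2 + e j * β ^ 2 := by
      simp only [e2]
      calc _ = e i₀ * α ^ 2 * ∑ s, w s * (φ i₀ s * φ i₀ s)
              + e j * β ^ 2 * ∑ s, w s * (φ j s * φ j s)
            + (e i₀ + e j) * α * β * ∑ s, w s * (φ i₀ s * φ j s) := by
            simp only [Finset.mul_sum, ← Finset.sum_add_distrib]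
            exact Finset.sum_congr rfl fun s _ => by ring
        _ = _ := by rw [o1, o2, o3]; ring
    rwa [l1, l2] at h0
  set a := ∑ s, w s * φ i₀ s
  set b := ∑ s, w s * φ j s
  have hsum : ∀ α β : ℝ, ∑ s, w s * (α * φ i₀ s + β * φ j s) = α * a + β * b := by
    intro α β
    simp only [a, b, Finset.mul_sum, ← Finset.sum_add_distrib]
    exact Finset.sum_congr rfl fun s _ => by ring
  -- The span of the two lowest eigenfunctions is two-dimensional, hence meets the mean-zero
  -- hyperplane; on it the Rayleigh quotient is at most `e j`.
  obtain ⟨α, β, hne, hz⟩ : ∃ α β : ℝ, 0 < α ^ 2 + β ^ 2 ∧ α * a + β * b = 0 := by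
    by_cases hb : b = 0
    · exact ⟨0, 1, by norm_num, by simp [hb]⟩
    · exact ⟨b, -a, by positivity, by ring⟩
  have h1 := key α β (by rw [hsum, hz])
  have h2 : K * (e i₀ * α ^ 2 + e j * β ^ 2) ≤ K * e j * (α ^ 2 + β ^ 2) := by
    rw [mul_assoc]
    gcongr
    nlinarith [sq_nonneg α]
  rw [inv_le_iff_one_le_mul₀ hK]
  nlinarith

/-- The spectral gap is an admissible constant in the Poincaré inequality. -/
lemma spectralGap_mul_le (hw : ∀ s, 0 < w s) (hS : 2 ≤ Fintype.card S)
    (L : (S → ℝ) →ₗ[ℝ] (S → ℝ))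
    (hL : ∀ f g, ∑ s, w s * (L f s * g s) = ∑ s, w s * (f s * L g s))
    (hL1 : L (fun _ => 1) = 0) (hpos : ∀ f, 0 ≤ ∑ s, w s * (f s * (-L) f s)) (f : S → ℝ) :
    ∃ c : ℝ, spectralGap L * ∑ s, w s * (f s - c) ^ 2 ≤ ∑ s, w s * (f s * (-L) f s) := by
  obtain ⟨φ, e, hroots, heig, hon, hpars⟩ := exists_eigenbasis hw (-L) (fun f g => by
    simp only [LinearMap.neg_apply, Pi.neg_apply, neg_mul, mul_neg, Finset.sum_neg_distrib, hL])
  obtain ⟨i₀, j, hij, hgap, -, hge⟩ := getD_one_sort_map hS e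
  rw [spectralGap, hroots, hgap]
  have hco : ∀ (g : S → ℝ) i, ∑ s, w s * ((-L) g s * φ i s) = e i * ∑ s, w s * (g s * φ i s) := by
    intro g i
    have : ∑ s, w s * ((-L) g s * φ i s) = ∑ s, w s * (g s * (-L) (φ i) s) := by
      simp only [LinearMap.neg_apply, Pi.neg_apply, neg_mul, mul_neg, Finset.sum_neg_distrib, hL]
    rw [this, heig, Finset.mul_sum]
    refine Finset.sum_congr rfl fun s _ => ?_
    simp only [Pi.smul_apply, smul_eq_mul]
    ring
  have hen : ∑ s, w s * (f s * (-L) f s) = ∑ i, e i * (∑ s, w s * (f s * φ i s)) ^ 2 := by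
    rw [← hpars]
    refine Finset.sum_congr rfl fun i _ => ?_
    rw [hco]
    ring
  have he0 : ∀ i, 0 ≤ e i := by
    intro i
    have h1 := hpos (φ i)
    have h2 : ∑ s, w s * (φ i s * (-L) (φ i) s) = e i := by
      have := hon i i
      rw [if_pos rfl] at this
      trans e i * ∑ s, w s * (φ i s * φ i s)
      swap
      · rw [this, mul_one]
      rw [heig, Finset.mul_sum]
      refine Finset.sum_congr rfl fun s _ => ?_
      simp only [Pi.smul_apply, smul_eq_mul]
      ring
    rwa [h2] at h1
  -- If `e j = 0` any `c` will do. Otherwise every eigenvalue other than `e i₀` is positive, so the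
  -- function 1, which `L` kills, is a multiple of `φ i₀`.
  rcases (he0 j).eq_or_lt with hj | hj
  · exact ⟨0, by rw [← hj, zero_mul]; exact hpos f⟩
  set ψ : Fin (Fintype.card S) → ℝ := fun i => ∑ s, w s * (1 * φ i s) with hψ
  have hψ0 : ∀ i, i ≠ i₀ → ψ i = 0 := by
    intro i hi
    have h1 := hco (fun _ => 1) i
    rw [LinearMap.neg_apply, hL1] at h1
    simp only [Pi.neg_apply, Pi.zero_apply, neg_zero, zero_mul, mul_zero,
      Finset.sum_const_zero] at h1
    exact (mul_eq_zero.1 h1.symm).resolve_left (hj.trans_le (hge i hi)).ne'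
  have hψi₀ : ψ i₀ ≠ 0 := by
    intro h0
    have h1 := hpars (fun _ => 1) (fun _ => 1)
    have h2 : ∀ i, ψ i = 0 := fun i => if hi : i = i₀ then hi ▸ h0 else hψ0 i hi
    have h3 : ∑ i, ψ i * ψ i = 0 := by simp [h2]
    rw [h3] at h1
    have hcard : 0 < Fintype.card S := by omega
    have : Nonempty S := Fintype.card_pos_iff.1 hcard
    have : 0 < ∑ s, w s * (1 * 1) := Finset.sum_pos (fun s _ => by simp [hw]) Finset.univ_nonempty
    linarith
  set a : Fin (Fintype.card S) → ℝ := fun i => ∑ s, w s * (f s * φ i s) with ha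
  -- This constant removes the component of `f` along `φ i₀`; all other components carry an
  -- eigenvalue at least `e j`.
  refine ⟨a i₀ / ψ i₀, ?_⟩
  set c := a i₀ / ψ i₀
  have h1 : ∑ s, w s * (f s - c) ^ 2 = ∑ i, (a i - c * ψ i) ^ 2 := by
    have := hpars (fun s => f s - c) (fun s => f s - c)
    simp only [← pow_two] at this
    rw [← this]
    refine Finset.sum_congr rfl fun i _ => ?_
    congr 1
    simp only [a, ψ, Finset.mul_sum, ← Finset.sum_sub_distrib]
    exact Finset.sum_congr rfl fun s _ => by ring
  rw [h1, hen, Finset.mul_sum]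
  refine Finset.sum_le_sum fun i _ => ?_
  by_cases hi : i = i₀
  · subst hi
    have : a i - c * ψ i = 0 := by
      simp only [c]
      field_simp
      ring
    rw [this]
    have := mul_nonneg (he0 i) (sq_nonneg (a i))
    simpa using this
  · rw [hψ0 i hi, mul_zero, sub_zero]
    exact mul_le_mul_of_nonneg_right (hge i hi) (sq_nonneg _)

end Spectral

/-! ### The Dirichlet form of heat-bath dynamics and the relaxation time. -/

section Glauber

variable {V : Type} [Fintype V] [DecidableEq V] (G : SimpleGraph V) [DecidableRel G.Adj]
  (β : ℝ) (H : V → ℝ)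

lemma isingWeight_pos (σ : V → ℤˣ) : 0 < isingWeight G β H σ := Real.exp_pos _

/-- The partition function cancels in the heat-bath rates, and these sum to 1 over `a`; so each
vertex contributes a projection minus the identity. -/
lemma glauberGenerator_apply (f : (V → ℤˣ) → ℝ) (σ : V → ℤˣ) :
    glauberGenerator G β H f σ = ∑ v, (condAvg (isingWeight G β H) {v} f σ - f σ) := by
  change ∑ v, ∑ a : ℤˣ, heatBathRate G β H σ v a * (f (Function.update σ v a) - f σ) = _
  refine Finset.sum_congr rfl fun v _ => ?_
  have hpos := isingWeight_pos G β H
  have hZ : (0 : ℝ) < ∑ η, isingWeight G β H η :=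
    Finset.sum_pos (fun η _ => hpos η) Finset.univ_nonempty
  have hY : (0 : ℝ) < ∑ a : ℤˣ, isingWeight G β H (Function.update σ v a) :=
    Finset.sum_pos (fun a _ => hpos _) Finset.univ_nonempty
  have hr : ∀ a, heatBathRate G β H σ v a
      = isingWeight G β H (Function.update σ v a)
        / ∑ a : ℤˣ, isingWeight G β H (Function.update σ v a) := by
    intro a
    unfold heatBathRate isingGibbs
    rw [← Finset.sum_div, div_div_div_cancel_right₀ hZ.ne']
  simp only [hr, condAvg, av_singleton]
  rw [div_div_div_cancel_right₀ two_ne_zero, eq_sub_iff_add_eq, eq_div_iff hY.ne', add_mul,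
    Finset.sum_mul, Finset.mul_sum, ← Finset.sum_add_distrib]
  refine Finset.sum_congr rfl fun a _ => ?_
  field_simp
  ring

lemma sum_mul_glauberGenerator (f g : (V → ℤˣ) → ℝ) :
    ∑ σ, isingWeight G β H σ * (f σ * glauberGenerator G β H g σ)
      = ∑ v, (∑ σ, isingWeight G β H σ * (f σ * condAvg (isingWeight G β H) {v} g σ)
        - ∑ σ, isingWeight G β H σ * (f σ * g σ)) := by
  simp only [glauberGenerator_apply, Finset.mul_sum]
  rw [Finset.sum_comm]
  refine Finset.sum_congr rfl fun v _ => ?_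
  rw [← Finset.sum_sub_distrib]
  exact Finset.sum_congr rfl fun σ _ => by ring

lemma glauberGenerator_symm (f g : (V → ℤˣ) → ℝ) :
    ∑ σ, isingWeight G β H σ * (glauberGenerator G β H f σ * g σ)
      = ∑ σ, isingWeight G β H σ * (f σ * glauberGenerator G β H g σ) := by
  rw [sum_mul_glauberGenerator]
  simp only [mul_comm (glauberGenerator G β H f _)]
  rw [sum_mul_glauberGenerator]
  refine Finset.sum_congr rfl fun v _ => ?_
  rw [condAvg_symm (isingWeight_pos G β H)]
  simp only [mul_comm]

lemma dirichlet_eq_sum_energy (f : (V → ℤˣ) → ℝ) :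
    ∑ σ, isingWeight G β H σ * (f σ * (-glauberGenerator G β H) f σ)
      = ∑ v, energy (isingWeight G β H) {v} f := by
  have : ∑ σ, isingWeight G β H σ * (f σ * (-glauberGenerator G β H) f σ)
      = -∑ σ, isingWeight G β H σ * (f σ * glauberGenerator G β H f σ) := by
    simp [LinearMap.neg_apply]
  rw [this, sum_mul_glauberGenerator, ← Finset.sum_neg_distrib]
  refine Finset.sum_congr rfl fun v _ => ?_
  rw [← sum_sub_condAvg_mul (isingWeight_pos G β H), neg_sub, ← Finset.sum_sub_distrib]
  exact Finset.sum_congr rfl fun σ _ => by ring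

lemma two_le_card_cfg [Nonempty V] : 2 ≤ Fintype.card (V → ℤˣ) := by
  rw [Fintype.card_fun]
  have : Fintype.card ℤˣ = 2 := rfl
  rw [this]
  exact Nat.le_self_pow Fintype.card_ne_zero 2

lemma condAvg_univ_eq_zero {w f : (V → ℤˣ) → ℝ} (hf : ∑ σ, w σ * f σ = 0) (σ : V → ℤˣ) :
    condAvg w Finset.univ f σ = 0 := by
  rw [condAvg, av_univ, hf]
  simp

lemma inv_le_spectralGap_glauber [Nonempty V] {K : ℝ} (hK : 0 < K)
    (h : BlockPoincare (isingWeight G β H) Finset.univ K) :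
    K⁻¹ ≤ spectralGap (glauberGenerator G β H) := by
  refine inv_le_spectralGap (isingWeight_pos G β H) two_le_card_cfg _
    (glauberGenerator_symm G β H) hK fun f hf => ?_
  have h1 := h f
  rw [← dirichlet_eq_sum_energy] at h1
  simpa only [energy, condAvg_univ_eq_zero hf, sub_zero] using h1

/-- A Poincaré inequality bounds the relaxation time from above. -/
lemma relaxationTime_le [Nonempty V] {K : ℝ} (hK : 0 < K)
    (h : BlockPoincare (isingWeight G β H) Finset.univ K) :
    relaxationTime G β H ≤ K :=
  inv_le_of_inv_le₀ hK (inv_le_spectralGap_glauber G β H hK h)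

lemma spectralGap_mul_energy_le [Nonempty V] (f : (V → ℤˣ) → ℝ) :
    spectralGap (glauberGenerator G β H) * energy (isingWeight G β H) Finset.univ f
      ≤ ∑ v, energy (isingWeight G β H) {v} f := by
  have hpos : ∀ f, 0 ≤ ∑ σ, isingWeight G β H σ * (f σ * (-glauberGenerator G β H) f σ) := by
    intro f
    rw [dirichlet_eq_sum_energy]
    exact Finset.sum_nonneg fun v _ => energy_nonneg (isingWeight_pos G β H) _ _
  by_cases hg : spectralGap (glauberGenerator G β H) ≤ 0
  · refine (mul_nonpos_of_nonpos_of_nonneg hg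
      (energy_nonneg (isingWeight_pos G β H) _ _)).trans ?_
    exact Finset.sum_nonneg fun v _ => energy_nonneg (isingWeight_pos G β H) _ _
  obtain ⟨c, hc⟩ := spectralGap_mul_le (isingWeight_pos G β H) two_le_card_cfg
    (glauberGenerator G β H) (glauberGenerator_symm G β H)
    (by
      funext σ
      rw [glauberGenerator_apply]
      refine Finset.sum_eq_zero fun v _ => ?_
      rw [condAvg_of_indepOf (isingWeight_pos G β H) (IndepOf.const {v} 1), sub_self]) hpos f
  rw [dirichlet_eq_sum_energy] at hc
  refine le_trans ?_ hc
  push Not at hg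
  exact mul_le_mul_of_nonneg_left
    (energy_le (isingWeight_pos G β H) (IndepOf.const Finset.univ c) f) hg.le

/-- As soon as some Poincaré inequality holds, the relaxation time is positive and is itself an
admissible Poincaré constant. -/
lemma relaxationTime_spec [Nonempty V] {K : ℝ} (hK : 0 < K)
    (h : BlockPoincare (isingWeight G β H) Finset.univ K) :
    0 < relaxationTime G β H ∧
      BlockPoincare (isingWeight G β H) Finset.univ (relaxationTime G β H) := by
  have hg := (inv_pos.2 hK).trans_le (inv_le_spectralGap_glauber G β H hK h)
  refine ⟨inv_pos.2 hg, fun f => ?_⟩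
  have := spectralGap_mul_energy_le G β H f
  rw [relaxationTime, ← div_eq_inv_mul, le_div_iff₀ hg, mul_comm]
  exact this

end Glauber

/-! ### Ising weights on forests described by a parent map. -/

section ParentWeight

variable {V : Type} [DecidableEq V] [Fintype V]

/-- Ising weight on a forest given by a parent map `p`: the edge from `v` to `p v` has coupling
constant `J v`. -/
def parentWeight (p : V → V) (J H : V → ℝ) (σ : V → ℤˣ) : ℝ :=
  Real.exp (∑ v, (J v * (spin σ v * spin σ (p v)) + H v * spin σ v))

lemma parentWeight_pos (p : V → V) (J H : V → ℝ) (σ : V → ℤˣ) : 0 < parentWeight p J H σ :=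
  Real.exp_pos _

lemma spin_congr {σ τ : V → ℤˣ} {v : V} (h : σ v = τ v) : spin σ v = spin τ v := by
  simp [spin, h]

lemma abs_spin (σ : V → ℤˣ) (v : V) : |spin σ v| = 1 := by
  rcases Int.units_eq_one_or (σ v) with h | h <;> simp [spin, h]

lemma spin_mul_self (σ : V → ℤˣ) (v : V) : spin σ v * spin σ v = 1 := by
  rcases Int.units_eq_one_or (σ v) with h | h <;> simp [spin, h]

variable {p : V → V} {J H : V → ℝ}

/-- The terms of the exponent that involve a vertex of `A` go into one factor, the rest into the
other. A term involving both `A` and `B` has zero coupling, so the first factor ignores `B`. -/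
lemma separates_parentWeight {A B : Finset V} (hd : Disjoint A B)
    (h1 : ∀ v ∈ A, p v ∈ B → J v = 0) (h2 : ∀ v ∈ B, p v ∈ A → J v = 0) :
    Separates (parentWeight p J H) A B := by
  refine ⟨hd, fun σ => Real.exp (∑ v, ((if v ∈ A ∨ p v ∈ A then 0
      else J v * (spin σ v * spin σ (p v))) + (if v ∈ A then 0 else H v * spin σ v))),
    fun σ => Real.exp (∑ v, ((if v ∈ A ∨ p v ∈ A then J v * (spin σ v * spin σ (p v))
      else 0) + (if v ∈ A then H v * spin σ v else 0))), ?_, ?_, ?_⟩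
  · intro σ
    rw [← Real.exp_add, ← Finset.sum_add_distrib, parentWeight]
    congr 1
    refine Finset.sum_congr rfl fun v _ => ?_
    split_ifs <;> ring
  · intro σ τ h
    dsimp only
    congr 1
    refine Finset.sum_congr rfl fun v _ => ?_
    congr 1
    · split_ifs with hv
      · rfl
      · push Not at hv
        rw [spin_congr (h v hv.1), spin_congr (h _ hv.2)]
    · split_ifs with hv
      · rfl
      · rw [spin_congr (h v hv)]
  · intro σ τ h
    dsimp only
    congr 1
    refine Finset.sum_congr rfl fun v _ => ?_
    congr 1
    · split_ifs with hv
      · rcases eq_or_ne (J v) 0 with hJ | hJ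
        · simp [hJ]
        · have hvB : v ∉ B := fun hB => hv.elim (fun hA => Finset.disjoint_left.1 hd hA hB)
            fun hA => hJ (h2 v hB hA)
          have hpB : p v ∉ B := fun hB => hv.elim (fun hA => hJ (h1 v hA hB))
            fun hA => Finset.disjoint_left.1 hd hA hB
          rw [spin_congr (h v hvB), spin_congr (h _ hpB)]
      · rfl
    · split_ifs with hv
      · rw [spin_congr (h v (Finset.disjoint_left.1 hd hv))]
      · rfl

/-- Cutting the edge above `c`, where `X` is a union of components of what remains. -/
lemma exists_cut_factorization (c : V) (X : Finset V) (hX : ∀ v, v ≠ c → (v ∈ X ↔ p v ∈ X)) :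
    ∃ g h : (V → ℤˣ) → ℝ, (∀ σ, parentWeight p J H σ
      = Real.exp (J c * (spin σ c * spin σ (p c))) * (g σ * h σ)) ∧
      IndepOf X g ∧ IndepOf Xᶜ h ∧ (∀ σ, 0 < g σ) ∧ (∀ σ, 0 < h σ) := by
  refine ⟨fun σ => Real.exp (∑ v, if v ∈ X then 0 else
      ((if v = c then 0 else J v * (spin σ v * spin σ (p v))) + H v * spin σ v)),
    fun σ => Real.exp (∑ v, if v ∈ X then
      ((if v = c then 0 else J v * (spin σ v * spin σ (p v))) + H v * spin σ v) else 0),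
    ?_, ?_, ?_, fun _ => Real.exp_pos _, fun _ => Real.exp_pos _⟩
  · intro σ
    have hc : J c * (spin σ c * spin σ (p c))
        = ∑ v, if v = c then J v * (spin σ v * spin σ (p v)) else 0 := by
      simp
    rw [← Real.exp_add, ← Real.exp_add, ← Finset.sum_add_distrib, hc, ← Finset.sum_add_distrib,
      parentWeight]
    congr 1
    refine Finset.sum_congr rfl fun v _ => ?_
    split_ifs <;> ring
  · intro σ τ h
    dsimp only
    congr 1
    refine Finset.sum_congr rfl fun v _ => ?_
    split_ifs with hv hc
    · rfl
    · rw [spin_congr (h v hv)]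
    · rw [spin_congr (h v hv), spin_congr (h (p v) fun hp => hv ((hX v hc).2 hp))]
  · intro σ τ h
    dsimp only
    congr 1
    refine Finset.sum_congr rfl fun v _ => ?_
    split_ifs with hv hc
    · rw [spin_congr (h v (by simpa using hv))]
    · rw [spin_congr (h v (by simpa using hv)),
        spin_congr (h (p v) (by simpa using (hX v hc).1 hv))]
    · rfl

/-- Edges inside `A` with nonzero coupling stay within one class of `κ`, so distinct classes are
separated and the variance tensorises, one class at a time. -/
lemma energy_le_sum_classes {ι : Type} [DecidableEq ι] (A : Finset V) (κ : V → ι)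
    (hκ : ∀ v ∈ A, p v ∈ A → J v ≠ 0 → κ v = κ (p v)) (f : (V → ℤˣ) → ℝ) :
    energy (parentWeight p J H) A f
      ≤ ∑ x ∈ A.image κ, energy (parentWeight p J H) (A.filter fun v => κ v = x) f := by
  have hw := parentWeight_pos p J H
  have main : ∀ T : Finset ι, energy (parentWeight p J H) (A.filter fun v => κ v ∈ T) f
      ≤ ∑ x ∈ T, energy (parentWeight p J H) (A.filter fun v => κ v = x) f := by
    intro T
    induction T using Finset.induction_on with
    | empty =>
      simp only [Finset.notMem_empty, Finset.filter_false, Finset.sum_empty]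
      refine (energy_eq_zero_of_indepOf hw ?_).le
      intro σ τ h
      rw [show σ = τ from funext fun v => h v (Finset.notMem_empty v)]
    | insert x T hx ih =>
      rw [Finset.sum_insert hx]
      have hU : (A.filter fun v => κ v ∈ insert x T)
          = (A.filter fun v => κ v = x) ∪ (A.filter fun v => κ v ∈ T) := by
        ext v
        simp only [Finset.mem_filter, Finset.mem_insert, Finset.mem_union]
        tauto
      rw [hU]
      have hsep : Separates (parentWeight p J H) (A.filter fun v => κ v = x)
          (A.filter fun v => κ v ∈ T) := by
        refine separates_parentWeight ?_ ?_ ?_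
        · rw [Finset.disjoint_left]
          intro v h1 h2
          rw [Finset.mem_filter] at h1 h2
          exact hx (h1.2 ▸ h2.2)
        · intro v h1 h2
          rw [Finset.mem_filter] at h1 h2
          by_contra hJ
          have := hκ v h1.1 h2.1 hJ
          exact hx (by rw [← h1.2, this]; exact h2.2)
        · intro v h1 h2
          rw [Finset.mem_filter] at h1 h2
          by_contra hJ
          have := hκ v h1.1 h2.1 hJ
          exact hx (by rw [← h2.2, ← this]; exact h1.2)
      exact (hsep.energy_union_le hw f).trans (by gcongr)
  refine le_of_eq_of_le ?_ (main (A.image κ))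
  congr 1
  ext v
  simp only [Finset.mem_filter, Finset.mem_image]
  exact ⟨fun h => ⟨h, v, h, rfl⟩, fun h => h.1⟩

lemma blockPoincare_of_classes {ι : Type} [DecidableEq ι] {A : Finset V} (κ : V → ι)
    (hκ : ∀ v ∈ A, p v ∈ A → J v ≠ 0 → κ v = κ (p v)) {K : ℝ}
    (h : ∀ x, BlockPoincare (parentWeight p J H) (A.filter fun v => κ v = x) K) :
    BlockPoincare (parentWeight p J H) A K := by
  intro f
  refine (energy_le_sum_classes A κ hκ f).trans ?_
  calc _ ≤ ∑ x ∈ A.image κ, K * ∑ v ∈ A.filter fun v => κ v = x,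
        energy (parentWeight p J H) {v} f := Finset.sum_le_sum fun x _ => h x f
    _ = _ := by
      rw [← Finset.mul_sum, Finset.sum_fiberwise_of_maps_to]
      exact fun v hv => Finset.mem_image_of_mem _ hv

/-- Changing the couplings changes the weight by a bounded factor. -/
lemma parentWeight_le_exp_mul (J J' : V → ℝ) (σ : V → ℤˣ) :
    parentWeight p J H σ ≤ Real.exp (∑ v, |J v - J' v|) * parentWeight p J' H σ := by
  unfold parentWeight
  rw [← Real.exp_add, Real.exp_le_exp, ← Finset.sum_add_distrib]
  refine Finset.sum_le_sum fun v _ => ?_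
  have h1 : (J v - J' v) * (spin σ v * spin σ (p v)) ≤ |J v - J' v| := by
    refine (le_abs_self _).trans ?_
    rw [abs_mul, abs_mul, abs_spin, abs_spin, mul_one, mul_one]
  linarith

lemma BlockPoincare.change_coupling {J' : V → ℝ} {A : Finset V} {K : ℝ} (hK : 0 ≤ K)
    (h : BlockPoincare (parentWeight p J' H) A K) :
    BlockPoincare (parentWeight p J H) A (K * Real.exp (2 * ∑ v, |J v - J' v|)) :=
  h.of_comparable (parentWeight_pos p J' H) (parentWeight_pos p J H) hK
    (parentWeight_le_exp_mul J J')
    (fun σ => by simpa only [abs_sub_comm] using parentWeight_le_exp_mul J' J σ)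

/-- A crude Poincaré inequality on any block, by comparison with a product measure. -/
lemma blockPoincare_exp_card (A : Finset V) :
    BlockPoincare (parentWeight p J H) A (Real.exp (2 * ∑ v ∈ A, |J v|)) := by
  -- With the couplings at the vertices of `A` switched off no interaction is left inside `A`: the
  -- classes are single sites and the constant is 1. Switching them on again costs the exponential.
  have h0 : BlockPoincare (parentWeight p (fun v => if v ∈ A then 0 else J v) H) A 1 := by
    refine blockPoincare_of_classes id (fun v hv _ hJ => absurd (if_pos hv) hJ) fun x f => ?_
    by_cases hx : x ∈ A
    · have : (A.filter fun v => id v = x) = {x} := by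
        ext v
        simp only [id, Finset.mem_filter, Finset.mem_singleton]
        exact ⟨fun h => h.2, fun h => ⟨h ▸ hx, h⟩⟩
      rw [this]
      simp
    · have : (A.filter fun v => id v = x) = ∅ := by
        ext v
        simp only [id, Finset.mem_filter, Finset.notMem_empty, iff_false]
        rintro ⟨h1, rfl⟩
        exact hx h1
      rw [this, Finset.sum_empty, mul_zero]
      refine (energy_eq_zero_of_indepOf (parentWeight_pos _ _ _) ?_).le
      intro σ τ h
      rw [show σ = τ from funext fun v => h v (Finset.notMem_empty v)]
  have h1 := h0.change_coupling (J := J) zero_le_one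
  rw [one_mul] at h1
  convert h1 using 3
  rw [← Finset.sum_subset (Finset.subset_univ A)]
  · exact Finset.sum_congr rfl fun v hv => by simp [hv]
  · intro v _ hv
    simp [hv]

end ParentWeight

/-! ### The tree as a parent map, and its size. -/

section TreeWeight

variable {b : ℕ}

/-- The parent of a vertex; the root is its own parent. -/
def par {r : ℕ} (v : TreeVertex b r) : TreeVertex b r :=
  ⟨v.1.tail, by have := v.2; simp only [List.length_tail]; omega⟩

/-- The constant coupling `β` on all edges. -/
def treeCoupling {r : ℕ} (β : ℝ) (v : TreeVertex b r) : ℝ := if v.1 = [] then 0 else β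

/-- The root of the tree. -/
def root (b r : ℕ) : TreeVertex b r := ⟨[], Nat.zero_le r⟩

instance (b r : ℕ) : Nonempty (TreeVertex b r) := ⟨root b r⟩

/-- Every edge is recorded once, at its lower endpoint. The root is its own parent, whence the zero
coupling there. -/
lemma isingWeight_tree (r : ℕ) (β : ℝ) (H : TreeVertex b r → ℝ) :
    isingWeight (tree b r) β H = parentWeight par (treeCoupling β) H := by
  funext σ
  unfold isingWeight parentWeight
  congr 1
  rw [Finset.sum_add_distrib]
  congr 1
  rw [Finset.mul_sum]
  have h1 : ∑ v : TreeVertex b r, treeCoupling β v * (spin σ v * spin σ (par v))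
      = ∑ v ∈ Finset.univ.filter (fun v : TreeVertex b r => v.1 ≠ []),
        β * (spin σ v * spin σ (par v)) := by
    rw [Finset.sum_filter]
    refine Finset.sum_congr rfl fun v _ => ?_
    unfold treeCoupling
    split_ifs <;> simp_all
  rw [h1]
  symm
  refine Finset.sum_bij (fun v _ => s(v, par v)) ?_ ?_ ?_ ?_
  · intro v hv
    rw [SimpleGraph.mem_edgeFinset, SimpleGraph.mem_edgeSet]
    right
    obtain ⟨a, l, hl⟩ := List.exists_cons_of_ne_nil (Finset.mem_filter.1 hv).2
    exact ⟨a, by simp [par, hl]⟩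
  · intro v hv v' hv' h
    have hne := (Finset.mem_filter.1 hv).2
    have hne' := (Finset.mem_filter.1 hv').2
    rw [Sym2.eq_iff] at h
    rcases h with h | h
    · exact h.1
    · exfalso
      have e1 := congrArg (fun x => x.1.length) h.1
      have e2 := congrArg (fun x => x.1.length) h.2
      simp only [par, List.length_tail] at e1 e2
      have := List.length_pos_of_ne_nil hne
      omega
  · intro e he
    induction e using Sym2.ind with
    | _ v v' =>
      rw [SimpleGraph.mem_edgeFinset, SimpleGraph.mem_edgeSet] at he
      rcases he with ⟨a, h⟩ | ⟨a, h⟩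
      · refine ⟨v', Finset.mem_filter.2 ⟨Finset.mem_univ _, by simp [h]⟩, ?_⟩
        rw [Sym2.eq_swap]
        congr 1
        simp [par, h]
      · refine ⟨v, Finset.mem_filter.2 ⟨Finset.mem_univ _, by simp [h]⟩, ?_⟩
        congr 1
        simp [par, h]
  · intro v _
    rfl

lemma treeSize_succ_le (r : ℕ) : treeSize b (r + 1) ≤ 1 + b * treeSize b r := by
  have : Fintype.card (Option (Fin b × TreeVertex b r)) = 1 + b * treeSize b r := by
    rw [Fintype.card_option, Fintype.card_prod, Fintype.card_fin, add_comm]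
    rfl
  rw [← this]
  refine Fintype.card_le_of_surjective (fun q : Option (Fin b × TreeVertex b r) => match q with
    | none => root b (r + 1)
    | some (a, v) => ⟨a :: v.1, by have := v.2; simp only [List.length_cons]; omega⟩) ?_
  rintro ⟨l, hl⟩
  cases l with
  | nil => exact ⟨none, rfl⟩
  | cons a l =>
    refine ⟨some (a, ⟨l, ?_⟩), rfl⟩
    simpa using hl

lemma treeSize_le (hb : 2 ≤ b) (r : ℕ) : treeSize b r ≤ b ^ (r + 1) := by
  -- The additional 1 closes the induction: (1 + b n) + 1 ≤ b (n + 1) because b ≥ 2.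
  have : treeSize b r + 1 ≤ b ^ (r + 1) := by
    induction r with
    | zero =>
      have : treeSize b 0 ≤ 1 := by
        unfold treeSize
        rw [Fintype.card_le_one_iff]
        rintro ⟨v, hv⟩ ⟨v', hv'⟩
        rw [Nat.le_zero, List.length_eq_zero_iff] at hv hv'
        simp [hv, hv']
      simp only [zero_add, pow_one]
      omega
    | succ r ih =>
      have h1 := treeSize_succ_le (b := b) r
      rw [pow_succ]
      nlinarith
  omega

lemma pow_le_treeSize (r : ℕ) : b ^ r ≤ treeSize b r := by
  have : Fintype.card (List.Vector (Fin b) r) = b ^ r := by simp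
  rw [← this]
  exact Fintype.card_le_of_injective
    (fun v : List.Vector (Fin b) r => (⟨v.1, v.2.le⟩ : TreeVertex b r))
    fun v v' h => by
      have := congrArg Subtype.val h
      exact Subtype.ext this

lemma treeSize_pos (b r : ℕ) : 0 < treeSize b r := Fintype.card_pos

/-- Only the existence of a finite constant matters: it makes the spectral gap positive, so the
inverse defining the relaxation time is not the default value 0. -/
lemma exists_treePoincare (r : ℕ) (β : ℝ) (H : TreeVertex b r → ℝ) :
    ∃ K, 0 < K ∧ BlockPoincare (isingWeight (tree b r) β H) Finset.univ K := by
  rw [isingWeight_tree]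
  exact ⟨_, Real.exp_pos _, blockPoincare_exp_card _⟩

lemma relaxationTime_tree_spec (r : ℕ) (β : ℝ) (H : TreeVertex b r → ℝ) :
    0 < relaxationTime (tree b r) β H ∧
      BlockPoincare (isingWeight (tree b r) β H) Finset.univ (relaxationTime (tree b r) β H) := by
  obtain ⟨K, hK, h⟩ := exists_treePoincare r β H
  exact relaxationTime_spec _ _ _ hK h

end TreeWeight

/-! ### Influence of one spin on conditional expectations. -/

section Oscillation

variable {V : Type} [DecidableEq V]

/-- Changing the spin at `u` changes `f` by at most `c`. -/
def OscLe (f : (V → ℤˣ) → ℝ) (u : V) (c : ℝ) : Prop :=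
  ∀ σ a, |f (Function.update σ u a) - f σ| ≤ c

lemma OscLe.mono {f : (V → ℤˣ) → ℝ} {u : V} {c c' : ℝ} (h : OscLe f u c) (hc : c ≤ c') :
    OscLe f u c' :=
  fun σ a => (h σ a).trans hc

lemma sum_units (φ : ℤˣ → ℝ) : ∑ a : ℤˣ, φ a = φ 1 + φ (-1) := by
  rw [show (Finset.univ : Finset ℤˣ) = {1, -1} from rfl, Finset.sum_pair (by decide)]

lemma spin_update_self (σ : V → ℤˣ) (v : V) (a : ℤˣ) :
    spin (Function.update σ v a) v = ((a : ℤ) : ℝ) := by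
  simp [spin]

lemma spin_update_of_ne (σ : V → ℤˣ) {u v : V} (h : u ≠ v) (a : ℤˣ) :
    spin (Function.update σ v a) u = spin σ u := by
  simp [spin, h]

variable [Fintype V]

lemma abs_sub_le_sum_osc {f : (V → ℤˣ) → ℝ} {c : V → ℝ} (h : ∀ v, OscLe f v (c v))
    (σ τ : V → ℤˣ) : |f σ - f τ| ≤ ∑ v, c v := by
  have key : ∀ A : Finset V, |f (A.piecewise σ τ) - f τ| ≤ ∑ v ∈ A, c v := by
    intro A
    induction A using Finset.induction_on with
    | empty => simp
    | insert v A hv ih =>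
      rw [Finset.sum_insert hv, Finset.piecewise_insert]
      have h1 := h v (A.piecewise σ τ) (σ v)
      calc _ = |(f (Function.update (A.piecewise σ τ) v (σ v)) - f (A.piecewise σ τ))
            + (f (A.piecewise σ τ) - f τ)| := by ring_nf
        _ ≤ _ := (abs_add_le _ _).trans (add_le_add h1 ih)
  simpa using key Finset.univ

/-- `1 - 2ε = tanh β` bounds the influence between neighbouring spins, whatever the other
spins contribute. -/
lemma abs_prob_sub_le {β : ℝ} (hβ : 0 ≤ β) {ρ ρ' : ℝ} (h1 : 0 < ρ) (h2 : 0 < ρ') (a a' : ℤˣ) :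
    |Real.exp (β * ((a : ℤ) : ℝ)) * ρ
        / (Real.exp (β * ((a : ℤ) : ℝ)) * ρ + Real.exp (-(β * ((a : ℤ) : ℝ))) * ρ')
      - Real.exp (β * ((a' : ℤ) : ℝ)) * ρ
        / (Real.exp (β * ((a' : ℤ) : ℝ)) * ρ + Real.exp (-(β * ((a' : ℤ) : ℝ))) * ρ')|
      ≤ 1 - 2 * eps β := by
  set t := Real.exp β with ht
  have ht1 : 1 ≤ t := Real.one_le_exp hβ
  have ht0 : 0 < t := Real.exp_pos β
  have hε : 1 - 2 * eps β = (t ^ 2 - 1) / (t ^ 2 + 1) := by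
    rw [eps, two_mul β, Real.exp_add, ← ht]
    field_simp
    ring
  have hnn : 0 ≤ 1 - 2 * eps β := by
    rw [hε]
    apply div_nonneg <;> nlinarith
  have main : |t * ρ / (t * ρ + t⁻¹ * ρ') - t⁻¹ * ρ / (t⁻¹ * ρ + t * ρ')| ≤ 1 - 2 * eps β := by
    have e : t * ρ / (t * ρ + t⁻¹ * ρ') - t⁻¹ * ρ / (t⁻¹ * ρ + t * ρ')
        = (t ^ 4 - 1) * (ρ * ρ') / ((t ^ 2 * ρ + ρ') * (ρ + t ^ 2 * ρ')) := by
      field_simp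
      ring
    have hp : 0 < ρ * ρ' := mul_pos h1 h2
    have h4 : 0 ≤ t ^ 4 - 1 := by nlinarith [sq_nonneg (t ^ 2 - 1)]
    rw [e, abs_of_nonneg (by positivity), hε, div_le_div_iff₀ (by positivity) (by positivity)]
    have h21 : 0 ≤ t ^ 2 - 1 := by nlinarith
    -- The difference of the two sides is (t² - 1) t² (ρ - ρ')². Equality holds for ρ = ρ', when
    -- nothing else biases the spin.
    nlinarith [mul_nonneg (mul_nonneg h21 (sq_nonneg t)) (sq_nonneg (ρ - ρ'))]
  rcases Int.units_eq_one_or a with rfl | rfl <;> rcases Int.units_eq_one_or a' with rfl | rfl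
  · simpa using hnn
  · simpa [Real.exp_neg, ← ht] using main
  · rw [abs_sub_comm]
    simpa [Real.exp_neg, ← ht] using main
  · simpa using hnn

/-- Integrating out a spin `x ∈ A` that is the only link between `u ∉ A` and the part `X` of the
system. -/
lemma OscLe.condAvg_of_cut {w g g₁ h₁ : (V → ℤˣ) → ℝ} {β : ℝ} (hβ : 0 ≤ β)
    {X A : Finset V} {u x : V} (hxX : x ∈ X) (huX : u ∉ X) (hxA : x ∈ A) (huA : u ∉ A)
    (hw : ∀ σ, w σ = Real.exp (β * (spin σ u * spin σ x)) * (g₁ σ * h₁ σ))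
    (hg₁ : IndepOf X g₁) (hh₁ : IndepOf Xᶜ h₁) (hg₁p : ∀ σ, 0 < g₁ σ) (hh₁p : ∀ σ, 0 < h₁ σ)
    (hg : IndepOf (A.erase x) g) {cu cx : ℝ} (hcu : OscLe g u cu) (hcx : OscLe g x cx) :
    OscLe (condAvg w A g) u (cu + (1 - 2 * eps β) * cx) := by
  have hux : u ≠ x := fun h => huX (h ▸ hxX)
  set B := A.erase x with hB
  set R₁ := av (B.filter (· ∈ X)) h₁ with hR₁
  set R₂ := av (B.filter (· ∉ X)) g₁ with hR₂
  have hR₁i : IndepOf Xᶜ R₁ := av_indepOf_of hh₁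
  have hR₂i : IndepOf X R₂ := av_indepOf_of hg₁
  have hR₁p : ∀ σ, 0 < R₁ σ := av_pos hh₁p _
  have hR₂p : ∀ σ, 0 < R₂ σ := av_pos hg₁p _
  have hei : IndepOf B (fun σ : V → ℤˣ => Real.exp (β * (spin σ u * spin σ x))) := by
    intro σ τ h
    dsimp only
    rw [spin_congr (h u fun hu => huA (Finset.mem_of_mem_erase hu)),
      spin_congr (h x (Finset.notMem_erase x A))]
  -- Once the rest of `A` is summed out, `R₁` sees only spins in `X` and `R₂` only spins outside
  -- `X`. Hence `R₂` cancels from the conditional law of the spin at `x`, and the spin at `u` enters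
  -- this law only through the explicit exponential.
  have hwB : ∀ σ, av B w σ = Real.exp (β * (spin σ u * spin σ x)) * (R₁ σ * R₂ σ) := by
    intro σ
    rw [show w = fun σ => Real.exp (β * (spin σ u * spin σ x)) * (g₁ σ * h₁ σ) from funext hw,
      av_mul_left hei]
    congr 1
    rw [← Finset.filter_union_filter_not_eq (· ∈ X) B, ← av_av]
    have h2 : av (B.filter (· ∉ X)) (fun σ => g₁ σ * h₁ σ) = fun σ => R₂ σ * h₁ σ := by
      funext τ
      exact av_mul_right (hh₁.mono fun v hv => by simpa using (Finset.mem_filter.1 hv).2) g₁ τ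
    rw [h2, av_mul_left (hR₂i.mono fun v hv => (Finset.mem_filter.1 hv).2), mul_comm]
  have hAx : ({x} : Finset V) ∪ B = A := by
    rw [hB, ← Finset.insert_eq, Finset.insert_erase hxA]
  have hE : ∀ σ, condAvg w A g σ
      = (Real.exp (β * spin σ u) * R₁ (Function.update σ x 1) * g (Function.update σ x 1)
        + Real.exp (-(β * spin σ u)) * R₁ (Function.update σ x (-1)) * g (Function.update σ x (-1)))
        / (Real.exp (β * spin σ u) * R₁ (Function.update σ x 1)
        + Real.exp (-(β * spin σ u)) * R₁ (Function.update σ x (-1))) := by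
    intro σ
    have hR := hR₂p σ
    rw [condAvg, ← hAx, ← av_av, ← av_av, av_singleton, av_singleton, sum_units, sum_units,
      div_div_div_cancel_right₀ two_ne_zero]
    simp only [av_mul_right hg, hwB, hR₂i.update hxX, spin_update_self,
      spin_update_of_ne _ hux]
    symm
    rw [← mul_div_mul_right _ _ hR.ne']
    congr 1
    · push_cast
      ring_nf
    · push_cast
      ring_nf
  intro σ a
  rw [hE, hE, spin_update_self]
  simp only [Function.update_comm hux, hR₁i.update (Finset.mem_compl.2 huX)]
  set ρ := R₁ (Function.update σ x 1)
  set ρ' := R₁ (Function.update σ x (-1))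
  have hρ : 0 < ρ := hR₁p _
  have hρ' : 0 < ρ' := hR₁p _
  have hq := abs_prob_sub_le hβ hρ hρ' a (σ u)
  have hs : spin σ u = ((σ u : ℤ) : ℝ) := rfl
  rw [← hs] at hq
  set y := Real.exp (β * ((a : ℤ) : ℝ)) * ρ with hy
  set y' := Real.exp (-(β * ((a : ℤ) : ℝ))) * ρ' with hy'
  set z := Real.exp (β * spin σ u) * ρ with hz
  set z' := Real.exp (-(β * spin σ u)) * ρ' with hz'
  have py : 0 < y := by positivity
  have py' : 0 < y' := by positivity
  have pz : 0 < z := by positivity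
  have pz' : 0 < z' := by positivity
  have u1 := hcu (Function.update σ x 1) a
  have u2 := hcu (Function.update σ x (-1)) a
  have u3 := hcx (Function.update σ x (-1)) 1
  rw [Function.update_idem] at u3
  set G1 := g (Function.update (Function.update σ x 1) u a)
  set G2 := g (Function.update (Function.update σ x (-1)) u a)
  set G3 := g (Function.update σ x 1)
  set G4 := g (Function.update σ x (-1))
  -- The change of the mean splits in two: the change of the law of the spin at `x`, acting on the
  -- variation of `g` in `x`, and the change of `g` in `u`, averaged under the new law.
  have hid : (y * G1 + y' * G2) / (y + y') - (z * G3 + z' * G4) / (z + z')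
      = (y / (y + y') - z / (z + z')) * (G3 - G4) + (y / (y + y') * (G1 - G3)
        + (1 - y / (y + y')) * (G2 - G4)) := by
    field_simp
    ring
  rw [hid]
  have q0 : 0 ≤ y / (y + y') := by positivity
  have q1 : 0 ≤ 1 - y / (y + y') := by
    rw [sub_nonneg, div_le_one (by positivity)]
    linarith
  have b1 : |(y / (y + y') - z / (z + z')) * (G3 - G4)| ≤ (1 - 2 * eps β) * cx := by
    rw [abs_mul]
    exact mul_le_mul hq u3 (abs_nonneg _) ((abs_nonneg _).trans hq)
  have b2 : |y / (y + y') * (G1 - G3)| ≤ y / (y + y') * cu := by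
    rw [abs_mul, abs_of_nonneg q0]
    gcongr
  have b3 : |(1 - y / (y + y')) * (G2 - G4)| ≤ (1 - y / (y + y')) * cu := by
    rw [abs_mul, abs_of_nonneg q1]
    gcongr
  calc _ ≤ (1 - 2 * eps β) * cx + (y / (y + y') * cu + (1 - y / (y + y')) * cu) :=
        (abs_add_le _ _).trans (add_le_add b1 ((abs_add_le _ _).trans (add_le_add b2 b3)))
    _ = _ := by ring

/-- Integrating out spins that do not interact with `u`. -/
lemma OscLe.condAvg_of_separates {w f : (V → ℤˣ) → ℝ} (hw : ∀ σ, 0 < w σ) {A : Finset V} {u : V}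
    (hs : Separates w {u} A) {c : ℝ} (hf : OscLe f u c) : OscLe (condAvg w A f) u c := by
  obtain ⟨hd, g, h, hgh, hg, hh⟩ := hs
  have huA : u ∉ A := by simpa using hd
  have hhne : ∀ σ, h σ ≠ 0 := fun σ h0 => by have := hw σ; simp [hgh, h0] at this
  have hav : ∀ (φ : (V → ℤˣ) → ℝ) σ, av A (fun τ => w τ * φ τ) σ
      = h σ * av A (fun τ => g τ * φ τ) σ := by
    intro φ σ
    rw [← av_mul_left hh]
    congr 1
    ext τ
    rw [hgh]; ring
  have hav1 : ∀ σ, av A w σ = h σ * av A g σ := fun σ => by simpa using hav (fun _ => 1) σ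
  have hE : ∀ σ, condAvg w A f σ = av A (fun τ => g τ * f τ) σ / av A g σ := fun σ => by
    rw [condAvg, hav, hav1, mul_div_mul_left _ _ (hhne σ)]
  have hgA : IndepOf {u} (av A g) := av_indepOf_of hg
  intro σ a
  rw [hE, hE, hgA.update (Finset.mem_singleton_self u), ← sub_div]
  have hcard := card_cfg_pos (V := V)
  have hpw : ∀ η, A.piecewise η (Function.update σ u a)
      = Function.update (A.piecewise η σ) u a := by
    intro η
    ext v
    by_cases hv : v = u
    · subst hv
      simp [huA]
    · by_cases hA : v ∈ A <;> simp [hA, hv]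
  have hdiff : av A (fun τ => g τ * f τ) (Function.update σ u a) - av A (fun τ => g τ * f τ) σ
      = (Fintype.card (V → ℤˣ) : ℝ)⁻¹ * ∑ η, g (A.piecewise η σ)
        * (f (Function.update (A.piecewise η σ) u a) - f (A.piecewise η σ)) := by
    unfold av
    rw [← mul_sub, ← Finset.sum_sub_distrib]
    congr 1
    refine Finset.sum_congr rfl fun η _ => ?_
    dsimp only
    rw [hpw, hg.update (Finset.mem_singleton_self u)]
    ring
  -- The factorisation does not say that `g` is positive, only that `g * h` is. As `h` ignores `A`,
  -- `g` keeps one sign along the average, so absolute values still form a weighted mean.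
  have hsgn : ∀ η, |g (A.piecewise η σ)| = g (A.piecewise η σ) * h σ * |h σ|⁻¹ := by
    intro η
    have hp := hw (A.piecewise η σ)
    rw [hgh, hh.piecewise] at hp
    rw [← abs_of_pos hp, abs_mul, mul_assoc, mul_inv_cancel₀ (abs_ne_zero.2 (hhne σ)), mul_one]
  have hsum : ∑ η, |g (A.piecewise η σ)| = |∑ η, g (A.piecewise η σ)| := by
    have hp : 0 < (∑ η, g (A.piecewise η σ)) * h σ := by
      rw [Finset.sum_mul]
      refine Finset.sum_pos (fun η _ => ?_) Finset.univ_nonempty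
      have hp := hw (A.piecewise η σ)
      rwa [hgh, hh.piecewise] at hp
    simp only [hsgn]
    rw [← Finset.sum_mul, ← Finset.sum_mul, ← abs_of_pos hp, abs_mul, mul_assoc,
      mul_inv_cancel₀ (abs_ne_zero.2 (hhne σ)), mul_one]
  rw [hdiff, av, mul_div_mul_left _ _ (inv_ne_zero hcard.ne'), abs_div, ← hsum]
  have hpos : 0 < ∑ η, |g (A.piecewise η σ)| := by
    refine Finset.sum_pos (fun η _ => abs_pos.2 fun h0 => ?_) Finset.univ_nonempty
    have := hw (A.piecewise η σ)
    rw [hgh, h0, zero_mul] at this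
    exact lt_irrefl _ this
  rw [div_le_iff₀ hpos, Finset.mul_sum]
  refine (Finset.abs_sum_le_sum_abs _ _).trans (Finset.sum_le_sum fun η _ => ?_)
  rw [abs_mul, mul_comm c]
  exact mul_le_mul_of_nonneg_left (hf _ _) (abs_nonneg _)

end Oscillation

/-! ### From decay of iterates to an L² contraction. -/

section Contraction

/-- A log-convex sequence that decays at rate `ρ` eventually decays at rate `ρ` from the start. -/
lemma le_mul_of_logConvex {a : ℕ → ℝ} (ha : ∀ k, 0 ≤ a k)
    (hc : ∀ k, a (k + 1) ^ 2 ≤ a k * a (k + 2)) {C ρ : ℝ} (hρ : 0 < ρ)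
    (hb : ∀ k, a k ≤ C * ρ ^ k) : a 1 ≤ ρ * a 0 := by
  by_contra! hlt
  have h0 : 0 < a 0 := by
    rcases (ha 0).eq_or_lt with h | h
    · have h1 := hc 0
      rw [← h, zero_mul] at h1
      have : a 1 = 0 := by simpa using le_antisymm h1 (sq_nonneg _)
      rw [← h, this] at hlt
      simp at hlt
    · exact h
  -- Log-convexity makes successive ratios nondecreasing, so an initial ratio above `ρ` would
  -- persist and outgrow `C * ρ ^ k`.
  set t := a 1 / a 0 with ht
  have htρ : ρ < t := by rwa [ht, lt_div_iff₀ h0]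
  have ht0 : 0 < t := hρ.trans htρ
  have step : ∀ k, 0 < a k ∧ t * a k ≤ a (k + 1) := by
    intro k
    induction k with
    | zero => exact ⟨h0, by rw [ht, div_mul_cancel₀ _ h0.ne']⟩
    | succ k ih =>
      have hk1 : 0 < a (k + 1) := (mul_pos ht0 ih.1).trans_le ih.2
      refine ⟨hk1, ?_⟩
      have := hc k
      have h2 : t * a k * a (k + 1) ≤ a (k + 1) * a (k + 1) :=
        mul_le_mul_of_nonneg_right ih.2 hk1.le
      have h3 : a k * (t * a (k + 1)) ≤ a k * a (k + 2) := by nlinarith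
      exact le_of_mul_le_mul_left h3 ih.1
  have hgeo : ∀ k, t ^ k * a 0 ≤ a k := by
    intro k
    induction k with
    | zero => simp
    | succ k ih =>
      calc t ^ (k + 1) * a 0 = t * (t ^ k * a 0) := by ring
        _ ≤ t * a k := by gcongr
        _ ≤ _ := (step k).2
  have hr : 1 < t / ρ := by rwa [one_lt_div hρ]
  obtain ⟨k, hk⟩ := pow_unbounded_of_one_lt (C / a 0) hr
  rw [div_pow, div_lt_div_iff₀ h0 (pow_pos hρ k)] at hk
  have := (hgeo k).trans (hb k)
  linarith

variable {S : Type} [Fintype S] {w : S → ℝ}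

/-- For self-adjoint `T` the squared norms of the iterates are log-convex, by Cauchy–Schwarz. Decay
at rate 1/4 with any prefactor therefore holds from the first step without one, and Cauchy–Schwarz
for `f` and `T f` concludes. Thus `C` may depend on the size of the tree. -/
lemma sum_mul_le_of_iterate_bound (hw : ∀ s, 0 < w s) (T : (S → ℝ) → S → ℝ)
    (hT : ∀ f g : S → ℝ, ∑ s, w s * (f s * T g s) = ∑ s, w s * (T f s * g s))
    (f : S → ℝ) {C : ℝ} (hC : ∀ k s, |T^[k] f s| ≤ C * (1 / 2) ^ k) :
    ∑ s, w s * (f s * T f s) ≤ 1 / 2 * ∑ s, w s * f s ^ 2 := by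
  have cs : ∀ f g : S → ℝ, (∑ s, w s * (f s * g s)) ^ 2
      ≤ (∑ s, w s * f s ^ 2) * ∑ s, w s * g s ^ 2 := by
    intro f g
    refine Finset.sum_sq_le_sum_mul_sum_of_sq_le_mul _
      (fun s _ => mul_nonneg (hw s).le (sq_nonneg _))
      (fun s _ => mul_nonneg (hw s).le (sq_nonneg _)) fun s _ => le_of_eq (by ring)
  set a : ℕ → ℝ := fun k => ∑ s, w s * T^[k] f s ^ 2 with ha
  have h1 : a 1 ≤ 1 / 4 * a 0 := by
    refine le_mul_of_logConvex (a := a) (C := (∑ s, w s) * C ^ 2) (ρ := 1 / 4)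
      (fun k => Finset.sum_nonneg fun s _ => mul_nonneg (hw s).le (sq_nonneg _)) ?_
      (by norm_num) ?_
    · intro k
      have e : a (k + 1) = ∑ s, w s * (T^[k] f s * T^[k + 2] f s) := by
        rw [show k + 2 = (k + 1) + 1 from rfl, Function.iterate_succ_apply', hT, ha]
        refine Finset.sum_congr rfl fun s _ => ?_
        rw [← Function.iterate_succ_apply' T k f]
        ring
      rw [e]
      exact cs _ _
    · intro k
      rw [ha, mul_assoc, Finset.sum_mul]
      refine Finset.sum_le_sum fun s _ => ?_
      have h2 := pow_le_pow_left₀ (abs_nonneg _) (hC k s) 2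
      rw [sq_abs, mul_pow, ← pow_mul, mul_comm k 2, pow_mul] at h2
      norm_num at h2 ⊢
      exact mul_le_mul_of_nonneg_left h2 (hw s).le
  have h2 := cs f (T f)
  have h3 : ∑ s, w s * T f s ^ 2 = a 1 := rfl
  have h4 : ∑ s, w s * f s ^ 2 = a 0 := rfl
  rw [h3, h4] at h2
  rw [h4]
  have h0 : 0 ≤ a 0 := Finset.sum_nonneg fun s _ => mul_nonneg (hw s).le (sq_nonneg _)
  refine le_of_sq_le_sq ?_ (by positivity)
  nlinarith

end Contraction

/-! ### Below the threshold: block dynamics on slabs of levels. -/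

section HighTemperature

variable {b r : ℕ}

/-- The descendants of `c`, including `c`. -/
def desc (c : TreeVertex b r) : Finset (TreeVertex b r) :=
  Finset.univ.filter fun v => c.1 <:+ v.1

lemma mem_desc {c v : TreeVertex b r} : v ∈ desc c ↔ c.1 <:+ v.1 := by
  simp [desc]

lemma self_mem_desc (c : TreeVertex b r) : c ∈ desc c := mem_desc.2 List.suffix_rfl

lemma mem_desc_par {c v : TreeVertex b r} (h : v ≠ c) : v ∈ desc c ↔ par v ∈ desc c := by
  rw [mem_desc, mem_desc]
  obtain ⟨l, hl⟩ := v
  cases l with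
  | nil => rfl
  | cons a l =>
    simp only [par, List.tail_cons]
    rw [List.suffix_cons_iff]
    constructor
    · rintro (h1 | h1)
      · exact absurd (Subtype.ext h1.symm) h
      · exact h1
    · exact Or.inr

lemma length_le_of_mem_desc {c v : TreeVertex b r} (h : v ∈ desc c) : c.1.length ≤ v.1.length :=
  (mem_desc.1 h).length_le

lemma length_par {v : TreeVertex b r} (h : v.1 ≠ []) : v.1.length = (par v).1.length + 1 := by
  have := List.length_pos_of_ne_nil h
  simp only [par, List.length_tail]
  omega

lemma par_notMem_desc {c : TreeVertex b r} (h : c.1 ≠ []) : par c ∉ desc c := by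
  intro hc
  have h1 := length_le_of_mem_desc hc
  have := length_par h
  omega

lemma ne_nil_of_par_ne {v : TreeVertex b r} (h : par v ≠ v) : v.1 ≠ [] := by
  intro h0
  apply h
  ext1
  simp [par, h0]

lemma par_ne_self {v : TreeVertex b r} (h : v.1 ≠ []) : par v ≠ v := by
  intro h0
  have := length_par h
  rw [h0] at this
  omega

lemma card_children_le (u : TreeVertex b r) :
    (Finset.univ.filter fun v : TreeVertex b r => v.1 ≠ [] ∧ par v = u).card ≤ b := by
  have : (Finset.univ.filter fun v : TreeVertex b r => v.1 ≠ [] ∧ par v = u)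
      ⊆ Finset.univ.image (fun a : Fin b => if h : (a :: u.1).length ≤ r
        then (⟨a :: u.1, h⟩ : TreeVertex b r) else u) := by
    intro v hv
    obtain ⟨hne, hp⟩ := (Finset.mem_filter.1 hv).2
    obtain ⟨a, l, hl⟩ := List.exists_cons_of_ne_nil hne
    have hu : u.1 = l := by rw [← hp]; simp [par, hl]
    rw [Finset.mem_image]
    refine ⟨a, Finset.mem_univ _, ?_⟩
    have h2 : a :: u.1 = v.1 := by rw [hl, hu]
    rw [dif_pos (by rw [h2]; exact v.2)]
    exact Subtype.ext h2
  refine (Finset.card_le_card this).trans (Finset.card_image_le.trans ?_)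
  simp

variable {β : ℝ} {H : TreeVertex b r → ℝ}

/-- Influence on `u` of integrating out one adjacent spin `x`. -/
lemma OscLe.condAvg_of_adj (hβ : 0 ≤ β) {A : Finset (TreeVertex b r)} {u x : TreeVertex b r}
    (hux : (x.1 ≠ [] ∧ par x = u) ∨ (u.1 ≠ [] ∧ par u = x)) (hxA : x ∈ A) (huA : u ∉ A)
    {f : (TreeVertex b r → ℤˣ) → ℝ} {cu cx : ℝ}
    (hcu : OscLe (condAvg (parentWeight par (treeCoupling β) H) (A.erase x) f) u cu)
    (hcx : OscLe (condAvg (parentWeight par (treeCoupling β) H) (A.erase x) f) x cx) :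
    OscLe (condAvg (parentWeight par (treeCoupling β) H) A f) u (cu + (1 - 2 * eps β) * cx) := by
  set w := parentWeight par (treeCoupling β) H with hwdef
  have hw : ∀ σ, 0 < w σ := parentWeight_pos _ _ _
  rw [← condAvg_condAvg_of_subset hw (Finset.erase_subset x A) f]
  rcases hux with ⟨hne, hp⟩ | ⟨hne, hp⟩
  · obtain ⟨g, h, hfac, hg, hh, hgp, hhp⟩ := exists_cut_factorization (p := par)
      (J := treeCoupling β) (H := H) x (desc x) (fun v hv => mem_desc_par hv)
    refine OscLe.condAvg_of_cut hβ (self_mem_desc x) (hp ▸ par_notMem_desc hne) hxA huA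
      (fun σ => ?_) hg hh hgp hhp (condAvg_indepOf w _ f) hcu hcx
    rw [hwdef, hfac, treeCoupling, if_neg hne, hp, mul_comm (spin σ x)]
  · obtain ⟨g, h, hfac, hg, hh, hgp, hhp⟩ := exists_cut_factorization (p := par)
      (J := treeCoupling β) (H := H) u (desc u) (fun v hv => mem_desc_par hv)
    refine OscLe.condAvg_of_cut (X := (desc u)ᶜ) (g₁ := h) (h₁ := g) hβ
      (Finset.mem_compl.2 (hp ▸ par_notMem_desc hne))
      (fun h => Finset.mem_compl.1 h (self_mem_desc u)) hxA huA
      (fun σ => ?_) hh (by rwa [compl_compl]) hhp hgp (condAvg_indepOf w _ f) hcu hcx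
    rw [hwdef, hfac, treeCoupling, if_neg hne, hp, mul_comm (g σ)]

variable {q lam S c : ℝ}

/-- With `u` and its parent both kept, influence leaves `u` only through its children in `A`. Each
child adds `(1 - 2 * eps β) * lam * S` relative to the weight at `u`, and b of them are absorbed by
`S = 1 + q * S`. -/
lemma oscLe_condAvg_down (hβ : 0 ≤ β) (hlam : 0 < lam) (hS : S = 1 + q * S)
    (hS0 : 0 ≤ S) (hc : 0 ≤ c) (hq : b * (1 - 2 * eps β) * lam ≤ q)
    (hθ : 0 ≤ 1 - 2 * eps β) {f : (TreeVertex b r → ℤˣ) → ℝ}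
    (hf : ∀ v, OscLe f v (c * lam ^ v.1.length)) (n : ℕ) :
    ∀ (A : Finset (TreeVertex b r)) (u : TreeVertex b r), A.card = n → u ∉ A → par u ∉ A →
      OscLe (condAvg (parentWeight par (treeCoupling β) H) A f) u (c * lam ^ u.1.length * S) := by
  -- Counting the children of `u` that lie in `A` allows the induction to integrate them out one at
  -- a time.
  suffices h : ∀ (A : Finset (TreeVertex b r)) (u : TreeVertex b r), A.card = n → u ∉ A →
      par u ∉ A → OscLe (condAvg (parentWeight par (treeCoupling β) H) A f) u
        (c * lam ^ u.1.length *
          (1 + (A.filter fun v => par v = u).card * ((1 - 2 * eps β) * lam * S))) by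
    intro A u hA hu hpu
    refine (h A u hA hu hpu).mono ?_
    gcongr
    rw [hS]
    have h1 : ((A.filter fun v => par v = u).card : ℝ) ≤ b := by
      have : (A.filter fun v => par v = u)
          ⊆ (Finset.univ.filter fun v : TreeVertex b r => v.1 ≠ [] ∧ par v = u) := by
        intro v hv
        obtain ⟨hvA, hp⟩ := Finset.mem_filter.1 hv
        refine Finset.mem_filter.2 ⟨Finset.mem_univ _, ne_nil_of_par_ne ?_, hp⟩
        rw [hp]
        rintro rfl
        exact hu hvA
      exact_mod_cast (Finset.card_le_card this).trans (card_children_le u)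
    rw [← hS]
    calc 1 + ((A.filter fun v => par v = u).card : ℝ) * ((1 - 2 * eps β) * lam * S)
        ≤ 1 + b * ((1 - 2 * eps β) * lam * S) := by gcongr
      _ = 1 + (b * (1 - 2 * eps β) * lam) * S := by ring
      _ ≤ 1 + q * S := by gcongr
      _ = S := hS.symm
  induction n with
  | zero =>
    intro A u hA _ _
    rw [Finset.card_eq_zero] at hA
    subst hA
    have : condAvg (parentWeight par (treeCoupling β) H) ∅ f = f := by
      funext σ
      refine condAvg_of_indepOf (parentWeight_pos _ _ _) (fun σ τ h => ?_) σ
      rw [show σ = τ from funext fun v => h v (Finset.notMem_empty v)]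
    rw [this]
    simpa using hf u
  | succ n ih =>
    intro A u hA hu hpu
    by_cases hch : (A.filter fun v => par v = u) = ∅
    · rw [hch, Finset.card_empty, Nat.cast_zero, zero_mul, add_zero, mul_one]
      refine OscLe.condAvg_of_separates (parentWeight_pos _ _ _)
        (separates_parentWeight ?_ ?_ ?_) (hf u)
      · simpa using hu
      · intro v hv hp
        rw [Finset.mem_singleton.1 hv] at hp
        exact absurd hp hpu
      · intro v hv hp
        have : v ∈ A.filter fun v => par v = u :=
          Finset.mem_filter.2 ⟨hv, Finset.mem_singleton.1 hp⟩
        rw [hch] at this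
        exact absurd this (Finset.notMem_empty v)
    · obtain ⟨x, hx⟩ := Finset.nonempty_of_ne_empty hch
      obtain ⟨hxA, hxu⟩ := Finset.mem_filter.1 hx
      have hxne : x.1 ≠ [] := ne_nil_of_par_ne (by rw [hxu]; rintro rfl; exact hu hxA)
      have hcard : (A.erase x).card = n := by
        rw [Finset.card_erase_of_mem hxA, hA, Nat.add_sub_cancel]
      have h1 := ih (A.erase x) u hcard (fun h => hu (Finset.mem_of_mem_erase h))
        (fun h => hpu (Finset.mem_of_mem_erase h))
      have h2 := ih (A.erase x) x hcard (Finset.notMem_erase x A)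
        (fun h => hu (hxu ▸ Finset.mem_of_mem_erase h))
      have h3 : ((A.filter fun v => par v = u).card : ℝ)
          = ((A.erase x).filter fun v => par v = u).card + 1 := by
        rw [← Finset.card_erase_add_one hx, Finset.filter_erase]
        push_cast
        rfl
      have h4 : (((A.erase x).filter fun v => par v = x).card : ℝ) ≤ b := by
        have : ((A.erase x).filter fun v => par v = x)
            ⊆ (Finset.univ.filter fun v : TreeVertex b r => v.1 ≠ [] ∧ par v = x) := by
          intro v hv
          obtain ⟨hvA, hp⟩ := Finset.mem_filter.1 hv
          refine Finset.mem_filter.2 ⟨Finset.mem_univ _, ne_nil_of_par_ne ?_, hp⟩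
          rw [hp]
          exact (Finset.ne_of_mem_erase hvA).symm
        exact_mod_cast (Finset.card_le_card this).trans (card_children_le x)
      have h5 : c * lam ^ x.1.length *
          (1 + ((A.erase x).filter fun v => par v = x).card * ((1 - 2 * eps β) * lam * S))
          ≤ c * lam ^ x.1.length * S := by
        gcongr
        calc 1 + (((A.erase x).filter fun v => par v = x).card : ℝ)
              * ((1 - 2 * eps β) * lam * S)
            ≤ 1 + b * ((1 - 2 * eps β) * lam * S) := by gcongr
          _ = 1 + (b * (1 - 2 * eps β) * lam) * S := by ring
          _ ≤ 1 + q * S := by gcongr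
          _ = S := hS.symm
      refine (OscLe.condAvg_of_adj hβ (Or.inl ⟨hxne, hxu⟩) hxA hu h1 (h2.mono h5)).mono ?_
      have hlen : x.1.length = u.1.length + 1 := by rw [length_par hxne, hxu]
      rw [h3, hlen, pow_succ]
      apply le_of_eq
      ring

/-- Induction on the depth. If the parent is integrated out, do so last: before that the oscillation
at `u` is inflated by `S`, at the parent by `S ^ 2`, and the step upward costs `q`, giving S (1 + q
S) = S². -/
lemma oscLe_condAvg (hβ : 0 ≤ β) (hlam : 0 < lam) (hq0 : 0 ≤ q) (hS : S = 1 + q * S)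
    (hS0 : 0 ≤ S) (hc : 0 ≤ c) (hq : b * (1 - 2 * eps β) * lam ≤ q)
    (hq' : 1 - 2 * eps β ≤ q * lam)
    (hθ : 0 ≤ 1 - 2 * eps β) {f : (TreeVertex b r → ℤˣ) → ℝ}
    (hf : ∀ v, OscLe f v (c * lam ^ v.1.length)) (n : ℕ) :
    ∀ (A : Finset (TreeVertex b r)) (u : TreeVertex b r), u.1.length = n → u ∉ A →
      OscLe (condAvg (parentWeight par (treeCoupling β) H) A f) u
        (c * lam ^ u.1.length * S ^ 2) := by
  have hS1 : 1 ≤ S := by nlinarith [mul_nonneg hq0 hS0]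
  induction n with
  | zero =>
    intro A u hu huA
    have hp : par u = u := by
      by_contra h
      exact ne_nil_of_par_ne h (List.length_eq_zero_iff.1 hu)
    refine (oscLe_condAvg_down hβ hlam hS hS0 hc hq hθ hf A.card A u rfl huA
      (by rwa [hp])).mono ?_
    gcongr
    nlinarith
  | succ n ih =>
    intro A u hu huA
    by_cases hp : par u ∈ A
    · have hne : u.1 ≠ [] := by
        intro h
        simp [h] at hu
      have h1 := oscLe_condAvg_down (H := H) hβ hlam hS hS0 hc hq hθ hf _ (A.erase (par u)) u rfl
        (fun h => huA (Finset.mem_of_mem_erase h)) (Finset.notMem_erase _ _)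
      have hlen := length_par hne
      have h2 := ih (A.erase (par u)) (par u) (by omega) (Finset.notMem_erase _ _)
      refine (OscLe.condAvg_of_adj hβ (Or.inr ⟨hne, rfl⟩) hp huA h1 h2).mono ?_
      rw [hlen]
      have h3 : (1 - 2 * eps β) * (c * lam ^ (par u).1.length * S ^ 2)
          ≤ (q * lam) * (c * lam ^ (par u).1.length * S ^ 2) := by gcongr
      have h4 : c * lam ^ ((par u).1.length + 1) * S + (q * lam) * (c * lam ^ (par u).1.length * S ^ 2)
          = c * lam ^ ((par u).1.length + 1) * S * (1 + q * S) := by ring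
      rw [← hS] at h4
      calc _ ≤ _ := add_le_add le_rfl h3
        _ = _ := by rw [h4]; ring
    · refine (oscLe_condAvg_down hβ hlam hS hS0 hc hq hθ hf A.card A u rfl huA hp).mono ?_
      gcongr
      nlinarith

/-- The vertices outside the levels congruent to `s` modulo `N`. -/
def slab (b r N s : ℕ) : Finset (TreeVertex b r) :=
  Finset.univ.filter fun v => v.1.length % N ≠ s

/-- Average over `s` of the conditional expectations given the levels congruent to `s`. -/
def slabAvg (w : (TreeVertex b r → ℤˣ) → ℝ) (N : ℕ) (f : (TreeVertex b r → ℤˣ) → ℝ)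
    (σ : TreeVertex b r → ℤˣ) : ℝ :=
  (N : ℝ)⁻¹ * ∑ s ∈ Finset.range N, condAvg w (slab b r N s) f σ

/-- The spin at `u` is integrated out in every term except the one with s congruent to the depth of
`u`. So the loss `S ^ 2` is divided by `N`. -/
lemma oscLe_slabAvg (hβ : 0 ≤ β) (hlam : 0 < lam) (hq0 : 0 ≤ q) (hS : S = 1 + q * S)
    (hS0 : 0 ≤ S) (hc : 0 ≤ c) (hq : b * (1 - 2 * eps β) * lam ≤ q)
    (hq' : 1 - 2 * eps β ≤ q * lam)
    (hθ : 0 ≤ 1 - 2 * eps β) {N : ℕ} (hN : 0 < N) (hN2 : 2 * S ^ 2 ≤ N)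
    {f : (TreeVertex b r → ℤˣ) → ℝ}
    (hf : ∀ v, OscLe f v (c * lam ^ v.1.length)) (u : TreeVertex b r) :
    OscLe (slabAvg (parentWeight par (treeCoupling β) H) N f) u
      (c * (1 / 2) * lam ^ u.1.length) := by
  intro σ a
  have hN0 : (0 : ℝ) < N := by exact_mod_cast hN
  unfold slabAvg
  rw [← mul_sub, ← Finset.sum_sub_distrib, Finset.sum_eq_single (u.1.length % N)]
  · have h1 := oscLe_condAvg (H := H) hβ hlam hq0 hS hS0 hc hq hq' hθ hf _
      (slab b r N (u.1.length % N)) u rfl (by simp [slab]) σ a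
    rw [abs_mul, abs_of_nonneg (inv_nonneg.2 hN0.le)]
    calc _ ≤ (N : ℝ)⁻¹ * (c * lam ^ u.1.length * S ^ 2) := by gcongr
      _ ≤ (N : ℝ)⁻¹ * (c * lam ^ u.1.length * (N / 2)) := by gcongr; linarith
      _ = _ := by field_simp
  · intro s _ hs
    rw [(condAvg_indepOf _ (slab b r N s) f).update, sub_self]
    simp [slab, hs.symm]
  · intro h
    exact absurd (Finset.mem_range.2 (Nat.mod_lt _ hN)) h

lemma slabAvg_symm {w : (TreeVertex b r → ℤˣ) → ℝ} (hw : ∀ σ, 0 < w σ) (N : ℕ)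
    (f g : (TreeVertex b r → ℤˣ) → ℝ) :
    ∑ σ, w σ * (f σ * slabAvg w N g σ) = ∑ σ, w σ * (slabAvg w N f σ * g σ) := by
  have e1 : ∑ σ, w σ * (f σ * slabAvg w N g σ) = (N : ℝ)⁻¹ *
      ∑ s ∈ Finset.range N, ∑ σ, w σ * (f σ * condAvg w (slab b r N s) g σ) := by
    rw [Finset.sum_comm, Finset.mul_sum]
    refine Finset.sum_congr rfl fun σ _ => ?_
    rw [slabAvg, ← Finset.mul_sum, ← Finset.mul_sum]
    ring
  have e2 : ∑ σ, w σ * (slabAvg w N f σ * g σ) = (N : ℝ)⁻¹ *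
      ∑ s ∈ Finset.range N, ∑ σ, w σ * (condAvg w (slab b r N s) f σ * g σ) := by
    rw [Finset.sum_comm, Finset.mul_sum]
    refine Finset.sum_congr rfl fun σ _ => ?_
    rw [slabAvg, ← Finset.mul_sum, ← Finset.sum_mul]
    ring
  rw [e1, e2]
  congr 1
  exact Finset.sum_congr rfl fun s _ => condAvg_symm hw _ f g

lemma sum_mul_slabAvg {w : (TreeVertex b r → ℤˣ) → ℝ} (hw : ∀ σ, 0 < w σ) {N : ℕ} (hN : 0 < N)
    (f : (TreeVertex b r → ℤˣ) → ℝ) :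
    ∑ σ, w σ * slabAvg w N f σ = ∑ σ, w σ * f σ := by
  have hN0 : (0 : ℝ) < N := by exact_mod_cast hN
  have h := slabAvg_symm hw N (fun _ => 1) f
  have h1 : ∀ σ, slabAvg w N (fun _ => 1) σ = 1 := by
    intro σ
    unfold slabAvg
    simp only [condAvg_of_indepOf hw (IndepOf.const _ 1)]
    simp [hN0.ne']
  simpa [h1] using h

lemma energy_sub_const {V : Type} [DecidableEq V] [Fintype V] {w : (V → ℤˣ) → ℝ}
    (hw : ∀ σ, 0 < w σ) (A : Finset V) (f : (V → ℤˣ) → ℝ) (m : ℝ) :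
    energy w A (fun σ => f σ - m) = energy w A f := by
  unfold energy
  simp only [condAvg_sub, condAvg_of_indepOf hw (IndepOf.const A m), sub_sub_sub_cancel_right]

/-- The Poincaré inequality for the slab dynamics. -/
lemma energy_univ_le_slab (hβ : 0 ≤ β) (hlam : 0 < lam) (hq0 : 0 ≤ q) (hS : S = 1 + q * S)
    (hS0 : 0 ≤ S) (hq : b * (1 - 2 * eps β) * lam ≤ q)
    (hq' : 1 - 2 * eps β ≤ q * lam)
    (hθ : 0 ≤ 1 - 2 * eps β) {N : ℕ} (hN : 0 < N) (hN2 : 2 * S ^ 2 ≤ N)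
    (f : (TreeVertex b r → ℤˣ) → ℝ) :
    energy (parentWeight par (treeCoupling β) H) Finset.univ f
      ≤ 2 * ((N : ℝ)⁻¹ * ∑ s ∈ Finset.range N,
        energy (parentWeight par (treeCoupling β) H) (slab b r N s) f) := by
  set w := parentWeight par (treeCoupling β) H with hwdef
  have hw : ∀ σ, 0 < w σ := parentWeight_pos _ _ _
  have hN0 : (0 : ℝ) < N := by exact_mod_cast hN
  have hZ : 0 < ∑ σ, w σ := Finset.sum_pos (fun σ _ => hw σ) Finset.univ_nonempty
  wlog hmean : ∑ σ, w σ * f σ = 0 with key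
  · have := key (f := fun σ => f σ - (∑ σ, w σ * f σ) / ∑ σ, w σ) hβ hlam hq0 hS hS0 hq hq' hθ hN
      hN2 hwdef hw hN0 hZ (by
        simp only [mul_sub, Finset.sum_sub_distrib, ← Finset.sum_mul]
        field_simp
        ring)
    simpa only [← hwdef, energy_sub_const hw] using this
  obtain ⟨c, hc, hfc⟩ : ∃ c, 0 ≤ c ∧ ∀ v, OscLe f v (c * lam ^ v.1.length) := by
    set M := ∑ σ, |f σ| with hM
    have hle : ∀ σ, |f σ| ≤ M := fun σ =>
      Finset.single_le_sum (f := fun σ => |f σ|) (fun _ _ => abs_nonneg _) (Finset.mem_univ σ)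
    have hM0 : 0 ≤ M := Finset.sum_nonneg fun _ _ => abs_nonneg _
    refine ⟨∑ v : TreeVertex b r, 2 * M / lam ^ v.1.length,
      Finset.sum_nonneg fun v _ => by positivity, fun v σ a => ?_⟩
    have h1 : 2 * M / lam ^ v.1.length ≤ ∑ v : TreeVertex b r, 2 * M / lam ^ v.1.length :=
      Finset.single_le_sum (f := fun v : TreeVertex b r => 2 * M / lam ^ v.1.length)
        (fun v _ => by positivity) (Finset.mem_univ v)
    have h2 : |f (Function.update σ v a) - f σ| ≤ 2 * M := by
      refine (abs_sub _ _).trans ?_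
      have := hle (Function.update σ v a)
      have := hle σ
      linarith
    calc _ ≤ 2 * M := h2
      _ = 2 * M / lam ^ v.1.length * lam ^ v.1.length := by
          rw [div_mul_cancel₀ _ (pow_pos hlam _).ne']
      _ ≤ _ := by gcongr
  have hiter : ∀ k : ℕ, (∑ σ, w σ * (slabAvg w N)^[k] f σ = 0) ∧
      ∀ v, OscLe ((slabAvg w N)^[k] f) v (c * (1 / 2) ^ k * lam ^ v.1.length) := by
    intro k
    induction k with
    | zero => exact ⟨hmean, by simpa only [pow_zero, mul_one, Function.iterate_zero, id] using hfc⟩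
    | succ k ih =>
      rw [Function.iterate_succ_apply']
      refine ⟨by rw [sum_mul_slabAvg hw hN]; exact ih.1, fun v => ?_⟩
      have := oscLe_slabAvg (H := H) hβ hlam hq0 hS hS0 (by positivity) hq hq' hθ hN hN2 ih.2 v
      rw [pow_succ, ← mul_assoc]
      exact this
  -- A mean-zero function is bounded by its total oscillation. The size of the tree enters only the
  -- prefactor, which `sum_mul_le_of_iterate_bound` discards.
  have hbound : ∀ k σ, |(slabAvg w N)^[k] f σ|
      ≤ (∑ v : TreeVertex b r, c * lam ^ v.1.length) * (1 / 2) ^ k := by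
    intro k σ
    set g := (slabAvg w N)^[k] f with hg
    have h1 := abs_sub_le_sum_osc (hiter k).2 σ
    have h2 : (∑ τ, w τ) * g σ = ∑ τ, w τ * (g σ - g τ) := by
      simp only [mul_sub, Finset.sum_sub_distrib, ← Finset.sum_mul, (hiter k).1, sub_zero, hg]
    have h3 : (∑ τ, w τ) * |g σ| ≤ (∑ τ, w τ)
        * ((∑ v : TreeVertex b r, c * lam ^ v.1.length) * (1 / 2) ^ k) := by
      rw [← abs_of_pos hZ, ← abs_mul, abs_of_pos hZ, h2, Finset.sum_mul]
      refine (Finset.abs_sum_le_sum_abs _ _).trans (Finset.sum_le_sum fun τ _ => ?_)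
      rw [abs_mul, abs_of_pos (hw τ)]
      refine mul_le_mul_of_nonneg_left ((h1 τ).trans (le_of_eq ?_)) (hw τ).le
      rw [Finset.sum_mul]
      exact Finset.sum_congr rfl fun v _ => by ring
    exact le_of_mul_le_mul_left h3 hZ
  have hhalf := sum_mul_le_of_iterate_bound hw (slabAvg w N) (slabAvg_symm hw N) f hbound
  have hE : energy w Finset.univ f = ∑ σ, w σ * f σ ^ 2 := by
    unfold energy
    simp only [condAvg_univ_eq_zero hmean, sub_zero]
  -- The averaged slab energy is the quadratic form of 1 - T, T being the slab average, because each
  -- conditional expectation is a projection.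
  have hD : (N : ℝ)⁻¹ * ∑ s ∈ Finset.range N, energy w (slab b r N s) f
      = ∑ σ, w σ * f σ ^ 2 - ∑ σ, w σ * (f σ * slabAvg w N f σ) := by
    simp only [← sum_sub_condAvg_mul hw]
    rw [Finset.sum_comm, Finset.mul_sum, ← Finset.sum_sub_distrib]
    refine Finset.sum_congr rfl fun σ _ => ?_
    rw [← Finset.mul_sum, ← Finset.sum_mul, Finset.sum_sub_distrib, slabAvg, Finset.sum_const,
      Finset.card_range, nsmul_eq_mul]
    field_simp
  rw [hE, hD]
  linarith

lemma succ_mod_of_ne {N x : ℕ} (hN : 0 < N) (h : x % N ≠ N - 1) : (x + 1) % N = x % N + 1 := by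
  have h1 := Nat.mod_lt x hN
  rw [← Nat.mod_add_mod, Nat.mod_eq_of_lt]
  omega

lemma BlockPoincare.mono {V : Type} [DecidableEq V] [Fintype V] {w : (V → ℤˣ) → ℝ}
    (hw : ∀ σ, 0 < w σ) {A : Finset V} {K K' : ℝ} (h : BlockPoincare w A K) (hK : K ≤ K') :
    BlockPoincare w A K' :=
  fun f => (h f).trans (mul_le_mul_of_nonneg_right hK
    (Finset.sum_nonneg fun _ _ => energy_nonneg hw _ _))

/-- The components of a slab have bounded size, hence a uniform Poincaré inequality. -/
lemma blockPoincare_slab (hβ : 0 ≤ β) {N s : ℕ} (hs : s < N) :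
    BlockPoincare (parentWeight par (treeCoupling β) H) (slab b r N s)
      (Real.exp (2 * (treeSize b N * β))) := by
  have hN : 0 < N := by omega
  -- For a level n in the slab, `k n` is its distance from the top level of its component: it
  -- vanishes when n is congruent to s + 1 modulo N. Dropping `k n` letters from a word yields the
  -- top vertex, which labels the component.
  set k : ℕ → ℕ := fun n => (n + (N - 1 - s)) % N with hk
  refine blockPoincare_of_classes (fun v => v.1.drop (k v.1.length)) ?_ fun x => ?_
  · rintro ⟨l, hl⟩ hv hp hJ
    cases l with
    | nil => exact absurd (if_pos rfl) hJ
    | cons a l =>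
      simp only [par, slab, Finset.mem_filter, Finset.mem_univ, true_and, List.tail_cons] at hp
      have h1 : (l.length + (N - 1 - s)) % N ≠ N - 1 := by
        intro h
        apply hp
        have h2 : (l.length + (N - 1 - s) + (s + 1)) % N = l.length % N := by
          rw [show l.length + (N - 1 - s) + (s + 1) = l.length + N by omega, Nat.add_mod_right]
        rw [← h2, ← Nat.mod_add_mod, h, show N - 1 + (s + 1) = s + N by omega,
          Nat.add_mod_right, Nat.mod_eq_of_lt hs]
      have h2 : k (a :: l).length = k l.length + 1 := by
        simp only [hk, List.length_cons]
        rw [show l.length + 1 + (N - 1 - s) = l.length + (N - 1 - s) + 1 by omega,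
          succ_mod_of_ne hN h1]
      simp only [par, List.tail_cons]
      rw [h2, List.drop_succ_cons]
  · refine (blockPoincare_exp_card _).mono (parentWeight_pos _ _ _) ?_
    rw [Real.exp_le_exp]
    gcongr
    have hJ : ∀ v : TreeVertex b r, |treeCoupling β v| ≤ β := by
      intro v
      unfold treeCoupling
      split_ifs
      · simpa using hβ
      · rw [abs_of_nonneg hβ]
    refine (Finset.sum_le_card_nsmul _ _ β fun v _ => hJ v).trans ?_
    rw [nsmul_eq_mul]
    gcongr
    -- Within a component a vertex is determined by the letters below the top vertex, a word of
    -- length less than `N`.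
    have hcard : ((slab b r N s).filter fun v => v.1.drop (k v.1.length) = x).card
        ≤ (Finset.univ : Finset (TreeVertex b N)).card := by
      refine Finset.card_le_card_of_injOn
        (fun v => ⟨v.1.take (k v.1.length), ?_⟩) (fun _ _ => Finset.mem_coe.2 (Finset.mem_univ _)) ?_
      · rw [List.length_take]
        exact (min_le_left _ _).trans (Nat.mod_lt _ hN).le
      · intro v hv v' hv' h
        have e1 := (Finset.mem_filter.1 hv).2
        have e2 := (Finset.mem_filter.1 hv').2
        have e3 := congrArg Subtype.val h
        dsimp only at e3
        ext1
        rw [← List.take_append_drop (k v.1.length) v.1, e1, e3, ← e2, List.take_append_drop]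
    exact hcard

/-- Bounded relaxation time below the reconstruction threshold, for all external fields. -/
lemma relaxationTime_bounded_of_lt (hb : 2 ≤ b) (hβ : 0 ≤ β)
    (h : 1 - 2 * eps β < 1 / Real.sqrt b) :
    ∃ C : ℝ, ∀ (r : ℕ) (H : TreeVertex b r → ℝ), relaxationTime (tree b r) β H ≤ C := by
  have hb0 : (0 : ℝ) < b := by
    have : 0 < b := by omega
    exact_mod_cast this
  have hsq : 0 < Real.sqrt b := Real.sqrt_pos.2 hb0
  have hθ : 0 ≤ 1 - 2 * eps β := by
    have h1 : 1 ≤ Real.exp (2 * β) := Real.one_le_exp (by linarith)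
    have : eps β ≤ 2⁻¹ := by
      unfold eps
      exact inv_anti₀ (by norm_num) (by linarith)
    linarith
  -- With the weight λ = 1/√b, going down costs bθλ and going up θ/λ; both equal `q`. None of `q`,
  -- `S`, `N` depends on the depth or the field.
  set q := (1 - 2 * eps β) * Real.sqrt b with hq
  have hq1 : q < 1 := by rwa [lt_div_iff₀ hsq] at h
  have hq0 : 0 ≤ q := by positivity
  set S := (1 - q)⁻¹ with hSdef
  have h1q : 0 < 1 - q := by linarith
  have hS0 : 0 < S := inv_pos.2 h1q
  have hS : S = 1 + q * S := by
    rw [hSdef]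
    field_simp
    ring
  obtain ⟨N, hN⟩ := exists_nat_ge (2 * S ^ 2)
  have hNpos : 0 < N := by
    have : (0 : ℝ) < N := lt_of_lt_of_le (by positivity) hN
    exact_mod_cast this
  have hN0 : (0 : ℝ) < N := by exact_mod_cast hNpos
  refine ⟨2 * Real.exp (2 * (treeSize b N * β)), fun r H => ?_⟩
  refine relaxationTime_le _ _ _ (by positivity) ?_
  rw [isingWeight_tree]
  intro f
  have hw := parentWeight_pos par (treeCoupling (b := b) (r := r) β) H
  have hb' : (b : ℝ) * (1 - 2 * eps β) * (1 / Real.sqrt b) ≤ q := by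
    rw [hq, mul_one_div, div_le_iff₀ hsq, mul_assoc, Real.mul_self_sqrt hb0.le, mul_comm]
  have hq' : 1 - 2 * eps β ≤ q * (1 / Real.sqrt b) := by
    rw [hq, mul_assoc, mul_one_div, div_self hsq.ne', mul_one]
  refine (energy_univ_le_slab hβ (by positivity) hq0 hS hS0.le hb' hq' hθ hNpos hN f).trans ?_
  rw [mul_assoc]
  refine mul_le_mul_of_nonneg_left ?_ zero_le_two
  rw [inv_mul_le_iff₀ hN0]
  have hbd : ∀ s ∈ Finset.range N, energy (parentWeight par (treeCoupling β) H) (slab b r N s) f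
      ≤ Real.exp (2 * (treeSize b N * β))
        * ∑ v, energy (parentWeight par (treeCoupling β) H) {v} f := by
    intro s hs
    refine (blockPoincare_slab hβ (Finset.mem_range.1 hs) f).trans ?_
    gcongr
    · intro i _ _
      exact energy_nonneg hw _ _
    · exact Finset.subset_univ _
  refine (Finset.sum_le_card_nsmul _ _ _ hbd).trans ?_
  rw [Finset.card_range, nsmul_eq_mul]

end HighTemperature

/-! ### Embedded copies of a system, and commuting conditional expectations. -/

section Transport

variable {V W : Type} [DecidableEq V] [Fintype V] [DecidableEq W] [Fintype W]

lemma sum_comp_injective {φ : W → V} (hφ : Function.Injective φ) (Ψ : (W → ℤˣ) → ℝ) :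
    ∑ σ : V → ℤˣ, Ψ (σ ∘ φ)
      = (Fintype.card (V → ℤˣ) : ℝ) / Fintype.card (W → ℤˣ) * ∑ η, Ψ η := by
  have hW := card_cfg_pos (V := W)
  have h1 : ∀ η₀ : W → ℤˣ, ∑ σ : V → ℤˣ, Ψ (η₀ * (σ ∘ φ)) = ∑ σ : V → ℤˣ, Ψ (σ ∘ φ) := by
    intro η₀
    refine Fintype.sum_equiv (Equiv.mulLeft (Function.extend φ η₀ 1)) _ _ fun σ => ?_
    congr 1
    funext x
    simp [hφ.extend_apply]
  have h2 : ∑ η₀ : W → ℤˣ, ∑ σ : V → ℤˣ, Ψ (η₀ * (σ ∘ φ))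
      = Fintype.card (W → ℤˣ) * ∑ σ : V → ℤˣ, Ψ (σ ∘ φ) := by
    simp only [h1, Finset.sum_const, Finset.card_univ, nsmul_eq_mul]
  rw [Finset.sum_comm] at h2
  have h3 : ∀ σ : V → ℤˣ, ∑ η₀ : W → ℤˣ, Ψ (η₀ * (σ ∘ φ)) = ∑ η, Ψ η := fun σ =>
    Fintype.sum_equiv (Equiv.mulRight (σ ∘ φ)) _ _ fun _ => rfl
  simp only [h3, Finset.sum_const, Finset.card_univ, nsmul_eq_mul] at h2
  field_simp
  linarith

lemma av_image {φ : W → V} (hφ : Function.Injective φ) (F : (V → ℤˣ) → ℝ) (σ : V → ℤˣ) :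
    av (Finset.univ.image φ) F σ
      = (Fintype.card (W → ℤˣ) : ℝ)⁻¹ * ∑ η : W → ℤˣ, F (Function.extend φ η σ) := by
  have hV := card_cfg_pos (V := V)
  have key : ∀ ξ : V → ℤˣ, (Finset.univ.image φ).piecewise ξ σ
      = Function.extend φ (ξ ∘ φ) σ := by
    intro ξ
    funext v
    by_cases hv : ∃ x, φ x = v
    · obtain ⟨x, rfl⟩ := hv
      rw [hφ.extend_apply, Finset.piecewise_eq_of_mem _ _ _
        (Finset.mem_image_of_mem φ (Finset.mem_univ x))]
      rfl
    · rw [Function.extend_apply' _ _ _ hv, Finset.piecewise_eq_of_notMem]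
      simpa using hv
  unfold av
  simp only [key]
  rw [sum_comp_injective hφ (fun η => F (Function.extend φ η σ))]
  field_simp

lemma update_extend {φ : W → V} (hφ : Function.Injective φ) (η : W → ℤˣ) (σ : V → ℤˣ) (x : W)
    (a : ℤˣ) : Function.update (Function.extend φ η σ) (φ x) a
      = Function.extend φ (Function.update η x a) σ := by
  funext v
  by_cases hv : ∃ y, φ y = v
  · obtain ⟨y, rfl⟩ := hv
    rw [hφ.extend_apply]
    by_cases hyx : y = x
    · subst hyx
      simp
    · rw [Function.update_of_ne (fun h => hyx (hφ h)), Function.update_of_ne hyx,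
        hφ.extend_apply]
  · rw [Function.extend_apply' _ _ _ hv, Function.update_of_ne, Function.extend_apply' _ _ _ hv]
    rintro rfl
    exact hv ⟨x, rfl⟩

/-- A Poincaré inequality for the system `W` gives one for every block on which the conditional
measures are copies of `W`. -/
lemma BlockPoincare.of_embedding {φ : W → V} (hφ : Function.Injective φ) {w : (V → ℤˣ) → ℝ}
    {w₀ : (W → ℤˣ) → ℝ} {g : (V → ℤˣ) → ℝ} (hg : ∀ σ, 0 < g σ)
    (hfac : ∀ η σ, w (Function.extend φ η σ) = w₀ η * g σ) {K : ℝ}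
    (h : BlockPoincare w₀ Finset.univ K) : BlockPoincare w (Finset.univ.image φ) K := by
  intro f
  have hW := card_cfg_pos (V := W)
  set fσ : (V → ℤˣ) → (W → ℤˣ) → ℝ := fun σ η => f (Function.extend φ η σ) with hfσ
  have hEA : ∀ σ η, condAvg w (Finset.univ.image φ) f (Function.extend φ η σ)
      = condAvg w₀ Finset.univ (fσ σ) η := by
    intro σ η
    have e : condAvg w (Finset.univ.image φ) f (Function.extend φ η σ)
        = condAvg w (Finset.univ.image φ) f σ := by
      refine condAvg_indepOf _ _ _ _ _ fun v hv => ?_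
      rw [Function.extend_apply']
      simpa using hv
    rw [e, condAvg, condAvg, av_image hφ, av_image hφ, av_univ, av_univ]
    simp only [hfac]
    have : ∀ η, w₀ η * g σ * f (Function.extend φ η σ) = g σ * (w₀ η * fσ σ η) := fun η => by
      rw [hfσ]; ring
    simp only [this, ← Finset.mul_sum, ← Finset.sum_mul]
    have := (hg σ).ne'
    rw [mul_left_comm, ← mul_assoc _ _ (g σ), mul_comm _ (g σ), mul_div_mul_left _ _ this]
  have hEx : ∀ σ η x, condAvg w {φ x} f (Function.extend φ η σ)
      = condAvg w₀ {x} (fσ σ) η := by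
    intro σ η x
    rw [condAvg, condAvg, av_singleton, av_singleton, av_singleton, av_singleton]
    simp only [update_extend hφ, hfac]
    rw [div_div_div_cancel_right₀ two_ne_zero, div_div_div_cancel_right₀ two_ne_zero]
    have : ∀ η, w₀ η * g σ * f (Function.extend φ η σ) = g σ * (w₀ η * fσ σ η) := fun η => by
      rw [hfσ]; ring
    simp only [this, ← Finset.mul_sum, ← Finset.sum_mul]
    rw [mul_comm _ (g σ), mul_div_mul_left _ _ (hg σ).ne']
  have hen : ∀ (B : Finset V) (B' : Finset W),
      (∀ σ η, condAvg w B f (Function.extend φ η σ) = condAvg w₀ B' (fσ σ) η) →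
      energy w B f = (Fintype.card (W → ℤˣ) : ℝ)⁻¹ * ∑ σ, g σ * energy w₀ B' (fσ σ) := by
    intro B B' hB
    unfold energy
    rw [← sum_av (Finset.univ.image φ), Finset.mul_sum]
    refine Finset.sum_congr rfl fun σ _ => ?_
    rw [av_image hφ]
    congr 1
    rw [Finset.mul_sum]
    refine Finset.sum_congr rfl fun η _ => ?_
    rw [hB, hfac, hfσ]
    ring
  rw [Finset.sum_image fun x _ y _ hxy => hφ hxy, hen _ _ hEA]
  have : ∑ x, energy w {φ x} f
      = (Fintype.card (W → ℤˣ) : ℝ)⁻¹ * ∑ σ, g σ * ∑ x, energy w₀ {x} (fσ σ) := by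
    simp only [hen _ _ fun σ η => hEx σ η _, ← Finset.mul_sum]
    rw [Finset.sum_comm]
    simp only [← Finset.mul_sum]
  rw [this, mul_left_comm]
  gcongr
  rw [Finset.mul_sum]
  refine Finset.sum_le_sum fun σ _ => ?_
  rw [mul_left_comm]
  exact mul_le_mul_of_nonneg_left (h _) (hg σ).le

lemma Separates.mono {w : (V → ℤˣ) → ℝ} {A B A' B' : Finset V} (h : Separates w A B)
    (hA : A' ⊆ A) (hB : B' ⊆ B) : Separates w A' B' := by
  obtain ⟨hd, g, h, hw, hg, hh⟩ := h
  exact ⟨hd.mono hA hB, g, h, hw, hg.mono hA, hh.mono hB⟩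

/-- Splitting E_D into its parts on `D ∩ A` and `D \ A`, the first part is absorbed by E_A on either
side; both products equal the conditional expectation over `A ∪ (D \ A)`. -/
lemma condAvg_comm {w : (V → ℤˣ) → ℝ} (hw : ∀ σ, 0 < w σ) {A D : Finset V}
    (hs : Separates w A (D \ A)) (f : (V → ℤˣ) → ℝ) :
    condAvg w A (condAvg w D f) = condAvg w D (condAvg w A f) := by
  have h1 : Separates w (D ∩ A) (D \ A) := hs.mono Finset.inter_subset_right subset_rfl
  have hD : (D ∩ A) ∪ (D \ A) = D := by
    rw [Finset.union_comm, Finset.sdiff_union_inter]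
  have e1 : ∀ f, condAvg w D f = condAvg w (D ∩ A) (condAvg w (D \ A) f) := fun f => by
    rw [h1.condAvg_condAvg hw, hD]
  have e2 : ∀ f, condAvg w D f = condAvg w (D \ A) (condAvg w (D ∩ A) f) := fun f => by
    rw [h1.symm.condAvg_condAvg hw, Finset.union_comm, hD]
  rw [e1 f, condAvg_condAvg_of_subset hw Finset.inter_subset_right, e2,
    condAvg_condAvg_of_superset hw Finset.inter_subset_right, hs.condAvg_condAvg hw,
    hs.symm.condAvg_condAvg hw, Finset.union_comm]

end Transport

/-! ### Submultiplicativity of the relaxation time in the depth. -/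

section Submultiplicative

variable {b : ℕ}

/-- The ancestor of `v` at level `r`, or `v` itself if its level is at most `r`. -/
def anc {R : ℕ} (r : ℕ) (v : TreeVertex b R) : TreeVertex b R :=
  ⟨v.1.drop (v.1.length - r), (List.length_drop ▸ Nat.sub_le _ _).trans v.2⟩

lemma length_anc {R : ℕ} (r : ℕ) (v : TreeVertex b R) :
    (anc r v).1.length = min v.1.length r := by
  simp only [anc, List.length_drop]
  omega

lemma anc_of_le {R r : ℕ} {v : TreeVertex b R} (h : v.1.length ≤ r) : anc r v = v := by
  ext1
  simp [anc, Nat.sub_eq_zero_of_le h]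

lemma anc_par {R r : ℕ} {v : TreeVertex b R} (h : r < v.1.length) : anc r (par v) = anc r v := by
  ext1
  simp only [anc, par, List.length_tail]
  obtain ⟨a, l, hl⟩ := List.exists_cons_of_length_pos (Nat.zero_lt_of_lt h)
  rw [hl] at h ⊢
  simp only [List.length_cons, List.tail_cons] at h ⊢
  rw [show l.length + 1 - r = (l.length + 1 - 1 - r) + 1 by omega, List.drop_succ_cons]

/-- The inclusion of the tree with `r` levels into the tree with `R ≥ r` levels. -/
def incl {r R : ℕ} (h : r ≤ R) (v : TreeVertex b r) : TreeVertex b R := ⟨v.1, v.2.trans h⟩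

lemma incl_injective {r R : ℕ} (h : r ≤ R) : Function.Injective (incl (b := b) h) := by
  intro v v' hv
  ext1
  exact congrArg (fun x => x.1) hv

lemma anc_mem_image_incl {r R : ℕ} (h : r ≤ R) (v : TreeVertex b R) :
    anc r v ∈ Finset.univ.image (incl h) := by
  rw [Finset.mem_image]
  exact ⟨⟨(anc r v).1, (length_anc r v).trans_le (min_le_right _ _)⟩, Finset.mem_univ _, rfl⟩

lemma sum_anc {r R : ℕ} (h : r ≤ R) (g : TreeVertex b R → ℝ) :
    ∑ x : TreeVertex b r, ∑ v ∈ Finset.univ.filter fun v => anc r v = incl h x, g v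
      = ∑ v, g v := by
  rw [← Finset.sum_fiberwise_of_maps_to (s := Finset.univ) (t := Finset.univ.image (incl h))
    (g := anc r) (fun v _ => anc_mem_image_incl h v) g,
    Finset.sum_image fun x _ y _ hxy => incl_injective h hxy]

/-- Spins at level at most `r` are extended to the lower levels along the ancestor map. -/
def extendDown {r R : ℕ} (η : TreeVertex b r → ℤˣ) (v : TreeVertex b R) : ℤˣ :=
  η ⟨(anc r v).1, (length_anc r v).trans_le (min_le_right _ _)⟩

/-- Without external field, the restriction to the first `r` levels of the Ising model on the tree
is the Ising model on the tree with `r` levels. -/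
lemma exists_marginal {r R : ℕ} (h : r ≤ R) (β : ℝ) :
    ∃ c : ℝ, 0 < c ∧ ∀ Φ : (TreeVertex b r → ℤˣ) → ℝ,
      ∑ σ, parentWeight par (treeCoupling β) (fun _ => 0) σ * Φ (σ ∘ incl h)
        = c * ∑ η, parentWeight par (treeCoupling β) (fun _ => 0) η * Φ η := by
  set D : Finset (TreeVertex b R) := Finset.univ.filter fun v => r < v.1.length with hD
  -- Gauge change: spins below level r are measured relative to their ancestor at level r. In zero
  -- field the weight then factors, and at level r + 1 the edge to the parent becomes a term in a
  -- single spin.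
  set Γ : (TreeVertex b R → ℤˣ) → TreeVertex b R → ℤˣ :=
    fun σ v => if v.1.length ≤ r then σ v else σ v * σ (anc r v) with hΓ
  have hanc : ∀ v : TreeVertex b R, (anc r v).1.length ≤ r := fun v =>
    (length_anc r v).trans_le (min_le_right _ _)
  have hinv : Function.Involutive Γ := by
    intro σ
    funext v
    simp only [hΓ, hanc, if_true]
    split_ifs
    · rfl
    · rw [mul_assoc, Int.units_mul_self, mul_one]
  set q : (TreeVertex b R → ℤˣ) → ℝ := fun σ => Real.exp (∑ v ∈ D,
    treeCoupling β v * (if v.1.length = r + 1 then spin σ v else spin σ v * spin σ (par v)))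
    with hq
  have hqD : IndepOf Dᶜ q := by
    intro σ τ hστ
    rw [hq]
    dsimp only
    congr 1
    refine Finset.sum_congr rfl fun v hv => ?_
    have hv' : r < v.1.length := (Finset.mem_filter.1 hv).2
    rw [spin_congr (hστ v (by simpa using hv))]
    split_ifs with h1
    · rfl
    · rw [spin_congr (hστ (par v) _)]
      rw [Finset.mem_compl, not_not, hD, Finset.mem_filter]
      refine ⟨Finset.mem_univ _, ?_⟩
      simp only [par, List.length_tail]
      omega
  have hqpos : ∀ σ, 0 < q σ := fun σ => Real.exp_pos _
  have hw : ∀ σ, parentWeight par (treeCoupling β) (fun _ => 0) (Γ σ)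
      = parentWeight par (treeCoupling β) (fun _ => 0) (σ ∘ incl h) * q σ := by
    intro σ
    simp only [parentWeight, hq, zero_mul, add_zero]
    rw [← Real.exp_add]
    congr 1
    rw [← Finset.sum_filter_not_add_sum_filter (s := Finset.univ)
      (p := fun v : TreeVertex b R => r < v.1.length)]
    congr 1
    · symm
      refine Finset.sum_bij (fun x _ => incl h x) ?_ ?_ ?_ ?_
      · intro x _
        simpa [incl] using x.2
      · intro x _ y _ hxy
        exact incl_injective h hxy
      · intro v hv
        have hv' : v.1.length ≤ r := by simpa using hv
        exact ⟨⟨v.1, hv'⟩, Finset.mem_univ _, rfl⟩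
      · intro x _
        have h1 : Γ σ (incl h x) = σ (incl h x) := if_pos x.2
        have h2 : Γ σ (par (incl h x)) = σ (par (incl h x)) := by
          refine if_pos ?_
          have := x.2
          simp only [par, incl, List.length_tail]
          omega
        rw [spin_congr h1, spin_congr h2]
        rfl
    · refine Finset.sum_congr rfl fun v hv => ?_
      have hv' : r < v.1.length := (Finset.mem_filter.1 hv).2
      have h1 : spin (Γ σ) v = spin σ v * spin σ (anc r v) := by
        simp only [spin, hΓ, if_neg hv'.not_ge]
        push_cast
        rfl
      have hne : v.1 ≠ [] := fun h0 => by simp [h0] at hv'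
      have hlen := length_par hne
      rw [h1]
      split_ifs with h2
      · have h3 : anc r v = par v := by
          rw [← anc_par hv', anc_of_le (by omega)]
        have h4 : spin (Γ σ) (par v) = spin σ (par v) := by
          simp only [spin, hΓ]
          rw [if_pos (by omega)]
        rw [h3, h4, mul_assoc, spin_mul_self, mul_one]
      · have h4 : spin (Γ σ) (par v) = spin σ (par v) * spin σ (anc r v) := by
          simp only [spin, hΓ]
          rw [if_neg (by omega), anc_par hv']
          push_cast
          rfl
        rw [h4]
        have := spin_mul_self σ (anc r v)
        linear_combination treeCoupling β v * spin σ v * spin σ (par v) * this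
  -- `q` involves only spins in `D`, so its average over `D` is a constant, whatever the top spins
  -- are.
  have hκ : ∀ σ, av D q σ = av D q 1 := fun σ => by
    have h1 := av_indepOf D q
    have h2 : IndepOf Dᶜ (av D q) := av_indepOf_of hqD
    have e1 := h1.piecewise (1 : TreeVertex b R → ℤˣ) σ
    rw [← e1]
    refine h2 _ _ fun v hv => ?_
    rw [Finset.mem_compl, not_not] at hv
    simp [hv]
  have hcV := card_cfg_pos (V := TreeVertex b R)
  have hcW := card_cfg_pos (V := TreeVertex b r)
  refine ⟨av D q 1 * (Fintype.card (TreeVertex b R → ℤˣ) / Fintype.card (TreeVertex b r → ℤˣ)),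
    mul_pos (av_pos hqpos _ _) (div_pos hcV hcW), fun Φ => ?_⟩
  set Ψ : (TreeVertex b r → ℤˣ) → ℝ :=
    fun η => parentWeight par (treeCoupling β) (fun _ => 0) η * Φ η
  have hΨ : IndepOf D fun σ => Ψ (σ ∘ incl h) := by
    intro σ τ hστ
    have : σ ∘ incl h = τ ∘ incl h := by
      funext x
      refine hστ _ fun hx => ?_
      have h1 : r < (incl h x).1.length := (Finset.mem_filter.1 hx).2
      exact h1.not_ge x.2
    simp only [this]
  calc ∑ σ, parentWeight par (treeCoupling β) (fun _ => 0) σ * Φ (σ ∘ incl h)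
      = ∑ σ, parentWeight par (treeCoupling β) (fun _ => 0) (Γ σ) * Φ (Γ σ ∘ incl h) :=
        (Equiv.sum_comp hinv.toPerm _).symm
    _ = ∑ σ, Ψ (σ ∘ incl h) * q σ := by
        refine Finset.sum_congr rfl fun σ _ => ?_
        have : Γ σ ∘ incl h = σ ∘ incl h := funext fun x => if_pos x.2
        rw [hw, this]
        ring
    _ = ∑ σ, Ψ (σ ∘ incl h) * av D q 1 := by
        rw [← sum_av D]
        refine Finset.sum_congr rfl fun σ _ => ?_
        rw [av_mul_left hΨ, hκ]
    _ = _ := by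
        rw [← Finset.sum_mul, sum_comp_injective (incl_injective h)]
        ring

/-- The Poincaré inequality for the first `r` levels, lifted to blocks of the whole tree. -/
lemma energy_univ_condAvg_le {r R : ℕ} (h : r ≤ R) (β : ℝ) {K : ℝ} (hK : 0 ≤ K)
    (hP : BlockPoincare (parentWeight par (treeCoupling (b := b) (r := r) β) fun _ => 0)
      Finset.univ K) (f : (TreeVertex b R → ℤˣ) → ℝ) :
    energy (parentWeight par (treeCoupling β) fun _ => 0) Finset.univ
      (condAvg (parentWeight par (treeCoupling β) fun _ => 0)
        (Finset.univ.filter fun v => r < v.1.length) f)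
      ≤ K * ∑ x : TreeVertex b r, energy (parentWeight par (treeCoupling β) fun _ => 0)
        (Finset.univ.filter fun v => anc r v = incl h x) f := by
  set w : (TreeVertex b R → ℤˣ) → ℝ := parentWeight par (treeCoupling β) fun _ => 0 with hwdef
  have hw : ∀ σ, 0 < w σ := parentWeight_pos _ _ _
  set wr : (TreeVertex b r → ℤˣ) → ℝ := parentWeight par (treeCoupling β) fun _ => 0 with hwrdef
  have hwr : ∀ σ, 0 < wr σ := parentWeight_pos _ _ _
  set D : Finset (TreeVertex b R) := Finset.univ.filter fun v => r < v.1.length with hD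
  obtain ⟨c, hc, hmarg⟩ := exists_marginal (b := b) h β
  have hrestr : ∀ G : (TreeVertex b R → ℤˣ) → ℝ, IndepOf D G → ∀ σ,
      G (extendDown (σ ∘ incl h)) = G σ := by
    intro G hG σ
    refine hG _ _ fun v hv => ?_
    have hv' : v.1.length ≤ r := by simpa [hD] using hv
    simp only [extendDown, Function.comp, incl]
    congr 1
    ext1
    exact congrArg Subtype.val (anc_of_le hv')
  set G := condAvg w D f with hG
  have hGD : IndepOf D G := condAvg_indepOf w D f
  set F : (TreeVertex b r → ℤˣ) → ℝ := fun η => G (extendDown η) with hF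
  -- `G` depends only on the first r levels, so its variance is that of `F` in the model on T_r, up
  -- to the constant of `exists_marginal`.
  have h1 : energy w Finset.univ G ≤ c * energy wr Finset.univ F := by
    refine (energy_le hw (IndepOf.const Finset.univ (condAvg wr Finset.univ F 1)) G).trans ?_
    have : ∀ η, condAvg wr Finset.univ F η = condAvg wr Finset.univ F 1 := fun η =>
      condAvg_indepOf wr Finset.univ F _ _ fun v hv => absurd (Finset.mem_univ v) hv
    unfold energy
    simp only [this]
    rw [← hmarg]
    refine le_of_eq (Finset.sum_congr rfl fun σ _ => ?_)
    rw [hF]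
    simp only [hrestr G hGD, hwdef]
  refine h1.trans ((mul_le_mul_of_nonneg_left (hP F) hc.le).trans ?_)
  rw [mul_left_comm, Finset.mul_sum]
  refine mul_le_mul_of_nonneg_left (Finset.sum_le_sum fun x _ => ?_) hK
  set A : Finset (TreeVertex b R) := Finset.univ.filter fun v => anc r v = incl h x with hA
  have hmemA : ∀ v, v ∈ A ↔ anc r v = incl h x := fun v => by simp [hA]
  -- `A` is the whole subtree at `x` when `x` has level r, and `{x}` otherwise. Either way no edge
  -- joins it to `D \ A`, so E_A and E_D commute.
  have hsep : Separates w A (D \ A) := by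
    refine separates_parentWeight Finset.disjoint_sdiff ?_ ?_
    · intro v hv hp
      rw [Finset.mem_sdiff] at hp
      have hlt : r < (par v).1.length := (Finset.mem_filter.1 hp.1).2
      have hlt2 : r < v.1.length := by
        simp only [par, List.length_tail] at hlt
        omega
      exact absurd ((hmemA _).2 ((anc_par hlt2).trans ((hmemA v).1 hv))) hp.2
    · intro v hv hp
      rw [Finset.mem_sdiff] at hv
      have hlt : r < v.1.length := (Finset.mem_filter.1 hv.1).2
      exact absurd ((hmemA _).2 ((anc_par hlt).symm.trans ((hmemA _).1 hp))) hv.2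
  set G' := condAvg w A G with hG'
  have hcomm : G' = condAvg w D (condAvg w A f) := condAvg_comm hw hsep f
  have hG'D : IndepOf D G' := hcomm ▸ condAvg_indepOf w D _
  have hF' : IndepOf {x} fun η => G' (extendDown η) := by
    intro η η' hη
    refine condAvg_indepOf w A G _ _ fun v hv => ?_
    simp only [extendDown]
    refine hη _ fun hx => hv ?_
    rw [hmemA]
    ext1
    have hx' := congrArg Subtype.val (Finset.mem_singleton.1 hx)
    exact hx'
  -- E_A G serves as a guess for F at `x`; by commutation G - E_A G = E_D (f - E_A f), and E_D is a
  -- contraction.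
  calc c * energy wr {x} F ≤ c * ∑ η, wr η * (F η - G' (extendDown η)) ^ 2 := by
        gcongr
        exact energy_le hwr hF' F
    _ = ∑ σ, w σ * (G σ - G' σ) ^ 2 := by
        rw [← hmarg]
        refine Finset.sum_congr rfl fun σ _ => ?_
        rw [hF]
        simp only [hrestr G hGD, hrestr G' hG'D, hwdef]
    _ = ∑ σ, w σ * condAvg w D (fun τ => f τ - condAvg w A f τ) σ ^ 2 := by
        simp only [condAvg_sub, ← hcomm, hG]
    _ ≤ energy w A f := sum_sq_condAvg_le hw D _

/-- Words are appended to `u`, giving a copy of the tree with `s` levels below `u`. -/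
def graft {R s : ℕ} (u : TreeVertex b R) (h : u.1.length + s ≤ R) (x : TreeVertex b s) :
    TreeVertex b R :=
  ⟨x.1 ++ u.1, by have := x.2; rw [List.length_append]; omega⟩

lemma graft_injective {R s : ℕ} (u : TreeVertex b R) (h : u.1.length + s ≤ R) :
    Function.Injective (graft u h) := by
  intro x y hxy
  ext1
  exact List.append_cancel_right (congrArg Subtype.val hxy)

lemma image_graft {R s : ℕ} (u : TreeVertex b R) (h : u.1.length + s = R) :
    Finset.univ.image (graft u h.le) = desc u := by
  ext v
  rw [Finset.mem_image, mem_desc]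
  constructor
  · rintro ⟨x, _, rfl⟩
    exact List.suffix_append _ _
  · rintro ⟨l, hl⟩
    have h2 := v.2
    rw [← hl, List.length_append] at h2
    exact ⟨⟨l, by omega⟩, Finset.mem_univ _, Subtype.ext hl⟩

/-- With the edge above `u` cut, the conditional law below `u` is exactly the free model on T_s.
Restoring this one edge costs `exp (2 * β)`. -/
lemma blockPoincare_desc {R s : ℕ} (u : TreeVertex b R) (h : u.1.length + s = R) {β : ℝ}
    (hβ : 0 ≤ β) {K : ℝ} (hK : 0 ≤ K)
    (hP : BlockPoincare (parentWeight par (treeCoupling (b := b) (r := s) β) fun _ => 0)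
      Finset.univ K) :
    BlockPoincare (parentWeight par (treeCoupling β) fun _ => 0) (desc u)
      (K * Real.exp (2 * β)) := by
  set J' : TreeVertex b R → ℝ := fun v => if v = u then 0 else treeCoupling β v with hJ'
  have hcut : BlockPoincare (parentWeight par J' fun _ => 0) (desc u) K := by
    rw [← image_graft u h]
    refine BlockPoincare.of_embedding (graft_injective u h.le)
      (g := fun σ => Real.exp (∑ v ∈ (desc u)ᶜ, J' v * (spin σ v * spin σ (par v))))
      (fun σ => Real.exp_pos _) (fun η σ => ?_) hP
    simp only [parentWeight, zero_mul, add_zero]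
    rw [← Real.exp_add]
    congr 1
    have hin : ∀ x, spin (Function.extend (graft u h.le) η σ) (graft u h.le x) = spin η x :=
      fun x => by rw [spin, (graft_injective u h.le).extend_apply]; rfl
    have hout : ∀ v, v ∉ desc u → spin (Function.extend (graft u h.le) η σ) v = spin σ v := by
      intro v hv
      rw [spin, Function.extend_apply']
      · rfl
      · rw [← image_graft u h] at hv
        simpa using hv
    rw [← Finset.sum_add_sum_compl (desc u)]
    congr 1
    · rw [← image_graft u h, Finset.sum_image fun x _ y _ hxy => graft_injective u h.le hxy]
      refine Finset.sum_congr rfl fun x _ => ?_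
      by_cases hx : x.1 = []
      · have : graft u h.le x = u := by
          ext1
          simp [graft, hx]
        simp [hJ', this, treeCoupling, hx]
      · have h1 : graft u h.le x ≠ u := by
          intro h0
          have := congrArg (fun v => v.1.length) h0
          simp only [graft, List.length_append] at this
          have := List.length_pos_of_ne_nil hx
          omega
        have h2 : par (graft u h.le x) = graft u h.le (par x) := by
          ext1
          simp only [par, graft]
          rw [List.tail_append_of_ne_nil hx]
        rw [h2, hin, hin, hJ']
        simp only [if_neg h1, treeCoupling, if_neg hx]
        rw [if_neg]
        simp [graft, hx]
    · refine Finset.sum_congr rfl fun v hv => ?_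
      rw [Finset.mem_compl] at hv
      have hvu : v ≠ u := fun h0 => hv (h0 ▸ self_mem_desc u)
      rw [hout v hv, hout (par v) fun hp => hv ((mem_desc_par hvu).2 hp)]
  refine (hcut.change_coupling (J := treeCoupling β) hK).mono (parentWeight_pos _ _ _) ?_
  gcongr
  rw [Finset.sum_eq_single u]
  · simp only [hJ', if_true, sub_zero, treeCoupling]
    split_ifs
    · simpa using hβ
    · rw [abs_of_nonneg hβ]
  · intro v _ hv
    simp [hJ', hv]
  · intro h0
    exact absurd (Finset.mem_univ u) h0

lemma treeRelaxationTime_spec (b r : ℕ) (β : ℝ) :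
    0 < treeRelaxationTime b r β ∧
      BlockPoincare (parentWeight par (treeCoupling (b := b) (r := r) β) fun _ => 0) Finset.univ
        (treeRelaxationTime b r β) := by
  have := relaxationTime_tree_spec (b := b) r β (fun _ => 0)
  rwa [isingWeight_tree] at this

lemma treeRelaxationTime_le {r : ℕ} {β K : ℝ} (hK : 0 < K)
    (h : BlockPoincare (parentWeight par (treeCoupling (b := b) (r := r) β) fun _ => 0)
      Finset.univ K) : treeRelaxationTime b r β ≤ K :=
  relaxationTime_le _ _ _ hK (by rwa [isingWeight_tree])

lemma energy_univ_pos {V : Type} [DecidableEq V] [Fintype V] {w : (V → ℤˣ) → ℝ}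
    (hw : ∀ σ, 0 < w σ) {f : (V → ℤˣ) → ℝ} {σ τ : V → ℤˣ} (h : f σ ≠ f τ) :
    0 < energy w Finset.univ f := by
  refine (energy_nonneg hw _ f).lt_of_ne' fun h0 => h ?_
  have h1 := (Finset.sum_eq_zero_iff_of_nonneg
    fun σ _ => mul_nonneg (hw σ).le (sq_nonneg _)).1 h0
  have h2 : ∀ σ, f σ = condAvg w Finset.univ f σ := by
    intro σ
    have := (mul_eq_zero.1 (h1 σ (Finset.mem_univ σ))).resolve_left (hw σ).ne'
    exact sub_eq_zero.1 (pow_eq_zero_iff two_ne_zero |>.1 this)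
  rw [h2 σ, h2 τ]
  exact condAvg_indepOf w _ f _ _ fun v hv => absurd (Finset.mem_univ v) hv

/-- Test function: the spin at the root. Its only local energy is at the root, and this is at most
its variance. -/
lemma one_le_treeRelaxationTime (b r : ℕ) (β : ℝ) : 1 ≤ treeRelaxationTime b r β := by
  obtain ⟨-, hP⟩ := treeRelaxationTime_spec b r β
  have hw := parentWeight_pos par (treeCoupling (b := b) (r := r) β) fun _ => 0
  set w := parentWeight par (treeCoupling (b := b) (r := r) β) fun _ => 0
  set f : (TreeVertex b r → ℤˣ) → ℝ := fun σ => spin σ (root b r)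
  have hpos : 0 < energy w Finset.univ f := by
    refine energy_univ_pos hw (σ := fun _ => 1) (τ := fun _ => -1) ?_
    norm_num [f, spin]
  have h1 := hP f
  have h2 : ∑ v, energy w {v} f = energy w {root b r} f := by
    refine Finset.sum_eq_single _ (fun v _ hv => energy_eq_zero_of_indepOf hw ?_)
      fun h => absurd (Finset.mem_univ _) h
    intro σ τ h
    exact spin_congr (h _ (by simpa using hv.symm))
  rw [h2] at h1
  have h3 := energy_mono hw (Finset.subset_univ {root b r}) f
  have h4 := energy_nonneg hw {root b r} f
  by_contra! hlt
  rcases h4.eq_or_lt with h5 | h5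
  · rw [← h5, mul_zero] at h1
    exact hpos.not_ge h1
  · exact (mul_lt_of_lt_one_left h5 hlt).not_ge (h3.trans h1)

/-- The relaxation time is submultiplicative in the depth, up to a constant. -/
lemma treeRelaxationTime_add_le (b r s : ℕ) {β : ℝ} (hβ : 0 ≤ β) :
    treeRelaxationTime b (r + s) β
      ≤ 2 * Real.exp (2 * β) * (treeRelaxationTime b r β * treeRelaxationTime b s β) := by
  obtain ⟨hr0, hr⟩ := treeRelaxationTime_spec b r β
  obtain ⟨hs0, hs⟩ := treeRelaxationTime_spec b s β
  have hr1 := one_le_treeRelaxationTime b r β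
  have hs1 := one_le_treeRelaxationTime b s β
  set τr := treeRelaxationTime b r β
  set τs := treeRelaxationTime b s β
  have he1 : 1 ≤ Real.exp (2 * β) := Real.one_le_exp (by linarith)
  refine treeRelaxationTime_le (by positivity) fun f => ?_
  have h := Nat.le_add_right r s
  set w : (TreeVertex b (r + s) → ℤˣ) → ℝ := parentWeight par (treeCoupling β) fun _ => 0
    with hwdef
  have hw : ∀ σ, 0 < w σ := parentWeight_pos _ _ _
  set D : Finset (TreeVertex b (r + s)) := Finset.univ.filter fun v => r < v.1.length with hD
  set A : TreeVertex b (r + s) → Finset (TreeVertex b (r + s)) :=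
    fun u => Finset.univ.filter fun v => anc r v = u with hA
  -- Law of total variance, given the first r levels.
  have h1 : energy w Finset.univ f
      = energy w D f + energy w Finset.univ (condAvg w D f) := by
    have := sum_sq_sub_eq hw ((condAvg_indepOf w Finset.univ f).mono (Finset.subset_univ D)) f
    change energy w Finset.univ f = _ at this
    rw [this]
    congr 1
    unfold energy
    rw [condAvg_condAvg_of_subset hw (Finset.subset_univ D)]
  have h2 : energy w Finset.univ (condAvg w D f)
      ≤ τr * ∑ x : TreeVertex b r, energy w (A (incl h x)) f :=
    energy_univ_condAvg_le h β hr0.le hr f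
  have h3 : energy w D f ≤ ∑ x : TreeVertex b r, energy w (A (incl h x)) f := by
    refine (energy_le_sum_classes D (anc r) (fun v hv _ _ =>
      (anc_par (Finset.mem_filter.1 hv).2).symm) f).trans ?_
    calc ∑ x ∈ D.image (anc r), energy w (D.filter fun v => anc r v = x) f
        ≤ ∑ x ∈ D.image (anc r), energy w (A x) f :=
          Finset.sum_le_sum fun x _ => energy_mono hw
            (Finset.filter_subset_filter _ (Finset.subset_univ D)) f
      _ ≤ ∑ x ∈ Finset.univ.image (incl h), energy w (A x) f := by
          refine Finset.sum_le_sum_of_subset_of_nonneg ?_ fun x _ _ => energy_nonneg hw _ _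
          intro x hx
          obtain ⟨v, -, rfl⟩ := Finset.mem_image.1 hx
          exact anc_mem_image_incl h v
      _ = _ := Finset.sum_image fun x _ y _ hxy => incl_injective h hxy
  have h4 : ∀ x : TreeVertex b r, energy w (A (incl h x)) f
      ≤ τs * Real.exp (2 * β) * ∑ v ∈ A (incl h x), energy w {v} f := by
    intro x
    -- Vertices at level r carry a copy of T_s; above them the block is a single site, for which the
    -- constant 1 is enough.
    rcases x.2.eq_or_lt with hx | hx
    · have : A (incl h x) = desc (incl h x) := by
        ext v
        rw [hA, Finset.mem_filter, mem_desc]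
        simp only [Finset.mem_univ, true_and]
        constructor
        · intro hv
          rw [← hv]
          exact List.drop_suffix _ _
        · intro hv
          ext1
          rw [List.suffix_iff_eq_drop.1 hv]
          simp only [anc]
          congr 2
          exact hx.symm
      rw [this]
      refine blockPoincare_desc (incl h x) ?_ hβ hs0.le hs f
      change x.1.length + s = r + s
      rw [hx]
    · have : A (incl h x) = {incl h x} := by
        ext v
        rw [hA, Finset.mem_filter, Finset.mem_singleton]
        simp only [Finset.mem_univ, true_and]
        constructor
        · intro hv
          have h5 := length_anc r v
          rw [hv] at h5
          have h6 : (incl h x).1.length = x.1.length := rfl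
          rw [← hv, anc_of_le]
          omega
        · rintro rfl
          exact anc_of_le x.2
      rw [this, Finset.sum_singleton]
      refine le_mul_of_one_le_left (energy_nonneg hw _ _) ?_
      nlinarith
  have h5 : ∑ x : TreeVertex b r, ∑ v ∈ A (incl h x), energy w {v} f
      = ∑ v, energy w {v} f :=
    sum_anc h fun v => energy w {v} f
  have h6 : ∑ x : TreeVertex b r, energy w (A (incl h x)) f
      ≤ τs * Real.exp (2 * β) * ∑ v, energy w {v} f := by
    rw [← h5, Finset.mul_sum]
    exact Finset.sum_le_sum fun x _ => h4 x
  have h7 : 0 ≤ ∑ x : TreeVertex b r, energy w (A (incl h x)) f :=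
    Finset.sum_nonneg fun x _ => energy_nonneg hw _ _
  calc energy w Finset.univ f ≤ (1 + τr) * ∑ x : TreeVertex b r, energy w (A (incl h x)) f := by
        rw [h1, add_mul, one_mul]
        exact add_le_add h3 h2
    _ ≤ (2 * τr) * ∑ x : TreeVertex b r, energy w (A (incl h x)) f :=
        mul_le_mul_of_nonneg_right (by linarith) h7
    _ ≤ (2 * τr) * (τs * Real.exp (2 * β) * ∑ v, energy w {v} f) :=
        mul_le_mul_of_nonneg_left h6 (by linarith)
    _ = _ := by ring

end Submultiplicative

/-! ### Expectations and disagreement probabilities. -/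

section Mean

variable {V : Type} [DecidableEq V] [Fintype V]

/-- Expectation under the probability measure proportional to `w`. -/
def mean (w F : (V → ℤˣ) → ℝ) : ℝ := (∑ σ, w σ * F σ) / ∑ σ, w σ

variable {w : (V → ℤˣ) → ℝ}

lemma sum_weight_pos (hw : ∀ σ, 0 < w σ) : 0 < ∑ σ, w σ :=
  Finset.sum_pos (fun σ _ => hw σ) Finset.univ_nonempty

lemma mean_mono (hw : ∀ σ, 0 < w σ) {F G : (V → ℤˣ) → ℝ} (h : ∀ σ, F σ ≤ G σ) :
    mean w F ≤ mean w G := by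
  unfold mean
  have := sum_weight_pos hw
  gcongr with σ
  · exact (hw σ).le
  · exact h σ

lemma mean_nonneg (hw : ∀ σ, 0 < w σ) {F : (V → ℤˣ) → ℝ} (h : ∀ σ, 0 ≤ F σ) : 0 ≤ mean w F :=
  div_nonneg (Finset.sum_nonneg fun σ _ => mul_nonneg (hw σ).le (h σ)) (sum_weight_pos hw).le

lemma mean_add (F G : (V → ℤˣ) → ℝ) : mean w (fun σ => F σ + G σ) = mean w F + mean w G := by
  simp only [mean, mul_add, Finset.sum_add_distrib, add_div]

lemma mean_const_mul (c : ℝ) (F : (V → ℤˣ) → ℝ) : mean w (fun σ => c * F σ) = c * mean w F := by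
  simp only [mean, mul_left_comm _ c, ← Finset.mul_sum, mul_div_assoc]

lemma mean_sum {ι : Type} (s : Finset ι) (F : ι → (V → ℤˣ) → ℝ) :
    mean w (fun σ => ∑ i ∈ s, F i σ) = ∑ i ∈ s, mean w (F i) := by
  simp only [mean, Finset.mul_sum]
  rw [Finset.sum_comm, Finset.sum_div]

lemma mean_const (hw : ∀ σ, 0 < w σ) (c : ℝ) : mean w (fun _ => c) = c := by
  unfold mean
  rw [← Finset.sum_mul, mul_div_cancel_left₀ _ (sum_weight_pos hw).ne']

lemma sum_weight_mul (hw : ∀ σ, 0 < w σ) (F : (V → ℤˣ) → ℝ) :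
    ∑ σ, w σ * F σ = (∑ σ, w σ) * mean w F := by
  rw [mean, mul_div_cancel₀ _ (sum_weight_pos hw).ne']

/-- Probability that `g` and `h` differ. -/
def disagree (w : (V → ℤˣ) → ℝ) (g h : (V → ℤˣ) → ℤˣ) : ℝ :=
  mean w fun σ => if g σ ≠ h σ then 1 else 0

lemma disagree_comm (g h : (V → ℤˣ) → ℤˣ) : disagree w g h = disagree w h g := by
  simp only [disagree, ne_comm]

lemma disagree_triangle (hw : ∀ σ, 0 < w σ) (g h k : (V → ℤˣ) → ℤˣ) :
    disagree w g k ≤ disagree w g h + disagree w h k := by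
  unfold disagree
  rw [← mean_add]
  refine mean_mono hw fun σ => ?_
  by_cases h1 : g σ = h σ
  · simp [h1]
  · rw [if_pos h1]
    have : (0 : ℝ) ≤ if h σ ≠ k σ then 1 else 0 := by split_ifs <;> norm_num
    split_ifs at * <;> linarith

lemma disagree_nonneg (hw : ∀ σ, 0 < w σ) (g h : (V → ℤˣ) → ℤˣ) : 0 ≤ disagree w g h :=
  mean_nonneg hw fun σ => by split_ifs <;> norm_num

end Mean

/-! ### Zero field: the edge variables are independent. -/

section ZeroField

variable {b R : ℕ} {β : ℝ}

/-- The weight of the Ising model on the tree without external field. -/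
def freeWeight (b R : ℕ) (β : ℝ) : (TreeVertex b R → ℤˣ) → ℝ :=
  parentWeight par (treeCoupling β) fun _ => 0

lemma freeWeight_pos (σ : TreeVertex b R → ℤˣ) : 0 < freeWeight b R β σ := parentWeight_pos _ _ _ σ

lemma freeWeight_eq (σ : TreeVertex b R → ℤˣ) :
    freeWeight b R β σ = Real.exp (∑ v, treeCoupling β v * (spin σ v * spin σ (par v))) := by
  simp [freeWeight, parentWeight]

/-- Copy the configuration `σ` below `v` into `τ`, preserving its edge variables. -/
def regraft (v : TreeVertex b R) (σ τ : TreeVertex b R → ℤˣ) : TreeVertex b R → ℤˣ :=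
  (desc v).piecewise (fun x => σ (par v) * τ (par v) * σ x) τ

lemma regraft_of_mem {v x : TreeVertex b R} (h : x ∈ desc v) (σ τ : TreeVertex b R → ℤˣ) :
    regraft v σ τ x = σ (par v) * τ (par v) * σ x := by
  simp [regraft, h]

lemma regraft_of_notMem {v x : TreeVertex b R} (h : x ∉ desc v) (σ τ : TreeVertex b R → ℤˣ) :
    regraft v σ τ x = τ x := by
  simp [regraft, h]

lemma units_cases (a : ℤˣ) : a = 1 ∨ a = -1 := Int.units_eq_one_or a

lemma regraft_edge {v : TreeVertex b R} (hv : v.1 ≠ []) (x : TreeVertex b R)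
    (σ τ : TreeVertex b R → ℤˣ) :
    regraft v σ τ x * regraft v σ τ (par x)
      = if x ∈ desc v then σ x * σ (par x) else τ x * τ (par x) := by
  have hp := par_notMem_desc hv
  by_cases hx : x = v
  · subst hx
    rw [regraft_of_mem (self_mem_desc x), regraft_of_notMem hp, if_pos (self_mem_desc x)]
    rcases units_cases (σ (par x)) with h1 | h1 <;> rcases units_cases (τ (par x)) with h2 | h2 <;>
      simp [h1, h2]
  · by_cases hm : x ∈ desc v
    · rw [regraft_of_mem hm, regraft_of_mem ((mem_desc_par hx).1 hm), if_pos hm]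
      rcases units_cases (σ (par v)) with h1 | h1 <;>
        rcases units_cases (τ (par v)) with h2 | h2 <;> simp [h1, h2]
    · rw [regraft_of_notMem hm, regraft_of_notMem fun h => hm ((mem_desc_par hx).2 h), if_neg hm]

lemma spin_mul_spin (σ : TreeVertex b R → ℤˣ) (x y : TreeVertex b R) :
    spin σ x * spin σ y = (((σ x * σ y : ℤˣ) : ℤ) : ℝ) := by
  simp [spin]

/-- The exchange only moves each edge variable from one configuration to the other, and in zero
field the weight is a function of the edge variables. -/
lemma freeWeight_regraft {v : TreeVertex b R} (hv : v.1 ≠ []) (σ τ : TreeVertex b R → ℤˣ) :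
    freeWeight b R β (regraft v τ σ) * freeWeight b R β (regraft v σ τ)
      = freeWeight b R β σ * freeWeight b R β τ := by
  simp only [freeWeight_eq, ← Real.exp_add, ← Finset.sum_add_distrib, spin_mul_spin,
    regraft_edge hv]
  congr 1
  refine Finset.sum_congr rfl fun x _ => ?_
  split_ifs <;> ring

lemma regraft_involutive {v : TreeVertex b R} (hv : v.1 ≠ []) :
    Function.Involutive (fun q : (TreeVertex b R → ℤˣ) × (TreeVertex b R → ℤˣ) =>
      (regraft v q.2 q.1, regraft v q.1 q.2)) := by
  have hp := par_notMem_desc hv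
  have key : ∀ σ τ : TreeVertex b R → ℤˣ, regraft v (regraft v σ τ) (regraft v τ σ) = σ := by
    intro σ τ
    funext x
    by_cases hx : x ∈ desc v
    · rw [regraft_of_mem hx, regraft_of_mem hx, regraft_of_notMem hp, regraft_of_notMem hp]
      rcases units_cases (σ (par v)) with h1 | h1 <;>
        rcases units_cases (τ (par v)) with h2 | h2 <;> simp [h1, h2]
    · rw [regraft_of_notMem hx, regraft_of_notMem hx]
  rintro ⟨σ, τ⟩
  exact Prod.ext (key σ τ) (key τ σ)

/-- Functions of the edge variables below `v` are independent of everything that is not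
below `v`. -/
lemma mean_mul_of_regraft {v : TreeVertex b R} (hv : v.1 ≠ [])
    {X Y : (TreeVertex b R → ℤˣ) → ℝ} (hX : ∀ σ τ, X (regraft v σ τ) = X σ)
    (hY : IndepOf (desc v) Y) :
    mean (freeWeight b R β) (fun σ => X σ * Y σ)
      = mean (freeWeight b R β) X * mean (freeWeight b R β) Y := by
  set w := freeWeight b R β
  have hZ : 0 < ∑ σ, w σ := sum_weight_pos freeWeight_pos
  have hYr : ∀ σ τ, Y (regraft v σ τ) = Y τ := fun σ τ => hY.piecewise _ τ
  -- Two independent copies exchange their parts below `v`: X of the first times Y of the second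
  -- becomes X Y of the second, at equal total weight.
  have key : (∑ σ, w σ * X σ) * (∑ τ, w τ * Y τ)
      = (∑ σ, w σ) * ∑ τ, w τ * (X τ * Y τ) := by
    rw [Finset.sum_mul_sum, Finset.sum_mul_sum,
      ← Fintype.sum_prod_type' (f := fun σ τ => w σ * X σ * (w τ * Y τ)),
      ← Fintype.sum_prod_type' (f := fun σ τ => w σ * (w τ * (X τ * Y τ))),
      ← Equiv.sum_comp (regraft_involutive hv).toPerm]
    refine Finset.sum_congr rfl fun q _ => ?_
    obtain ⟨σ, τ⟩ := q
    change w (regraft v τ σ) * X (regraft v τ σ) * (w (regraft v σ τ) * Y (regraft v σ τ)) = _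
    rw [hX, hYr]
    have := freeWeight_regraft (β := β) hv σ τ
    linear_combination X τ * Y τ * this
  unfold mean
  rw [div_mul_div_comm, key, mul_div_mul_left _ _ hZ.ne']

/-- Flipping every spin below `v` reverses this edge variable and no other. The value 1 - 2ε is the
one that makes the centred, weighted edge variable odd under this flip. -/
lemma mean_edge {v : TreeVertex b R} (hv : v.1 ≠ []) :
    mean (freeWeight b R β) (fun σ => spin σ v * spin σ (par v)) = 1 - 2 * eps β := by
  set w := freeWeight b R β with hwdef
  set fl : (TreeVertex b R → ℤˣ) → TreeVertex b R → ℤˣ :=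
    fun σ => (desc v).piecewise (fun x => -σ x) σ with hfl
  have hp := par_notMem_desc hv
  have hin : ∀ σ x, x ∈ desc v → fl σ x = -σ x := fun σ x hx => by simp [hfl, hx]
  have hout : ∀ σ x, x ∉ desc v → fl σ x = σ x := fun σ x hx => by simp [hfl, hx]
  have hinv : Function.Involutive fl := by
    intro σ
    funext x
    by_cases hx : x ∈ desc v
    · rw [hin _ _ hx, hin _ _ hx, neg_neg]
    · rw [hout _ _ hx, hout _ _ hx]
  have hedge : ∀ σ, spin (fl σ) v * spin (fl σ) (par v) = -(spin σ v * spin σ (par v)) := by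
    intro σ
    simp only [spin, hin _ _ (self_mem_desc v), hout _ _ hp]
    push_cast
    ring
  have hw : ∀ σ, w (fl σ) = w σ * Real.exp (-(2 * β * (spin σ v * spin σ (par v)))) := by
    intro σ
    rw [hwdef, freeWeight_eq, freeWeight_eq, ← Real.exp_add]
    congr 1
    have : -(2 * β * (spin σ v * spin σ (par v))) = ∑ x, if x = v then
        -(2 * treeCoupling β x * (spin σ x * spin σ (par x))) else 0 := by
      simp [treeCoupling, hv]
    rw [this, ← Finset.sum_add_distrib]
    refine Finset.sum_congr rfl fun x _ => ?_
    by_cases hx : x = v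
    · subst hx
      rw [hedge, if_pos rfl]
      ring
    · rw [if_neg hx, add_zero]
      congr 1
      by_cases hm : x ∈ desc v
      · simp only [spin, hin _ _ hm, hin _ _ ((mem_desc_par hx).1 hm)]
        push_cast
        ring
      · simp only [spin, hout _ _ hm, hout _ (par x) fun h => hm ((mem_desc_par hx).2 h)]
  set θ := 1 - 2 * eps β with hθ
  have hanti : ∀ σ, w (fl σ) * (spin (fl σ) v * spin (fl σ) (par v) - θ)
      = -(w σ * (spin σ v * spin σ (par v) - θ)) := by
    intro σ
    rw [hw, hedge, hθ, eps]
    have he := Real.exp_pos (2 * β)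
    rw [spin_mul_spin]
    rcases units_cases (σ v * σ (par v)) with h | h <;> rw [h]
    · simp only [Units.val_one, Int.cast_one, mul_one, Real.exp_neg]
      field_simp
      ring
    · simp only [Units.val_neg, Units.val_one, Int.cast_neg, Int.cast_one, mul_neg, mul_one,
        neg_neg]
      field_simp
      ring
  have h0 : ∑ σ, w σ * (spin σ v * spin σ (par v) - θ) = 0 := by
    have := Equiv.sum_comp hinv.toPerm fun σ => w σ * (spin σ v * spin σ (par v) - θ)
    have h2 : ∑ σ, w (fl σ) * (spin (fl σ) v * spin (fl σ) (par v) - θ)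
        = ∑ σ, w σ * (spin σ v * spin σ (par v) - θ) := this
    simp only [hanti, Finset.sum_neg_distrib] at h2
    linarith
  have hZ : 0 < ∑ σ, w σ := sum_weight_pos freeWeight_pos
  rw [mean, div_eq_iff hZ.ne', mul_comm θ, Finset.sum_mul]
  simp only [mul_sub, Finset.sum_sub_distrib] at h0
  linarith

lemma disagree_edge {v : TreeVertex b R} (hv : v.1 ≠ []) :
    disagree (freeWeight b R β) (fun σ => σ v) (fun σ => σ (par v)) = eps β := by
  have h1 : ∀ σ : TreeVertex b R → ℤˣ, (if σ v ≠ σ (par v) then (1 : ℝ) else 0)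
      = 1 / 2 + (-1 / 2) * (spin σ v * spin σ (par v)) := by
    intro σ
    rcases units_cases (σ v) with h | h <;> rcases units_cases (σ (par v)) with h' | h' <;>
      norm_num [h, h', spin]
  unfold disagree
  simp only [h1]
  rw [mean_add, mean_const freeWeight_pos, mean_const_mul, mean_edge hv]
  ring

lemma regraft_edge_invariant {v : TreeVertex b R} (hv : v.1 ≠ []) (σ τ : TreeVertex b R → ℤˣ) :
    regraft v σ τ v * regraft v σ τ (par v) = σ v * σ (par v) := by
  rw [regraft_edge hv, if_pos (self_mem_desc v)]

/-- The spin at `v` is its edge variable times the parent spin, and that edge variable is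
independent of everything not below `v`. -/
lemma mean_spin_mul {v : TreeVertex b R} (hv : v.1 ≠ []) {Y : (TreeVertex b R → ℤˣ) → ℝ}
    (hY : IndepOf (desc v) Y) :
    mean (freeWeight b R β) (fun σ => spin σ v * Y σ)
      = (1 - 2 * eps β) * mean (freeWeight b R β) (fun σ => spin σ (par v) * Y σ) := by
  rw [← mean_edge hv, ← mean_mul_of_regraft hv
    (X := fun σ => spin σ v * spin σ (par v)) (Y := fun σ => spin σ (par v) * Y σ)]
  · congr 1
    funext σ
    have := spin_mul_self σ (par v)
    linear_combination -spin σ v * Y σ * this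
  · intro σ τ
    simp only [spin_mul_spin, regraft_edge_invariant hv]
  · refine IndepOf.mul (fun σ τ h => spin_congr (h _ (par_notMem_desc hv))) hY

lemma sum_freeWeight_odd {F : (TreeVertex b R → ℤˣ) → ℝ} (hF : ∀ σ, F (-σ) = -F σ) :
    ∑ σ, freeWeight b R β σ * F σ = 0 := by
  have hw : ∀ σ, freeWeight b R β (-σ) = freeWeight b R β σ := by
    intro σ
    simp [freeWeight_eq, spin]
  have h := Equiv.sum_comp (Equiv.neg (TreeVertex b R → ℤˣ)) fun σ => freeWeight b R β σ * F σ
  simp only [Equiv.neg_apply, hw, hF, mul_neg, Finset.sum_neg_distrib] at h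
  linarith

lemma energy_univ_of_odd {F : (TreeVertex b R → ℤˣ) → ℝ} (hF : ∀ σ, F (-σ) = -F σ) :
    energy (freeWeight b R β) Finset.univ F
      = (∑ σ, freeWeight b R β σ) * mean (freeWeight b R β) fun σ => F σ ^ 2 := by
  rw [← sum_weight_mul freeWeight_pos]
  unfold energy
  simp only [condAvg_univ_eq_zero (sum_freeWeight_odd hF), sub_zero]

end ZeroField

/-! ### Second moment of the sum of the leaf spins. -/

section LeafSum

variable {b R : ℕ} {β : ℝ}

/-- The vertices at distance `k` from the root. -/
def level (b R k : ℕ) : Finset (TreeVertex b R) := Finset.univ.filter fun v => v.1.length = k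

lemma mem_level {k : ℕ} {v : TreeVertex b R} : v ∈ level b R k ↔ v.1.length = k := by
  simp [level]

lemma sum_level_succ {k : ℕ} (hk : k < R) (φ : TreeVertex b R → ℝ) :
    ∑ v ∈ level b R (k + 1), φ (par v) = b * ∑ u ∈ level b R k, φ u := by
  have hmaps : ∀ v ∈ level b R (k + 1), par v ∈ level b R k := by
    intro v hv
    rw [mem_level] at hv ⊢
    simp [par, hv]
  rw [← Finset.sum_fiberwise_of_maps_to hmaps, Finset.mul_sum]
  refine Finset.sum_congr rfl fun u hu => ?_
  rw [mem_level] at hu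
  have h1 : ∑ v ∈ level b R (k + 1) with par v = u, φ (par v)
      = ∑ v ∈ level b R (k + 1) with par v = u, φ u :=
    Finset.sum_congr rfl fun v hv => by rw [(Finset.mem_filter.1 hv).2]
  have hcard : ((level b R (k + 1)).filter fun v => par v = u).card = b := by
    have hl : ∀ a : Fin b, (a :: u.1).length ≤ R := fun a => by
      rw [List.length_cons]
      omega
    have : (level b R (k + 1)).filter (fun v => par v = u)
        = Finset.univ.image fun a : Fin b => (⟨a :: u.1, hl a⟩ : TreeVertex b R) := by
      ext v
      rw [Finset.mem_filter, mem_level, Finset.mem_image]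
      constructor
      · rintro ⟨hv, hp⟩
        obtain ⟨a, l, hal⟩ := List.exists_cons_of_ne_nil
          (fun h0 => by simp [h0] at hv : v.1 ≠ [])
        refine ⟨a, Finset.mem_univ _, ?_⟩
        ext1
        have hu' : u.1 = l := by rw [← hp]; simp [par, hal]
        change a :: u.1 = v.1
        rw [hal, hu']
      · rintro ⟨a, -, rfl⟩
        refine ⟨by simp [hu], ?_⟩
        ext1
        simp [par]
    rw [this, Finset.card_image_of_injective, Finset.card_univ, Fintype.card_fin]
    intro a a' h
    simpa using congrArg Subtype.val h
  rw [h1, Finset.sum_const, hcard, nsmul_eq_mul]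

lemma card_level {k : ℕ} (hk : k ≤ R) : ((level b R k).card : ℝ) = (b : ℝ) ^ k := by
  induction k with
  | zero =>
    have : level b R 0 = {root b R} := by
      ext v
      rw [mem_level, Finset.mem_singleton, List.length_eq_zero_iff]
      exact ⟨fun h => Subtype.ext h, fun h => by rw [h]; rfl⟩
    rw [this]
    simp
  | succ k ih =>
    have := sum_level_succ (b := b) (R := R) (k := k) (by omega) fun _ => 1
    simp only [Finset.sum_const, nsmul_eq_mul, mul_one] at this
    rw [this, ih (by omega), pow_succ]
    ring

lemma notMem_desc_of_length {u v : TreeVertex b R} (h : u ≠ v)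
    (hl : u.1.length ≤ v.1.length) : u ∉ desc v := by
  rw [mem_desc]
  intro hs
  exact h (Subtype.ext (hs.eq_of_length (le_antisymm hs.length_le hl))).symm

/-- The second moment of the sum of the spins at level `k`. -/
def levelMoment (b R : ℕ) (β : ℝ) (k : ℕ) : ℝ :=
  mean (freeWeight b R β) fun σ => (∑ v ∈ level b R k, spin σ v) ^ 2

lemma levelMoment_eq (k : ℕ) : levelMoment b R β k = ∑ u ∈ level b R k, ∑ v ∈ level b R k,
    mean (freeWeight b R β) fun σ => spin σ u * spin σ v := by
  unfold levelMoment
  simp only [pow_two, Finset.sum_mul_sum]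
  rw [mean_sum]
  exact Finset.sum_congr rfl fun u _ => mean_sum _ _

lemma mean_spin_sq (v : TreeVertex b R) :
    mean (freeWeight b R β) (fun σ => spin σ v * spin σ v) = 1 := by
  simp only [spin_mul_self]
  exact mean_const freeWeight_pos 1

lemma levelMoment_zero : levelMoment b R β 0 = 1 := by
  have : level b R 0 = {root b R} := by
    ext v
    rw [mem_level, Finset.mem_singleton, List.length_eq_zero_iff]
    exact ⟨fun h => Subtype.ext h, fun h => by rw [h]; rfl⟩
  rw [levelMoment_eq, this, Finset.sum_singleton, Finset.sum_singleton, mean_spin_sq]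

/-- Moving both spins of a pair to their parents costs θ². The diagonal pairs have second moment 1
instead of θ², which accounts for the last term. -/
lemma levelMoment_succ {k : ℕ} (hk : k < R) :
    levelMoment b R β (k + 1) = (b * (1 - 2 * eps β)) ^ 2 * levelMoment b R β k
      + (1 - (1 - 2 * eps β) ^ 2) * (b : ℝ) ^ (k + 1) := by
  set θ := 1 - 2 * eps β with hθ
  set w := freeWeight b R β
  have hcorr : ∀ u ∈ level b R (k + 1), ∀ v ∈ level b R (k + 1),
      mean w (fun σ => spin σ u * spin σ v)
        = θ ^ 2 * mean w (fun σ => spin σ (par u) * spin σ (par v))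
          + if u = v then 1 - θ ^ 2 else 0 := by
    intro u hu v hv
    rw [mem_level] at hu hv
    have hune : u.1 ≠ [] := fun h0 => by simp [h0] at hu
    have hvne : v.1 ≠ [] := fun h0 => by simp [h0] at hv
    by_cases huv : u = v
    · subst huv
      rw [mean_spin_sq, mean_spin_sq, if_pos rfl]
      ring
    · rw [if_neg huv, add_zero, mean_spin_mul hune (Y := fun σ => spin σ v)]
      · have h1 : (fun σ : TreeVertex b R → ℤˣ => spin σ (par u) * spin σ v)
            = fun σ => spin σ v * spin σ (par u) := by
          funext σ
          ring
        rw [h1, mean_spin_mul hvne (Y := fun σ => spin σ (par u))]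
        · simp only [mul_comm (spin _ (par v))]
          rw [← hθ]
          ring
        · refine fun σ τ h => spin_congr (h _ fun hd => ?_)
          have h2 := length_le_of_mem_desc hd
          have h3 := length_par hune
          omega
      · exact fun σ τ h => spin_congr (h _ (notMem_desc_of_length (Ne.symm huv) (by omega)))
  rw [levelMoment_eq, levelMoment_eq, Finset.sum_congr rfl fun u hu =>
    Finset.sum_congr rfl fun v hv => hcorr u hu v hv]
  simp only [Finset.sum_add_distrib, ← Finset.mul_sum]
  have h1 : ∀ x : TreeVertex b R, ∑ v ∈ level b R (k + 1),
      mean w (fun σ => spin σ x * spin σ (par v))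
      = b * ∑ v ∈ level b R k, mean w (fun σ => spin σ x * spin σ v) := fun x =>
    sum_level_succ hk fun v => mean w (fun σ => spin σ x * spin σ v)
  have h2 : ∑ u ∈ level b R (k + 1), ∑ v ∈ level b R (k + 1),
      mean w (fun σ => spin σ (par u) * spin σ (par v))
      = b * (b * ∑ u ∈ level b R k, ∑ v ∈ level b R k, mean w (fun σ => spin σ u * spin σ v)) := by
    simp only [h1, ← Finset.mul_sum]
    rw [sum_level_succ hk fun u => ∑ v ∈ level b R k, mean w (fun σ => spin σ u * spin σ v)]
  have h3 : ∑ u ∈ level b R (k + 1), ∑ v ∈ level b R (k + 1), (if u = v then 1 - θ ^ 2 else 0)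
      = (1 - θ ^ 2) * (b : ℝ) ^ (k + 1) := by
    rw [← card_level (b := b) (R := R) (show k + 1 ≤ R by omega), mul_comm, ← nsmul_eq_mul,
      ← Finset.sum_const]
    refine Finset.sum_congr rfl fun u hu => ?_
    rw [Finset.sum_ite_eq, if_pos hu]
  rw [h2, h3]
  ring

/-- The sum of the spins at the leaves as a test function. -/
lemma levelMoment_le_treeRelaxationTime (b R : ℕ) (β : ℝ) :
    levelMoment b R β R ≤ treeRelaxationTime b R β * (b : ℝ) ^ R := by
  obtain ⟨hτ, hP⟩ := treeRelaxationTime_spec b R β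
  set w := freeWeight b R β with hwdef
  have hw : ∀ σ, 0 < w σ := freeWeight_pos
  set F : (TreeVertex b R → ℤˣ) → ℝ := fun σ => ∑ v ∈ level b R R, spin σ v with hF
  have hZ := sum_weight_pos hw
  have h1 : energy w Finset.univ F = (∑ σ, w σ) * levelMoment b R β R :=
    energy_univ_of_odd fun σ => by simp [hF, spin]
  have h2 : ∑ v, energy w {v} F ≤ (∑ σ, w σ) * (b : ℝ) ^ R := by
    rw [← card_level (b := b) (R := R) le_rfl, mul_comm, ← nsmul_eq_mul, ← Finset.sum_const,
      ← Finset.sum_subset (Finset.subset_univ (level b R R))]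
    · refine Finset.sum_le_sum fun v hv => ?_
      -- Omitting the spin at `v` from the sum gives a guess with error of modulus 1.
      have hind : IndepOf {v} fun σ => ∑ u ∈ (level b R R).erase v, spin σ u := by
        intro σ τ h
        refine Finset.sum_congr rfl fun u hu => spin_congr (h u ?_)
        simpa using Finset.ne_of_mem_erase hu
      refine (energy_le hw hind F).trans (le_of_eq ?_)
      refine Finset.sum_congr rfl fun σ _ => ?_
      have : F σ - ∑ u ∈ (level b R R).erase v, spin σ u = spin σ v := by
        rw [hF, sub_eq_iff_eq_add, Finset.add_sum_erase _ _ hv]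
      rw [this, pow_two, spin_mul_self, mul_one]
    · intro v _ hv
      refine energy_eq_zero_of_indepOf hw fun σ τ h => ?_
      refine Finset.sum_congr rfl fun u hu => spin_congr (h u ?_)
      rw [Finset.mem_singleton]
      rintro rfl
      exact hv hu
  have h3 := (hP F).trans (mul_le_mul_of_nonneg_left h2 hτ.le)
  change energy w Finset.univ F ≤ _ at h3
  rw [h1, mul_left_comm] at h3
  exact le_of_mul_le_mul_left h3 hZ

lemma levelMoment_lower (hb : 0 < b) (h0 : 0 ≤ eps β) (h1 : eps β ≤ 1) {k : ℕ} (hk : k ≤ R) :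
    (b * (1 - 2 * eps β) ^ 2) ^ k * (b : ℝ) ^ k ≤ levelMoment b R β k := by
  induction k with
  | zero => simp [levelMoment_zero]
  | succ k ih =>
    rw [levelMoment_succ (by omega)]
    have h2 : 0 ≤ (1 - (1 - 2 * eps β) ^ 2) * (b : ℝ) ^ (k + 1) := by
      have : 0 ≤ 1 - (1 - 2 * eps β) ^ 2 := by nlinarith
      positivity
    have h3 := mul_le_mul_of_nonneg_left (ih (by omega)) (sq_nonneg ((b : ℝ) * (1 - 2 * eps β)))
    calc _ = ((b : ℝ) * (1 - 2 * eps β)) ^ 2 * ((b * (1 - 2 * eps β) ^ 2) ^ k * (b : ℝ) ^ k) := by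
          ring
      _ ≤ _ := by linarith

/-- Here (bθ)² = b, so both terms of the recursion grow like b^k and the diagonal contributions
accumulate linearly. -/
lemma levelMoment_critical (h1 : (b : ℝ) * (1 - 2 * eps β) ^ 2 = 1) {k : ℕ} (hk : k ≤ R) :
    levelMoment b R β k = (1 + k * (1 - (1 - 2 * eps β) ^ 2)) * (b : ℝ) ^ k := by
  induction k with
  | zero => simp [levelMoment_zero]
  | succ k ih =>
    rw [levelMoment_succ (by omega), ih (by omega)]
    push_cast
    rw [pow_succ]
    linear_combination (b : ℝ) ^ k * b * (1 + k * (1 - (1 - 2 * eps β) ^ 2)) * h1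

end LeafSum

/-! ### Recursive majority as a test function at low temperature. -/

section Majority

variable {b R : ℕ} {β : ℝ}

/-- The vertex with a given word. -/
def vtx (b R : ℕ) (l : List (Fin b)) : TreeVertex b R :=
  if h : l.length ≤ R then ⟨l, h⟩ else root b R

lemma val_vtx {l : List (Fin b)} (h : l.length ≤ R) : (vtx b R l).1 = l := by
  simp [vtx, h]

/-- The majority of three spins. -/
def maj (x y z : ℤˣ) : ℤˣ := if y = z then y else x

lemma maj_mul (c x y z : ℤˣ) : maj (c * x) (c * y) (c * z) = c * maj x y z := by
  unfold maj
  simp only [mul_right_inj]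
  split_ifs <;> rfl

/-- Recursive majority with `m` rounds, estimating the spin at the vertex `l` from the spins
`2 * m + t` levels below it. -/
def recMaj (R : ℕ) (a₀ a₁ : Fin b) (t : ℕ) : ℕ → List (Fin b) → (TreeVertex b R → ℤˣ) → ℤˣ
  | 0, l, σ => σ (vtx b R (List.replicate t a₀ ++ l))
  | m + 1, l, σ => maj (recMaj R a₀ a₁ t m (a₀ :: a₀ :: l) σ)
      (recMaj R a₀ a₁ t m (a₁ :: a₀ :: l) σ) (recMaj R a₀ a₁ t m (a₀ :: a₁ :: l) σ)

variable {a₀ a₁ : Fin b} {t : ℕ}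

/-- Equivariance under a global sign on the leaves concerned. The sign 1 gives locality
(`recMaj_congr`), -1 gives oddness, and the sign produced by `regraft` gives the independence
statements. -/
lemma recMaj_smul (m : ℕ) (l : List (Fin b)) (hl : l.length + 2 * m + t ≤ R) (c : ℤˣ)
    {σ τ : TreeVertex b R → ℤˣ} (h : ∀ x : TreeVertex b R, l <:+ x.1 →
      x.1.length = l.length + 2 * m + t → τ x = c * σ x) :
    recMaj R a₀ a₁ t m l τ = c * recMaj R a₀ a₁ t m l σ := by
  induction m generalizing l with
  | zero =>
    have hlen : (List.replicate t a₀ ++ l).length = l.length + 2 * 0 + t := by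
      rw [List.length_append, List.length_replicate]
      omega
    have hv := val_vtx (hlen.trans_le hl)
    exact h _ (by rw [hv]; exact List.suffix_append _ _) (by rw [hv, hlen])
  | succ m ih =>
    have key : ∀ a a' : Fin b, recMaj R a₀ a₁ t m (a :: a' :: l) τ
        = c * recMaj R a₀ a₁ t m (a :: a' :: l) σ := by
      intro a a'
      refine ih _ (by simp only [List.length_cons]; omega) fun x hx hxl => h x ?_ ?_
      · exact (List.suffix_append [a, a'] l).trans hx
      · rw [hxl]
        simp only [List.length_cons]
        omega
    simp only [recMaj, key, maj_mul]

lemma recMaj_congr (m : ℕ) (l : List (Fin b)) (hl : l.length + 2 * m + t ≤ R)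
    {σ τ : TreeVertex b R → ℤˣ} (h : ∀ x : TreeVertex b R, l <:+ x.1 →
      x.1.length = l.length + 2 * m + t → τ x = σ x) :
    recMaj R a₀ a₁ t m l τ = recMaj R a₀ a₁ t m l σ := by
  have := recMaj_smul (a₀ := a₀) (a₁ := a₁) m l hl 1 (σ := σ) (τ := τ)
    fun x h1 h2 => by rw [one_mul, h x h1 h2]
  rwa [one_mul] at this

/-- The configuration with the spin at `v` flipped. -/
def flipAt (v : TreeVertex b R) (σ : TreeVertex b R → ℤˣ) : TreeVertex b R → ℤˣ :=
  Function.update σ v (-σ v)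

/-- Indicator of the event that `v` is pivotal for `f`. -/
def pivotal (f : (TreeVertex b R → ℤˣ) → ℤˣ) (v : TreeVertex b R) (σ : TreeVertex b R → ℤˣ) : ℝ :=
  if f (flipAt v σ) ≠ f σ then 1 else 0

lemma pivotal_nonneg (f : (TreeVertex b R → ℤˣ) → ℤˣ) (v : TreeVertex b R)
    (σ : TreeVertex b R → ℤˣ) : 0 ≤ pivotal f v σ := by
  unfold pivotal
  split_ifs <;> norm_num

lemma pivotal_recMaj_of_ne (m : ℕ) (l : List (Fin b)) (hl : l.length + 2 * m + t ≤ R)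
    (v : TreeVertex b R) (hv : ¬ (l <:+ v.1 ∧ v.1.length = l.length + 2 * m + t))
    (σ : TreeVertex b R → ℤˣ) :
    recMaj R a₀ a₁ t m l (flipAt v σ) = recMaj R a₀ a₁ t m l σ := by
  refine recMaj_congr m l hl fun x h1 h2 => Function.update_of_ne ?_ _ _
  rintro rfl
  exact hv ⟨h1, h2⟩

lemma pivotal_regraft (m : ℕ) (u v : TreeVertex b R) (hl : u.1.length + 2 * m + t ≤ R)
    (hv : v ∈ desc u) (σ τ : TreeVertex b R → ℤˣ) :
    pivotal (recMaj R a₀ a₁ t m u.1) v (regraft u σ τ)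
      = pivotal (recMaj R a₀ a₁ t m u.1) v σ := by
  unfold pivotal
  have h1 : recMaj R a₀ a₁ t m u.1 (regraft u σ τ)
      = σ (par u) * τ (par u) * recMaj R a₀ a₁ t m u.1 σ :=
    recMaj_smul m _ hl _ fun x hx _ => regraft_of_mem (mem_desc.2 hx) σ τ
  have h2 : recMaj R a₀ a₁ t m u.1 (flipAt v (regraft u σ τ))
      = σ (par u) * τ (par u) * recMaj R a₀ a₁ t m u.1 (flipAt v σ) := by
    refine recMaj_smul m _ hl _ fun x hx _ => ?_
    unfold flipAt
    by_cases hxv : x = v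
    · subst hxv
      rw [Function.update_self, Function.update_self, regraft_of_mem hv, mul_neg]
    · rw [Function.update_of_ne hxv, Function.update_of_ne hxv, regraft_of_mem (mem_desc.2 hx)]
  rw [h1, h2]
  simp only [ne_eq, mul_right_inj]

/-- Estimate and true spin acquire the same sign under regrafting, so the error event depends only
on edge variables below `u`. -/
lemma error_regraft (m : ℕ) (u : TreeVertex b R) (hl : u.1.length + 2 * m + t ≤ R)
    (σ τ : TreeVertex b R → ℤˣ) :
    (recMaj R a₀ a₁ t m u.1 (regraft u σ τ) ≠ regraft u σ τ u)
      ↔ (recMaj R a₀ a₁ t m u.1 σ ≠ σ u) := by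
  rw [recMaj_smul m _ hl _ fun x hx _ => regraft_of_mem (mem_desc.2 hx) σ τ,
    regraft_of_mem (self_mem_desc u), ne_eq, mul_right_inj]

/-- Probability that recursive majority fails to recover the spin at `l`. -/
def errorProb (R : ℕ) (β : ℝ) (a₀ a₁ : Fin b) (t m : ℕ) (l : List (Fin b)) : ℝ :=
  disagree (freeWeight b R β) (recMaj R a₀ a₁ t m l) fun σ => σ (vtx b R l)

lemma disagree_child {l : List (Fin b)} (a : Fin b) (hl : l.length + 1 ≤ R) :
    disagree (freeWeight b R β) (fun σ => σ (vtx b R (a :: l))) (fun σ => σ (vtx b R l))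
      = eps β := by
  have hv : (vtx b R (a :: l)).1 = a :: l := val_vtx (by simpa using hl)
  have hp : par (vtx b R (a :: l)) = vtx b R l := by
    ext1
    rw [val_vtx (by omega)]
    simp [par, hv]
  rw [← hp]
  exact disagree_edge (by rw [hv]; exact List.cons_ne_nil _ _)

lemma disagree_grandchild {l : List (Fin b)} (a a' : Fin b) (hl : l.length + 2 ≤ R) :
    disagree (freeWeight b R β) (fun σ => σ (vtx b R (a :: a' :: l))) (fun σ => σ (vtx b R l))
      ≤ 2 * eps β := by
  refine (disagree_triangle freeWeight_pos _ (fun σ => σ (vtx b R (a' :: l))) _).trans ?_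
  rw [disagree_child a (by simp only [List.length_cons]; omega), disagree_child a' (by omega)]
  linarith

lemma disjoint_desc_vtx {l l' : List (Fin b)} (h : l ≠ l') (hlen : l.length = l'.length)
    (hR : l.length ≤ R) : Disjoint (desc (vtx b R l)) (desc (vtx b R l')) := by
  rw [Finset.disjoint_left]
  intro x hx hx'
  rw [mem_desc, val_vtx hR] at hx
  rw [mem_desc, val_vtx (hlen ▸ hR)] at hx'
  exact h ((List.suffix_of_suffix_length_le hx hx' hlen.le).eq_of_length hlen)

lemma recMaj_eq_of_agree (m : ℕ) (l l' : List (Fin b)) (h : l ≠ l') (hlen : l.length = l'.length)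
    (hl : l.length + 2 * m + t ≤ R) {σ τ : TreeVertex b R → ℤˣ}
    (hστ : ∀ v, v ∉ desc (vtx b R l) → σ v = τ v) :
    recMaj R a₀ a₁ t m l' σ = recMaj R a₀ a₁ t m l' τ := by
  refine recMaj_congr m l' (hlen ▸ hl) fun x hx _ => hστ x fun hd => ?_
  refine Finset.disjoint_left.1 (disjoint_desc_vtx h hlen (by omega)) hd ?_
  rw [mem_desc, val_vtx (by omega)]
  exact hx

/-- Errors in disjoint subtrees are independent. -/
lemma mean_error_mul (m : ℕ) {l l' : List (Fin b)} (h : l ≠ l') (hlen : l.length = l'.length)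
    (hl : l.length + 2 * m + t ≤ R) (hne : l ≠ []) :
    mean (freeWeight b R β) (fun σ =>
      (if recMaj R a₀ a₁ t m l σ ≠ σ (vtx b R l) then 1 else 0)
        * (if recMaj R a₀ a₁ t m l' σ ≠ σ (vtx b R l') then 1 else 0))
      = errorProb R β a₀ a₁ t m l * errorProb R β a₀ a₁ t m l' := by
  have hv : (vtx b R l).1 = l := val_vtx (by omega)
  have hv' : (vtx b R l').1 = l' := val_vtx (by omega)
  refine mean_mul_of_regraft (v := vtx b R l) (by rwa [hv]) (fun σ τ => ?_) fun σ τ hστ => ?_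
  · have := error_regraft (a₀ := a₀) (a₁ := a₁) (t := t) m (vtx b R l) (by rwa [hv]) σ τ
    rw [hv] at this
    simp only [this]
  · have hd : vtx b R l' ∉ desc (vtx b R l) := fun hd =>
      Finset.disjoint_left.1 (disjoint_desc_vtx h hlen (by omega)) hd (self_mem_desc _)
    simp only [recMaj_eq_of_agree m l l' h hlen hl hστ, hστ _ hd]

/-- A wrong majority requires that some intermediate spin `p`, `q`, `r` differ from `s`, or that at
least two of the three estimates be wrong. -/
lemma maj_error_le (x y z s p q r : ℤˣ) :
    (if maj x y z ≠ s then (1 : ℝ) else 0)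
      ≤ (((if p ≠ s then 1 else 0) + (if q ≠ s then 1 else 0)) + (if r ≠ s then 1 else 0))
        + ((((if x ≠ p then 1 else 0) * (if y ≠ q then 1 else 0))
          + ((if x ≠ p then 1 else 0) * (if z ≠ r then 1 else 0)))
          + ((if y ≠ q then 1 else 0) * (if z ≠ r then 1 else 0))) := by
  have hnn : ∀ P : Prop, [Decidable P] → (0 : ℝ) ≤ if P then 1 else 0 := fun P _ => by
    split_ifs <;> norm_num
  by_cases hp : p = s
  · by_cases hq : q = s
    · by_cases hr : r = s
      · subst hp hq hr
        simp only [ne_eq, not_true_eq_false, if_false, add_zero, zero_add]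
        unfold maj
        rcases units_cases x with rfl | rfl <;> rcases units_cases y with rfl | rfl <;>
          rcases units_cases z with rfl | rfl <;> rcases units_cases r with rfl | rfl <;>
          norm_num [show (1 : ℤˣ) ≠ -1 by decide, show (-1 : ℤˣ) ≠ 1 by decide]
      · rw [if_pos hr]
        have h1 : (if maj x y z ≠ s then (1 : ℝ) else 0) ≤ 1 := by split_ifs <;> norm_num
        have := hnn (p ≠ s)
        have := hnn (q ≠ s)
        have := mul_nonneg (hnn (x ≠ p)) (hnn (y ≠ q))
        have := mul_nonneg (hnn (x ≠ p)) (hnn (z ≠ r))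
        have := mul_nonneg (hnn (y ≠ q)) (hnn (z ≠ r))
        linarith
    · rw [if_pos hq]
      have h1 : (if maj x y z ≠ s then (1 : ℝ) else 0) ≤ 1 := by split_ifs <;> norm_num
      have := hnn (p ≠ s)
      have := hnn (r ≠ s)
      have := mul_nonneg (hnn (x ≠ p)) (hnn (y ≠ q))
      have := mul_nonneg (hnn (x ≠ p)) (hnn (z ≠ r))
      have := mul_nonneg (hnn (y ≠ q)) (hnn (z ≠ r))
      linarith
  · rw [if_pos hp]
    have h1 : (if maj x y z ≠ s then (1 : ℝ) else 0) ≤ 1 := by split_ifs <;> norm_num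
    have := hnn (q ≠ s)
    have := hnn (r ≠ s)
    have := mul_nonneg (hnn (x ≠ p)) (hnn (y ≠ q))
    have := mul_nonneg (hnn (x ≠ p)) (hnn (z ≠ r))
    have := mul_nonneg (hnn (y ≠ q)) (hnn (z ≠ r))
    linarith

lemma errorProb_nonneg (m : ℕ) (l : List (Fin b)) : 0 ≤ errorProb R β a₀ a₁ t m l :=
  disagree_nonneg freeWeight_pos _ _

/-- Each grandchild differs from the vertex with probability at most 2ε, and errors in distinct
subtrees are independent. The bound 10ε reproduces itself because 6ε + 3 (10ε)² ≤ 10ε exactly when ε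
≤ 1/75. -/
lemma errorProb_le (ha : a₀ ≠ a₁) (h0 : 0 ≤ eps β) (hε : eps β ≤ 1 / 75) (ht1 : 1 ≤ t)
    (ht2 : t ≤ 2) (m : ℕ) (l : List (Fin b)) (hl : l.length + 2 * m + t ≤ R) :
    errorProb R β a₀ a₁ t m l ≤ 10 * eps β := by
  induction m generalizing l with
  | zero =>
    interval_cases t
    · have h1 := disagree_child (β := β) (R := R) (l := l) a₀ (by omega)
      change disagree _ (fun σ => σ (vtx b R (a₀ :: l))) _ ≤ _
      rw [h1]
      linarith
    · have h1 := disagree_grandchild (β := β) (R := R) (l := l) a₀ a₀ (by omega)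
      change disagree _ (fun σ => σ (vtx b R (a₀ :: a₀ :: l))) _ ≤ _
      linarith
  | succ m ih =>
    have hlen : ∀ a a' : Fin b, (a :: a' :: l).length + 2 * m + t ≤ R := fun a a' => by
      simp only [List.length_cons]
      omega
    set l₁ := a₀ :: a₀ :: l with hl₁
    set l₂ := a₁ :: a₀ :: l with hl₂
    set l₃ := a₀ :: a₁ :: l with hl₃
    have h12 : l₁ ≠ l₂ := fun h => ha (List.cons.inj h).1
    have h13 : l₁ ≠ l₃ := fun h => ha (List.cons.inj (List.cons.inj h).2).1
    have h23 : l₂ ≠ l₃ := fun h => ha (List.cons.inj h).1.symm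
    have hmono : errorProb R β a₀ a₁ t (m + 1) l ≤ mean (freeWeight b R β) _ :=
      mean_mono freeWeight_pos fun σ => maj_error_le (recMaj R a₀ a₁ t m l₁ σ)
        (recMaj R a₀ a₁ t m l₂ σ) (recMaj R a₀ a₁ t m l₃ σ) (σ (vtx b R l)) (σ (vtx b R l₁))
        (σ (vtx b R l₂)) (σ (vtx b R l₃))
    rw [mean_add, mean_add, mean_add, mean_add, mean_add,
      mean_error_mul m h12 rfl (hlen _ _) (List.cons_ne_nil _ _),
      mean_error_mul m h13 rfl (hlen _ _) (List.cons_ne_nil _ _),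
      mean_error_mul m h23 rfl (hlen _ _) (List.cons_ne_nil _ _)] at hmono
    have d1 : mean (freeWeight b R β) (fun σ => if σ (vtx b R l₁) ≠ σ (vtx b R l) then 1 else 0)
        ≤ 2 * eps β := disagree_grandchild a₀ a₀ (by omega)
    have d2 : mean (freeWeight b R β) (fun σ => if σ (vtx b R l₂) ≠ σ (vtx b R l) then 1 else 0)
        ≤ 2 * eps β := disagree_grandchild a₁ a₀ (by omega)
    have d3 : mean (freeWeight b R β) (fun σ => if σ (vtx b R l₃) ≠ σ (vtx b R l) then 1 else 0)
        ≤ 2 * eps β := disagree_grandchild a₀ a₁ (by omega)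
    have e1 := ih l₁ (hlen _ _)
    have e2 := ih l₂ (hlen _ _)
    have e3 := ih l₃ (hlen _ _)
    have q1 : 0 ≤ errorProb R β a₀ a₁ t m l₁ := errorProb_nonneg m l₁
    have q2 : 0 ≤ errorProb R β a₀ a₁ t m l₂ := errorProb_nonneg m l₂
    have q3 : 0 ≤ errorProb R β a₀ a₁ t m l₃ := errorProb_nonneg m l₃
    have p12 := mul_le_mul e1 e2 q2 (by positivity)
    have p13 := mul_le_mul e1 e3 q3 (by positivity)
    have p23 := mul_le_mul e2 e3 q3 (by positivity)
    nlinarith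

/-- Path from one estimate to the other through the two grandchildren and `l`: 10ε + 2ε + 2ε + 10ε.
-/
lemma disagree_recMaj_le (ha : a₀ ≠ a₁) (h0 : 0 ≤ eps β) (hε : eps β ≤ 1 / 75) (ht1 : 1 ≤ t)
    (ht2 : t ≤ 2) (m : ℕ) (l : List (Fin b)) (hl : l.length + 2 * (m + 1) + t ≤ R)
    (c c' d d' : Fin b) :
    disagree (freeWeight b R β) (recMaj R a₀ a₁ t m (c :: c' :: l))
      (recMaj R a₀ a₁ t m (d :: d' :: l)) ≤ 24 * eps β := by
  have hw : ∀ σ : TreeVertex b R → ℤˣ, 0 < freeWeight b R β σ := freeWeight_pos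
  have hlen : ∀ a a' : Fin b, (a :: a' :: l).length + 2 * m + t ≤ R := fun a a' => by
    simp only [List.length_cons]
    omega
  have h1 := errorProb_le (β := β) (R := R) ha h0 hε ht1 ht2 m (c :: c' :: l) (hlen _ _)
  have h2 := errorProb_le (β := β) (R := R) ha h0 hε ht1 ht2 m (d :: d' :: l) (hlen _ _)
  have h3 := disagree_grandchild (β := β) (R := R) (l := l) c c' (by omega)
  have h4 := disagree_grandchild (β := β) (R := R) (l := l) d d' (by omega)
  unfold errorProb at h1 h2
  rw [disagree_comm] at h2 h4
  refine (disagree_triangle hw _ (fun σ => σ (vtx b R (c :: c' :: l))) _).trans ?_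
  have h5 := disagree_triangle hw (fun σ => σ (vtx b R (c :: c' :: l)))
    (fun σ => σ (vtx b R (d :: d' :: l))) (recMaj R a₀ a₁ t m (d :: d' :: l))
  have h6 := disagree_triangle hw (fun σ => σ (vtx b R (c :: c' :: l)))
    (fun σ => σ (vtx b R l)) (fun σ => σ (vtx b R (d :: d' :: l)))
  linarith

/-- Expected number of pivotal vertices. -/
def pivotalSum (R : ℕ) (β : ℝ) (a₀ a₁ : Fin b) (t m : ℕ) (l : List (Fin b)) : ℝ :=
  ∑ v, mean (freeWeight b R β) (pivotal (recMaj R a₀ a₁ t m l) v)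

/-- Contribution of one of the three subtrees to the pivotal vertices. -/
lemma sum_desc_pivotal_le (m : ℕ) {l l₁ l₂ l₃ : List (Fin b)} (h12 : l₁ ≠ l₂) (h13 : l₁ ≠ l₃)
    (hlen2 : l₁.length = l₂.length) (hlen3 : l₁.length = l₃.length)
    (hl : l₁.length + 2 * m + t ≤ R) (hne : l₁ ≠ [])
    (hmaj : ∀ σ, recMaj R a₀ a₁ t (m + 1) l σ = if recMaj R a₀ a₁ t m l₂ σ
      = recMaj R a₀ a₁ t m l₃ σ then recMaj R a₀ a₁ t m l₂ σ else recMaj R a₀ a₁ t m l₁ σ) :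
    ∑ v ∈ desc (vtx b R l₁), mean (freeWeight b R β) (pivotal (recMaj R a₀ a₁ t (m + 1) l) v)
      ≤ disagree (freeWeight b R β) (recMaj R a₀ a₁ t m l₂) (recMaj R a₀ a₁ t m l₃)
        * pivotalSum R β a₀ a₁ t m l₁ := by
  have hw : ∀ σ : TreeVertex b R → ℤˣ, 0 < freeWeight b R β σ := freeWeight_pos
  have hv1 : (vtx b R l₁).1 = l₁ := val_vtx (by omega)
  have hstep : ∀ v ∈ desc (vtx b R l₁),
      mean (freeWeight b R β) (pivotal (recMaj R a₀ a₁ t (m + 1) l) v)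
      ≤ disagree (freeWeight b R β) (recMaj R a₀ a₁ t m l₂) (recMaj R a₀ a₁ t m l₃)
        * mean (freeWeight b R β) (pivotal (recMaj R a₀ a₁ t m l₁) v) := by
    intro v hv
    -- A leaf is pivotal for the majority only if it is pivotal in its own subtree and the other two
    -- estimates disagree; these events are independent.
    rw [mul_comm, disagree, ← mean_mul_of_regraft (v := vtx b R l₁) (by rwa [hv1])]
    · refine mean_mono hw fun σ => ?_
      have hfl : ∀ x, x ∉ desc (vtx b R l₁) → flipAt v σ x = σ x := fun x hx =>
        Function.update_of_ne (fun h => hx (by rw [h]; exact hv)) _ _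
      have e2 : recMaj R a₀ a₁ t m l₂ (flipAt v σ) = recMaj R a₀ a₁ t m l₂ σ :=
        recMaj_eq_of_agree m l₁ l₂ h12 hlen2 hl hfl
      have e3 : recMaj R a₀ a₁ t m l₃ (flipAt v σ) = recMaj R a₀ a₁ t m l₃ σ :=
        recMaj_eq_of_agree m l₁ l₃ h13 hlen3 hl hfl
      unfold pivotal
      rw [hmaj, hmaj, e2, e3]
      by_cases h : recMaj R a₀ a₁ t m l₂ σ = recMaj R a₀ a₁ t m l₃ σ
      · simp [h]
      · simp [h]
    · intro σ τ
      have := pivotal_regraft (a₀ := a₀) (a₁ := a₁) (t := t) m (vtx b R l₁) v (by rwa [hv1]) hv σ τ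
      rwa [hv1] at this
    · intro σ τ hστ
      simp only [recMaj_eq_of_agree m l₁ l₂ h12 hlen2 hl hστ,
        recMaj_eq_of_agree m l₁ l₃ h13 hlen3 hl hστ]
  refine (Finset.sum_le_sum hstep).trans ?_
  rw [← Finset.mul_sum]
  refine mul_le_mul_of_nonneg_left ?_ (disagree_nonneg hw _ _)
  exact Finset.sum_le_sum_of_subset_of_nonneg (Finset.subset_univ _) fun v _ _ =>
    mean_nonneg hw (pivotal_nonneg _ v)

/-- Each of the three subtrees contributes at most 24ε times its own expected number of pivotal
vertices, whence the factor 72ε per round. With no round only one vertex is pivotal. -/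
lemma pivotalSum_le (ha : a₀ ≠ a₁) (h0 : 0 ≤ eps β) (hε : eps β ≤ 1 / 75) (ht1 : 1 ≤ t)
    (ht2 : t ≤ 2) (m : ℕ) (l : List (Fin b)) (hl : l.length + 2 * m + t ≤ R) :
    pivotalSum R β a₀ a₁ t m l ≤ (72 * eps β) ^ m := by
  have hw : ∀ σ : TreeVertex b R → ℤˣ, 0 < freeWeight b R β σ := freeWeight_pos
  induction m generalizing l with
  | zero =>
    rw [pow_zero]
    set x := vtx b R (List.replicate t a₀ ++ l) with hx
    have h1 : ∀ v, mean (freeWeight b R β) (pivotal (recMaj R a₀ a₁ t 0 l) v)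
        ≤ if v = x then 1 else 0 := by
      intro v
      split_ifs with hv
      · refine (mean_mono hw (G := fun _ => 1) fun σ => ?_).trans_eq (mean_const hw 1)
        unfold pivotal
        split_ifs <;> norm_num
      · refine (mean_mono hw (G := fun _ => 0) fun σ => ?_).trans_eq (mean_const hw 0)
        unfold pivotal
        rw [if_neg]
        rw [not_not]
        exact Function.update_of_ne (Ne.symm hv) _ _
    refine (Finset.sum_le_sum fun v _ => h1 v).trans_eq ?_
    rw [Finset.sum_ite_eq' Finset.univ x, if_pos (Finset.mem_univ _)]
  | succ m ih =>
    have hlen : ∀ a a' : Fin b, (a :: a' :: l).length + 2 * m + t ≤ R := fun a a' => by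
      simp only [List.length_cons]
      omega
    have hd := fun c c' d d' => disagree_recMaj_le (β := β) (R := R) ha h0 hε ht1 ht2 m l hl c c' d d'
    set l₁ := a₀ :: a₀ :: l with hl₁
    set l₂ := a₁ :: a₀ :: l with hl₂
    set l₃ := a₀ :: a₁ :: l with hl₃
    have h12 : l₁ ≠ l₂ := fun h => ha (List.cons.inj h).1
    have h13 : l₁ ≠ l₃ := fun h => ha (List.cons.inj (List.cons.inj h).2).1
    have h23 : l₂ ≠ l₃ := fun h => ha (List.cons.inj h).1.symm
    have hF : ∀ σ, recMaj R a₀ a₁ t (m + 1) l σ = maj (recMaj R a₀ a₁ t m l₁ σ)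
        (recMaj R a₀ a₁ t m l₂ σ) (recMaj R a₀ a₁ t m l₃ σ) := fun σ => rfl
    have hmaj2 : ∀ x y z : ℤˣ, maj x y z = if x = z then x else y := by decide
    have hmaj3 : ∀ x y z : ℤˣ, maj x y z = if x = y then x else z := by decide
    have hpow : 0 ≤ (72 * eps β) ^ m := by positivity
    have bound : ∀ (c c' d d' : Fin b) (l' : List (Fin b)), l'.length + 2 * m + t ≤ R →
        disagree (freeWeight b R β) (recMaj R a₀ a₁ t m (c :: c' :: l))
          (recMaj R a₀ a₁ t m (d :: d' :: l)) * pivotalSum R β a₀ a₁ t m l'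
        ≤ 24 * eps β * (72 * eps β) ^ m := fun c c' d d' l' hl' =>
      mul_le_mul (hd c c' d d') (ih l' hl')
        (Finset.sum_nonneg fun v _ => mean_nonneg hw (pivotal_nonneg _ v)) (by positivity)
    have s1 := (sum_desc_pivotal_le (β := β) m h12 h13 rfl rfl (hlen _ _) (List.cons_ne_nil _ _)
      (fun σ => hF σ)).trans (bound a₁ a₀ a₀ a₁ l₁ (hlen _ _))
    have s2 := (sum_desc_pivotal_le (β := β) m h12.symm h23 rfl rfl (hlen _ _)
      (List.cons_ne_nil _ _) (fun σ => (hF σ).trans (hmaj2 _ _ _))).trans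
      (bound a₀ a₀ a₀ a₁ l₂ (hlen _ _))
    have s3 := (sum_desc_pivotal_le (β := β) m h13.symm h23.symm rfl rfl (hlen _ _)
      (List.cons_ne_nil _ _) (fun σ => (hF σ).trans (hmaj3 _ _ _))).trans
      (bound a₀ a₀ a₁ a₀ l₃ (hlen _ _))
    have hR1 : l₁.length ≤ R := by have : l₁.length + 2 * m + t ≤ R := hlen _ _; omega
    have hzero : ∀ v, v ∉ desc (vtx b R l₁) ∪ (desc (vtx b R l₂) ∪ desc (vtx b R l₃)) →
        mean (freeWeight b R β) (pivotal (recMaj R a₀ a₁ t (m + 1) l) v) = 0 := by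
      intro v hv
      simp only [Finset.mem_union, mem_desc, not_or] at hv
      rw [val_vtx hR1, val_vtx (l := l₂) hR1, val_vtx (l := l₃) hR1] at hv
      have : pivotal (recMaj R a₀ a₁ t (m + 1) l) v = fun _ => 0 := by
        funext σ
        unfold pivotal
        rw [if_neg]
        rw [not_not, hF, hF, pivotal_recMaj_of_ne m l₁ (hlen _ _) v fun h => hv.1 h.1,
          pivotal_recMaj_of_ne m l₂ (hlen _ _) v fun h => hv.2.1 h.1,
          pivotal_recMaj_of_ne m l₃ (hlen _ _) v fun h => hv.2.2 h.1]
      rw [this, mean_const hw]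
    have hsum : pivotalSum R β a₀ a₁ t (m + 1) l
        = ∑ v ∈ desc (vtx b R l₁), mean (freeWeight b R β) (pivotal (recMaj R a₀ a₁ t (m + 1) l) v)
        + (∑ v ∈ desc (vtx b R l₂),
            mean (freeWeight b R β) (pivotal (recMaj R a₀ a₁ t (m + 1) l) v)
        + ∑ v ∈ desc (vtx b R l₃),
            mean (freeWeight b R β) (pivotal (recMaj R a₀ a₁ t (m + 1) l) v)) := by
      rw [← Finset.sum_union (disjoint_desc_vtx h23 rfl hR1), ← Finset.sum_union]
      · exact (Finset.sum_subset (Finset.subset_univ _) fun v _ hv => hzero v hv).symm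
      · rw [Finset.disjoint_union_right]
        exact ⟨disjoint_desc_vtx h12 rfl hR1, disjoint_desc_vtx h13 rfl hR1⟩
    rw [hsum, pow_succ]
    linarith

/-- Recursive majority as a test function. -/
lemma one_le_treeRelaxationTime_mul (ha : a₀ ≠ a₁) (h0 : 0 ≤ eps β) (hε : eps β ≤ 1 / 75)
    (ht1 : 1 ≤ t) (ht2 : t ≤ 2) (m : ℕ) (hR : R = 2 * m + t) :
    1 ≤ treeRelaxationTime b R β * (4 * eps β * (72 * eps β) ^ m) := by
  obtain ⟨hτ, hP⟩ := treeRelaxationTime_spec b R β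
  set w := freeWeight b R β with hwdef
  have hw : ∀ σ, 0 < w σ := freeWeight_pos
  have hZ := sum_weight_pos hw
  have hl : ([] : List (Fin b)).length + 2 * m + t ≤ R := by simp [hR]
  set f := recMaj R a₀ a₁ t m ([] : List (Fin b)) with hf
  set F : (TreeVertex b R → ℤˣ) → ℝ := fun σ => ((f σ : ℤ) : ℝ) with hF
  have hodd : ∀ σ, F (-σ) = -F σ := by
    intro σ
    have : f (-σ) = -1 * f σ := recMaj_smul m _ hl (-1) fun x _ _ => by simp
    simp only [hF, this]
    push_cast
    ring
  have h1 : energy w Finset.univ F = ∑ σ, w σ := by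
    rw [hwdef, energy_univ_of_odd hodd]
    have : (fun σ => F σ ^ 2) = fun _ => 1 := by
      funext σ
      rcases units_cases (f σ) with h | h <;> simp [hF, h]
    rw [this, mean_const freeWeight_pos, mul_one]
  have hleaf : ∀ v : TreeVertex b R, energy w {v} F
      ≤ (∑ σ, w σ) * (4 * eps β * mean w (pivotal f v)) := by
    intro v
    by_cases hv : v.1.length = R
    · have hne : v.1 ≠ [] := by
        intro h
        rw [h, List.length_nil] at hv
        omega
      have hdesc : desc v = {v} := by
        ext x
        rw [mem_desc, Finset.mem_singleton]
        constructor
        · intro h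
          exact (Subtype.ext (h.eq_of_length (le_antisymm h.length_le (by rw [hv]; exact x.2)))).symm
        · rintro rfl
          exact List.suffix_rfl
      -- Guess for the conditional mean at a leaf: give it its parent's spin. The guess fails only
      -- if leaf and parent differ, with probability ε, and the leaf is pivotal. These events are
      -- independent and the squared error is at most 4.
      have hg : IndepOf {v} fun σ => F (Function.update σ v (σ (par v))) := by
        intro σ τ h
        have h2 : σ (par v) = τ (par v) := h _ (by simpa using par_ne_self hne)
        have : Function.update σ v (σ (par v)) = Function.update τ v (τ (par v)) := by
          funext x
          by_cases hx : x = v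
          · subst hx
            simp [h2]
          · simp [hx, h x (by simpa using hx)]
        simp only [this]
      have hpi : IndepOf (desc v) (pivotal f v) := by
        rw [hdesc]
        intro σ τ h
        by_cases hv2 : σ v = τ v
        · have : σ = τ := funext fun x => if hx : x = v then hx ▸ hv2 else h x (by simpa using hx)
          rw [this]
        · have hneg : τ v = -σ v := by
            rcases units_cases (σ v) with h1 | h1 <;> rcases units_cases (τ v) with h3 | h3 <;>
              simp_all
          have e1 : flipAt v σ = τ := by
            funext x
            unfold flipAt
            by_cases hx : x = v
            · subst hx
              simp [hneg]
            · simp [hx, h x (by simpa using hx)]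
          have e2 : flipAt v τ = σ := by
            funext x
            unfold flipAt
            by_cases hx : x = v
            · subst hx
              simp [hneg]
            · simp [hx, h x (by simpa using hx)]
          unfold pivotal
          rw [e1, e2]
          simp only [ne_comm]
      refine (energy_le hw hg F).trans ?_
      have h3 : mean w (fun σ => (if σ v ≠ σ (par v) then 1 else 0) * pivotal f v σ)
          = eps β * mean w (pivotal f v) := by
        rw [← disagree_edge (β := β) hne, disagree, hwdef, ← mean_mul_of_regraft hne _ hpi]
        intro σ τ
        have hinv := regraft_edge_invariant hne σ τ
        have hiff : ∀ x y : ℤˣ, (x ≠ y) = (x * y = -1) := by decide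
        simp only [hiff, hinv]
      rw [mul_assoc, ← h3, ← mean_const_mul, ← sum_weight_mul hw]
      refine Finset.sum_le_sum fun σ _ => mul_le_mul_of_nonneg_left ?_ (hw σ).le
      by_cases hs : σ v = σ (par v)
      · rw [← hs, Function.update_eq_self, sub_self]
        simp
      · have hfl : Function.update σ v (σ (par v)) = flipAt v σ := by
          unfold flipAt
          congr 1
          rcases units_cases (σ v) with h1 | h1 <;> rcases units_cases (σ (par v)) with h4 | h4 <;>
            simp_all
        rw [hfl, if_pos hs, one_mul]
        unfold pivotal
        by_cases hpv : f (flipAt v σ) = f σ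
        · simp [hF, hpv]
        · rw [if_pos hpv]
          rcases units_cases (f (flipAt v σ)) with h5 | h5 <;>
            rcases units_cases (f σ) with h6 | h6 <;> norm_num [hF, h5, h6]
    · rw [energy_eq_zero_of_indepOf hw]
      · have := mean_nonneg hw (pivotal_nonneg f v)
        positivity
      · intro σ τ h
        have : f σ = f τ := recMaj_congr m _ hl fun x _ hx => h x fun hxv => hv (by
          rw [← Finset.mem_singleton.1 hxv, hx, hR]
          simp)
        simp only [hF, this]
  have h2 : ∑ v, energy w {v} F ≤ (∑ σ, w σ) * (4 * eps β * (72 * eps β) ^ m) := by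
    refine (Finset.sum_le_sum fun v _ => hleaf v).trans ?_
    rw [← Finset.mul_sum, ← Finset.mul_sum]
    have := pivotalSum_le (β := β) ha h0 hε ht1 ht2 m [] hl
    exact mul_le_mul_of_nonneg_left (mul_le_mul_of_nonneg_left this (by positivity)) hZ.le
  have h3 := (hP F).trans (mul_le_mul_of_nonneg_left h2 hτ.le)
  change energy w Finset.univ F ≤ _ at h3
  rw [h1, mul_left_comm] at h3
  exact le_of_mul_le_mul_left (by simpa using h3) hZ

end Majority

/-! ### From bounds on the relaxation time to exponents. -/

section Exponents

variable {b : ℕ} {β : ℝ}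

lemma log_one_div_eps (β : ℝ) : Real.log (1 / eps β) = Real.log (1 + Real.exp (2 * β)) := by
  unfold eps
  rw [one_div, inv_inv]

lemma eps_pos (β : ℝ) : 0 < eps β := by
  unfold eps
  positivity

lemma eps_le_half (hβ : 0 ≤ β) : eps β ≤ 1 / 2 := by
  unfold eps
  rw [one_div]
  have := Real.one_le_exp (x := 2 * β) (by linarith)
  exact inv_anti₀ (by norm_num) (by linarith)

lemma two_mul_le_log_one_div_eps (β : ℝ) : 2 * β ≤ Real.log (1 / eps β) := by
  rw [log_one_div_eps, Real.le_log_iff_exp_le (by positivity)]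
  linarith

lemma log_two_le_log_one_div_eps (hβ : 0 ≤ β) : Real.log 2 ≤ Real.log (1 / eps β) := by
  rw [log_one_div_eps]
  have := Real.one_le_exp (x := 2 * β) (by linarith)
  exact Real.log_le_log (by norm_num) (by linarith)

lemma log_treeSize_le (hb : 2 ≤ b) (r : ℕ) :
    Real.log (treeSize b r) ≤ (r + 1) * Real.log b := by
  have h : (treeSize b r : ℝ) ≤ (b : ℝ) ^ (r + 1) := by exact_mod_cast treeSize_le hb r
  have h0 : (0 : ℝ) < treeSize b r := by exact_mod_cast treeSize_pos b r
  have := Real.log_le_log h0 h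
  rwa [Real.log_pow, Nat.cast_add, Nat.cast_one] at this

lemma mul_log_le_log_treeSize (hb : 2 ≤ b) (r : ℕ) :
    r * Real.log b ≤ Real.log (treeSize b r) := by
  have h : (b : ℝ) ^ r ≤ treeSize b r := by exact_mod_cast pow_le_treeSize (b := b) r
  have h0 : (0 : ℝ) < b := by
    have : 0 < b := by omega
    exact_mod_cast this
  have := Real.log_le_log (by positivity) h
  rwa [Real.log_pow] at this

lemma log_branching_pos (hb : 2 ≤ b) : 0 < Real.log b :=
  Real.log_pos (by have : 1 < b := by omega
                   exact_mod_cast this)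

lemma treeRelaxationTime_zero_le (b : ℕ) (β : ℝ) : treeRelaxationTime b 0 β ≤ 1 := by
  refine treeRelaxationTime_le one_pos ?_
  have h := blockPoincare_exp_card (p := par) (J := treeCoupling (b := b) (r := 0) β)
    (H := fun _ => 0) Finset.univ
  rwa [Finset.sum_eq_zero, mul_zero, Real.exp_zero] at h
  intro v _
  have hv : v.1 = [] := List.length_eq_zero_iff.1 (by have := v.2; omega)
  simp [treeCoupling, hv]

lemma treeRelaxationTime_one_le (hb : 2 ≤ b) (hβ : 0 ≤ β) :
    treeRelaxationTime b 1 β ≤ Real.exp (2 * β * b ^ 2) := by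
  refine (treeRelaxationTime_le (Real.exp_pos _) (blockPoincare_exp_card Finset.univ)).trans ?_
  rw [Real.exp_le_exp]
  have h1 : ∑ v : TreeVertex b 1, |treeCoupling β v| ≤ ∑ _v : TreeVertex b 1, β := by
    refine Finset.sum_le_sum fun v _ => ?_
    unfold treeCoupling
    split_ifs
    · simpa using hβ
    · rw [abs_of_nonneg hβ]
  have h2 : ∑ _v : TreeVertex b 1, β = treeSize b 1 * β := by
    rw [Finset.sum_const, nsmul_eq_mul]
    rfl
  have h3 : (treeSize b 1 : ℝ) ≤ (b : ℝ) ^ 2 := by exact_mod_cast treeSize_le hb 1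
  have h4 := mul_le_mul_of_nonneg_right h3 hβ
  linarith

lemma log_treeRelaxationTime_add_le (b r s : ℕ) (hβ : 0 ≤ β) :
    Real.log (treeRelaxationTime b (r + s) β)
      ≤ Real.log 2 + 2 * β + Real.log (treeRelaxationTime b r β)
        + Real.log (treeRelaxationTime b s β) := by
  have hr := one_le_treeRelaxationTime b r β
  have hs := one_le_treeRelaxationTime b s β
  have hrs := one_le_treeRelaxationTime b (r + s) β
  have h := Real.log_le_log (by linarith) (treeRelaxationTime_add_le b r s hβ)
  rw [Real.log_mul (by positivity) (by positivity), Real.log_mul (by norm_num) (by positivity),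
    Real.log_mul (by positivity) (by positivity), Real.log_exp] at h
  linarith

/-- One level at a time: each costs at most log 2 + 2β + 2β b², and both log 2 and 2β are at most
log (1/ε). -/
lemma log_treeRelaxationTime_le (hb : 2 ≤ b) (hβ : 0 ≤ β) (r : ℕ) :
    Real.log (treeRelaxationTime b r β) ≤ r * ((2 + b ^ 2) * Real.log (1 / eps β)) := by
  induction r with
  | zero =>
    have h := one_le_treeRelaxationTime b 0 β
    have := Real.log_le_log (by linarith) (treeRelaxationTime_zero_le b β)
    simpa using this
  | succ r ih =>
    have h := one_le_treeRelaxationTime b 1 β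
    have h1 := Real.log_le_log (by linarith) (treeRelaxationTime_one_le hb hβ)
    rw [Real.log_exp] at h1
    have h2 := mul_le_mul_of_nonneg_right (two_mul_le_log_one_div_eps β) (sq_nonneg (b : ℝ))
    have h3 := log_treeRelaxationTime_add_le b r 1 hβ
    have h4 := two_mul_le_log_one_div_eps β
    have h5 := log_two_le_log_one_div_eps hβ
    push_cast
    linarith

lemma treeRelaxationTime_le_rpow (hb : 2 ≤ b) :
    ∃ C : ℝ, 0 < C ∧ ∀ β : ℝ, 0 ≤ β → ∀ r : ℕ,
      treeRelaxationTime b r β ≤ (treeSize b r : ℝ) ^ (C * Real.log (1 / eps β)) := by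
  have hlb := log_branching_pos hb
  refine ⟨(2 + b ^ 2) / Real.log b, by positivity, fun β hβ r => ?_⟩
  have hL : 0 ≤ Real.log (1 / eps β) := (by positivity : (0 : ℝ) ≤ 2 * β).trans
    (two_mul_le_log_one_div_eps β)
  have hn : (0 : ℝ) < treeSize b r := by exact_mod_cast treeSize_pos b r
  have hτ := one_le_treeRelaxationTime b r β
  rw [Real.le_rpow_iff_log_le (by linarith) hn]
  calc Real.log (treeRelaxationTime b r β)
      ≤ r * ((2 + b ^ 2) * Real.log (1 / eps β)) := log_treeRelaxationTime_le hb hβ r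
    _ = (2 + b ^ 2) / Real.log b * Real.log (1 / eps β) * (r * Real.log b) := by
      field_simp
    _ ≤ _ := mul_le_mul_of_nonneg_left (mul_log_le_log_treeSize hb r) (by positivity)

lemma tendsto_log_treeSize_div (hb : 2 ≤ b) :
    Tendsto (fun r : ℕ => Real.log (treeSize b r) / r) atTop (𝓝 (Real.log b)) := by
  have hlim : Tendsto (fun r : ℕ => Real.log b + Real.log b / (r : ℝ)) atTop (𝓝 (Real.log b)) := by
    simpa using (tendsto_const_nhds (x := Real.log b)).add
      (tendsto_const_div_atTop_nhds_zero_nat (Real.log b))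
  refine tendsto_of_tendsto_of_tendsto_of_le_of_le' tendsto_const_nhds hlim ?_ ?_
  · filter_upwards [eventually_gt_atTop 0] with r hr
    have hr' : (0 : ℝ) < r := by exact_mod_cast hr
    rw [le_div_iff₀ hr', mul_comm]
    exact mul_log_le_log_treeSize hb r
  · filter_upwards [eventually_gt_atTop 0] with r hr
    have hr' : (0 : ℝ) < r := by exact_mod_cast hr
    rw [div_le_iff₀ hr', add_mul, div_mul_cancel₀ _ hr'.ne']
    linarith [log_treeSize_le hb r]

/-- Fekete's lemma: adding `κ` to log τ absorbs the constant in the submultiplicative inequality,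
and log n_r is asymptotic to r log b. -/
lemma exists_tendsto_log_treeRelaxationTime (hb : 2 ≤ b) (hβ : 0 ≤ β) :
    ∃ d : ℝ, Tendsto (fun r : ℕ => Real.log (treeRelaxationTime b r β)
      / Real.log (treeSize b r : ℝ)) atTop (𝓝 d) := by
  set κ := Real.log 2 + 2 * β with hκ
  have hκ0 : 0 ≤ κ := add_nonneg (Real.log_nonneg (by norm_num)) (by linarith)
  set u : ℕ → ℝ := fun r => Real.log (treeRelaxationTime b r β) + κ with hu
  have hsub : Subadditive u := fun r s => by
    have := log_treeRelaxationTime_add_le b r s hβ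
    simp only [hu]
    linarith
  have hbdd : BddBelow (Set.range fun r => u r / r) := by
    refine ⟨0, ?_⟩
    rintro _ ⟨r, rfl⟩
    exact div_nonneg (add_nonneg (Real.log_nonneg (one_le_treeRelaxationTime b r β)) hκ0)
      (Nat.cast_nonneg r)
  have h1 := hsub.tendsto_lim hbdd
  have h2 : Tendsto (fun r : ℕ => Real.log (treeRelaxationTime b r β) / r) atTop
      (𝓝 hsub.lim) := by
    have := h1.sub (tendsto_const_div_atTop_nhds_zero_nat κ)
    rw [sub_zero] at this
    refine this.congr fun r => ?_
    simp only [hu]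
    ring
  refine ⟨hsub.lim / Real.log b, (h2.div (tendsto_log_treeSize_div hb)
    (log_branching_pos hb).ne').congr' ?_⟩
  filter_upwards [eventually_gt_atTop 0] with r hr
  have hr' : (r : ℝ) ≠ 0 := by exact_mod_cast hr.ne'
  exact div_div_div_cancel_right₀ hr' _ _

lemma pow_le_treeRelaxationTime (hb : 2 ≤ b) (hβ : 0 ≤ β) (r : ℕ) :
    ((b : ℝ) * (1 - 2 * eps β) ^ 2) ^ r ≤ treeRelaxationTime b r β := by
  have hb0 : 0 < b := by omega
  have hb' : (0 : ℝ) < b := by exact_mod_cast hb0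
  have h1 : eps β ≤ 1 := (eps_le_half hβ).trans (by norm_num)
  exact le_of_mul_le_mul_right ((levelMoment_lower hb0 (eps_pos β).le h1 le_rfl).trans
    (levelMoment_le_treeRelaxationTime b r β)) (pow_pos hb' r)

lemma one_lt_branching_mul_sq (hb : 2 ≤ b) (h : 1 / Real.sqrt b < 1 - 2 * eps β) :
    1 < (b : ℝ) * (1 - 2 * eps β) ^ 2 := by
  have hb' : (0 : ℝ) < b := by
    have : 0 < b := by omega
    exact_mod_cast this
  have hs := Real.sqrt_pos.2 hb'
  have h2 : (1 / Real.sqrt b) ^ 2 < (1 - 2 * eps β) ^ 2 :=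
    pow_lt_pow_left₀ h (by positivity) two_ne_zero
  rw [div_pow, Real.sq_sqrt hb'.le, one_pow, div_lt_iff₀ hb'] at h2
  linarith

lemma branching_mul_sq_eq_one (hb : 2 ≤ b) (h : 1 - 2 * eps β = 1 / Real.sqrt b) :
    (b : ℝ) * (1 - 2 * eps β) ^ 2 = 1 := by
  have hb' : (0 : ℝ) < b := by
    have : 0 < b := by omega
    exact_mod_cast this
  rw [h, div_pow, Real.sq_sqrt hb'.le]
  field_simp

lemma mul_rpow_le_treeRelaxationTime (hb : 2 ≤ b) (hβ : 0 ≤ β)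
    (h : 1 / Real.sqrt b < 1 - 2 * eps β) :
    ∃ c : ℝ, 0 < c ∧ ∀ r : ℕ, c * (treeSize b r : ℝ) ^ Real.logb b (b * (1 - 2 * eps β) ^ 2)
      ≤ treeRelaxationTime b r β := by
  have hb1 : (1 : ℝ) < b := by
    have : 1 < b := by omega
    exact_mod_cast this
  have hx := one_lt_branching_mul_sq hb h
  set x := (b : ℝ) * (1 - 2 * eps β) ^ 2 with hxdef
  have hx0 : 0 < x := by linarith
  -- The factor `x⁻¹` pays for the extra level in n_r ≤ b^(r+1).
  refine ⟨x⁻¹, by positivity, fun r => le_trans ?_ (pow_le_treeRelaxationTime hb hβ r)⟩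
  rw [← hxdef, inv_mul_le_iff₀ hx0, ← pow_succ']
  have hn : (treeSize b r : ℝ) ≤ (b : ℝ) ^ (r + 1) := by exact_mod_cast treeSize_le hb r
  calc (treeSize b r : ℝ) ^ Real.logb b x ≤ ((b : ℝ) ^ (r + 1)) ^ Real.logb b x :=
        Real.rpow_le_rpow (Nat.cast_nonneg _) hn (Real.logb_nonneg hb1 hx.le)
    _ = ((b : ℝ) ^ Real.logb b x) ^ (r + 1) := by
        rw [← Real.rpow_natCast_mul (by linarith), mul_comm, Real.rpow_mul_natCast (by linarith)]
    _ = x ^ (r + 1) := by rw [Real.rpow_logb (by linarith) hb1.ne' hx0]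

lemma one_add_half_le_treeRelaxationTime (hb : 2 ≤ b)
    (h : 1 - 2 * eps β = 1 / Real.sqrt b) (r : ℕ) :
    1 + r / 2 ≤ treeRelaxationTime b r β := by
  have hb2 : (2 : ℝ) ≤ b := by exact_mod_cast hb
  have h1 := branching_mul_sq_eq_one hb h
  -- At criticality θ² = 1/b ≤ 1/2, so the linear growth rate 1 - θ² is at least 1/2.
  have hle : (1 - 2 * eps β) ^ 2 ≤ 1 / 2 := by
    nlinarith [sq_nonneg (1 - 2 * eps β)]
  have h2 := levelMoment_le_treeRelaxationTime b r β
  rw [levelMoment_critical h1 le_rfl] at h2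
  have h3 := le_of_mul_le_mul_right h2 (by positivity)
  have h4 : (r : ℝ) * (1 / 2) ≤ r * (1 - (1 - 2 * eps β) ^ 2) :=
    mul_le_mul_of_nonneg_left (by linarith) (Nat.cast_nonneg r)
  linarith

lemma mul_log_le_treeRelaxationTime (hb : 2 ≤ b) (h : 1 - 2 * eps β = 1 / Real.sqrt b) :
    ∃ c : ℝ, 0 < c ∧ ∀ r : ℕ, c * Real.log (treeSize b r : ℝ) ≤ treeRelaxationTime b r β := by
  have hlb := log_branching_pos hb
  refine ⟨1 / (2 * Real.log b), by positivity, fun r => ?_⟩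
  have h1 := one_add_half_le_treeRelaxationTime hb h r
  rw [div_mul_eq_mul_div, one_mul, div_le_iff₀ (by positivity)]
  have h2 := log_treeSize_le hb r
  have h3 : (1 + r / 2) * (2 * Real.log b) ≤ treeRelaxationTime b r β * (2 * Real.log b) :=
    mul_le_mul_of_nonneg_right h1 (by positivity)
  nlinarith

lemma not_bddAbove_treeRelaxationTime (hb : 2 ≤ b) (hβ : 0 ≤ β)
    (h : 1 / Real.sqrt b ≤ 1 - 2 * eps β) :
    ¬ BddAbove (Set.range fun r : ℕ => treeRelaxationTime b r β) := by
  rintro ⟨K, hK⟩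
  have hK' : ∀ r, treeRelaxationTime b r β ≤ K := fun r => hK ⟨r, rfl⟩
  rcases h.lt_or_eq with h | h
  · obtain ⟨r, hr⟩ := pow_unbounded_of_one_lt K (one_lt_branching_mul_sq hb h)
    linarith [pow_le_treeRelaxationTime hb hβ r, hK' r]
  · obtain ⟨r, hr⟩ := exists_nat_gt (2 * K)
    linarith [one_add_half_le_treeRelaxationTime hb h.symm r, hK' r]

/-- The threshold is 1/72², so that 72ε ≤ √ε. The majority bound then reads τ ≥ ε^(-(m+1)/2), and r
≤ 2 (m + 1) gives the factor 1/4. -/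
lemma log_treeRelaxationTime_ge (hb : 2 ≤ b) (hε : eps β < 1 / 5184) {r : ℕ} (hr : 0 < r) :
    r * (Real.log (1 / eps β) / 4) ≤ Real.log (treeRelaxationTime b r β) := by
  have h0 := eps_pos β
  obtain ⟨m, t, ht1, ht2, rfl⟩ : ∃ m t, 1 ≤ t ∧ t ≤ 2 ∧ r = 2 * m + t :=
    ⟨(r - 1) / 2, r - 2 * ((r - 1) / 2), by omega, by omega, by omega⟩
  have ha : (⟨0, by omega⟩ : Fin b) ≠ ⟨1, by omega⟩ := by simp
  have h1 := one_le_treeRelaxationTime_mul (β := β) ha h0.le (by linarith) ht1 ht2 m rfl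
  set τ := treeRelaxationTime b (2 * m + t) β
  have hτ : 1 ≤ τ := one_le_treeRelaxationTime b _ β
  set s := Real.sqrt (eps β) with hs
  have hs0 : 0 < s := Real.sqrt_pos.2 h0
  have hss : s * s = eps β := Real.mul_self_sqrt h0.le
  have hs72 : s ≤ 1 / 72 := by
    rw [hs, Real.sqrt_le_left (by norm_num)]
    linarith
  have h4 : 4 * eps β ≤ s := by nlinarith
  have h72 : 72 * eps β ≤ s := by nlinarith
  have h2 : 4 * eps β * (72 * eps β) ^ m ≤ s ^ (m + 1) := by
    rw [pow_succ']
    exact mul_le_mul h4 (pow_le_pow_left₀ (by positivity) h72 m) (by positivity) hs0.le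
  have h3 : 1 ≤ τ * s ^ (m + 1) := h1.trans (mul_le_mul_of_nonneg_left h2 (by linarith))
  have h5 := Real.log_nonneg h3
  rw [Real.log_mul (by positivity) (by positivity), Real.log_pow, hs, Real.log_sqrt h0.le] at h5
  have hL : 0 ≤ -Real.log (eps β) := neg_nonneg.2 (Real.log_nonpos h0.le (by linarith))
  rw [one_div, Real.log_inv]
  have ht : (t : ℝ) ≤ 2 := by exact_mod_cast ht2
  have h6 := mul_le_mul_of_nonneg_right ht hL
  push_cast at h5 ⊢
  nlinarith

/-- The constant 8 combines the 1/4 above with r + 1 ≤ 2 r. That fails for r = 0, where n_0 = 1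
makes the left side vanish. -/
lemma mul_log_treeSize_le_log_treeRelaxationTime (hb : 2 ≤ b) (hβ : 0 ≤ β)
    (hε : eps β < 1 / 5184) (r : ℕ) :
    1 / (8 * Real.log b) * Real.log (1 / eps β) * Real.log (treeSize b r)
      ≤ Real.log (treeRelaxationTime b r β) := by
  have hlb := log_branching_pos hb
  have hL : 0 ≤ Real.log (1 / eps β) := (by positivity : (0 : ℝ) ≤ 2 * β).trans
    (two_mul_le_log_one_div_eps β)
  rcases Nat.eq_zero_or_pos r with rfl | hr
  · have h1 : treeSize b 0 = 1 := by
      have : Subsingleton (TreeVertex b 0) := ⟨fun v w => Subtype.ext (by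
        rw [List.length_eq_zero_iff.1 (Nat.le_zero.1 v.2),
          List.length_eq_zero_iff.1 (Nat.le_zero.1 w.2)])⟩
      exact le_antisymm (Fintype.card_le_one_iff_subsingleton.2 this) (treeSize_pos b 0)
    rw [h1, Nat.cast_one, Real.log_one, mul_zero]
    exact Real.log_nonneg (one_le_treeRelaxationTime b 0 β)
  · refine le_trans ?_ (log_treeRelaxationTime_ge hb hε hr)
    have hr' : (1 : ℝ) ≤ r := by exact_mod_cast hr
    calc _ ≤ 1 / (8 * Real.log b) * Real.log (1 / eps β) * ((r + 1) * Real.log b) :=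
          mul_le_mul_of_nonneg_left (log_treeSize_le hb r) (by positivity)
      _ ≤ 1 / (8 * Real.log b) * Real.log (1 / eps β) * ((2 * r) * Real.log b) := by
          gcongr
          linarith
      _ = _ := by
          generalize Real.log (1 / eps β) = L
          field_simp
          ring

lemma rpow_le_treeRelaxationTime (hb : 2 ≤ b) :
    ∃ c : ℝ, 0 < c ∧ ∃ ε₀ : ℝ, 0 < ε₀ ∧ ∀ β : ℝ, 0 ≤ β → eps β < ε₀ → ∀ r : ℕ,
      (treeSize b r : ℝ) ^ (c * Real.log (1 / eps β)) ≤ treeRelaxationTime b r β := by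
  have hlb := log_branching_pos hb
  refine ⟨1 / (8 * Real.log b), by positivity, 1 / 5184, by norm_num, fun β hβ hε r => ?_⟩
  have hn : (0 : ℝ) < treeSize b r := by exact_mod_cast treeSize_pos b r
  have hτ := one_le_treeRelaxationTime b r β
  rw [← Real.log_le_log_iff (Real.rpow_pos_of_pos hn _) (by linarith), Real.log_rpow hn]
  exact mul_log_treeSize_le_log_treeRelaxationTime hb hβ hε r

lemma tendsto_log_one_div_eps : Tendsto (fun β => Real.log (1 / eps β)) atTop atTop :=
  tendsto_atTop_mono two_mul_le_log_one_div_eps (tendsto_id.const_mul_atTop two_pos)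

lemma tendsto_atTop_of_tendsto_log_treeRelaxationTime (hb : 2 ≤ b) (d : ℝ → ℝ)
    (hd : ∀ β : ℝ, 0 ≤ β → Tendsto (fun r : ℕ => Real.log (treeRelaxationTime b r β)
      / Real.log (treeSize b r : ℝ)) atTop (𝓝 (d β))) :
    Tendsto d atTop atTop := by
  have hlb := log_branching_pos hb
  have hlim : Tendsto (fun β => 1 / (8 * Real.log b) * Real.log (1 / eps β)) atTop atTop :=
    tendsto_log_one_div_eps.const_mul_atTop (by positivity)
  refine tendsto_atTop_mono' _ ?_ hlim
  filter_upwards [eventually_ge_atTop 0, tendsto_log_one_div_eps.eventually_gt_atTop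
    (Real.log 5184)] with β hβ hL
  have hε : eps β < 1 / 5184 := by
    have h0 := eps_pos β
    rw [Real.log_lt_log_iff (by norm_num) (by positivity)] at hL
    rw [lt_div_iff₀ h0] at hL
    linarith
  refine ge_of_tendsto (hd β hβ) ?_
  filter_upwards [eventually_gt_atTop 0] with r hr
  have hr' : (0 : ℝ) < r := by exact_mod_cast hr
  have hn : 0 < Real.log (treeSize b r) :=
    lt_of_lt_of_le (by positivity) (mul_log_le_log_treeSize hb r)
  rw [le_div_iff₀ hn]
  exact mul_log_treeSize_le_log_treeRelaxationTime hb hβ hε r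

end Exponents

end

theorem theorem1 (b : ℕ) (hb : 2 ≤ b) :
    -- polynomial upper bound at all temperatures, with exponent `O(log (1/ε))`
    (∃ C : ℝ, 0 < C ∧ ∀ β : ℝ, 0 ≤ β → ∀ r : ℕ,
      treeRelaxationTime b r β ≤ (treeSize b r : ℝ) ^ (C * Real.log (1 / eps β))) ∧
    -- the limiting exponent exists
    (∀ β : ℝ, 0 ≤ β → ∃ d : ℝ,
      Tendsto (fun r : ℕ => Real.log (treeRelaxationTime b r β) / Real.log (treeSize b r : ℝ))
        atTop (𝓝 d)) ∧
    -- low temperatures: the relaxation time is unbounded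
    (∀ β : ℝ, 0 ≤ β → 1 / Real.sqrt b ≤ 1 - 2 * eps β →
      ¬ BddAbove (Set.range fun r : ℕ => treeRelaxationTime b r β)) ∧
    (∀ β : ℝ, 0 ≤ β → 1 / Real.sqrt b < 1 - 2 * eps β →
      ∃ c : ℝ, 0 < c ∧ ∀ r : ℕ,
        c * (treeSize b r : ℝ) ^ Real.logb b (b * (1 - 2 * eps β) ^ 2)
          ≤ treeRelaxationTime b r β) ∧
    (∀ β : ℝ, 0 ≤ β → 1 - 2 * eps β = 1 / Real.sqrt b →
      ∃ c : ℝ, 0 < c ∧ ∀ r : ℕ,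
        c * Real.log (treeSize b r : ℝ) ≤ treeRelaxationTime b r β) ∧
    -- as `ε → 0`, the exponent is at least of order `log (1/ε)`, and the degree tends to infinity
    (∃ c : ℝ, 0 < c ∧ ∃ ε₀ : ℝ, 0 < ε₀ ∧ ∀ β : ℝ, 0 ≤ β → eps β < ε₀ → ∀ r : ℕ,
      (treeSize b r : ℝ) ^ (c * Real.log (1 / eps β)) ≤ treeRelaxationTime b r β) ∧
    (∀ d : ℝ → ℝ,
      (∀ β : ℝ, 0 ≤ β → Tendsto
        (fun r : ℕ => Real.log (treeRelaxationTime b r β) / Real.log (treeSize b r : ℝ))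
        atTop (𝓝 (d β))) →
      Tendsto d atTop atTop) ∧
    -- intermediate and high temperatures: bounded, uniformly in the external field
    (∀ β : ℝ, 0 ≤ β → 1 - 2 * eps β < 1 / Real.sqrt b →
      ∃ C : ℝ, ∀ (r : ℕ) (H : TreeVertex b r → ℝ),
        relaxationTime (tree b r) β H ≤ C) := by
  refine ⟨treeRelaxationTime_le_rpow hb, fun β hβ => exists_tendsto_log_treeRelaxationTime hb hβ,
    fun β hβ h => not_bddAbove_treeRelaxationTime hb hβ h,
    fun β hβ h => mul_rpow_le_treeRelaxationTime hb hβ h,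
    fun β _ h => mul_log_le_treeRelaxationTime hb h, rpow_le_treeRelaxationTime hb,
    fun d hd => tendsto_atTop_of_tendsto_log_treeRelaxationTime hb d hd,
    fun β hβ h => relaxationTime_bounded_of_lt hb hβ h⟩
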